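/- Let $d\ge 1$, let $E\subset[1,2]$ be a nonempty set of upper Minkowski dimension $\beta$, i.e. $\limsup_{\delta\to 0^+}\frac{\log N(E,\delta)}{\log(1/\delta)}=\beta$, where $N(E,\delta)$ is the minimal number of closed intervals of length $\delta$ covering $E$, and let $\mu$ be a compactly supported finite (nonnegative) Borel measure on $\mathbb{R}^{2d}$. Suppose that $\hat\mu$ is $a$-admissible, i.e. $a>\frac d2$ and there is a constant $C$ with $|\hat\mu(\xi,\eta)|\le C(1+|\xi|+|\eta|)^{-a}$ for all $\xi,\eta\in\mathbb{R}^d$, and that $2a>d+\beta$. For bounded measurable $m:\mathbb{R}^{2d}\to\mathbb{C}$, $t>0$ and $f,g\in C_0^\infty(\mathbb{R}^d)$ put $$T_m(f,g)(x)=\int_{\mathbb{R}^{2d}}\hat f(\xi)\hat g(\eta)m(\xi,\eta)e^{2\pi i x\cdot(\xi+\eta)}\,d\xi\,d\eta,\qquad m_t(\xi,\eta)=m(t\xi,t\eta),$$ $$\mathcal{A}_{m,E}(f,g)(x)=\sup_{t\in E}|T_{m_t}(f,g)(x)|,\qquad \mathcal{M}_{m,E}(f,g)(x)=\sup_{l\in\mathbb{Z}}\sup_{t\in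 E}|T_{m_{t2^l}}(f,g)(x)|.$$ Let $\mathcal{R}(\mu,E)\subset\mathbb{R}^3$ be the set of all $(1/p,1/q,1/r)$ with $1\le p,q\le\infty$, $r>0$, $1/p+1/q\ge 1/r$ such that $\|\mathcal{A}_{\hat\mu,E}(f,g)\|_{L^r}\le C\|f\|_{L^p}\|g\|_{L^q}$ for all $f,g\in C_0^\infty(\mathbb{R}^d)$, with $C$ independent of $f,g$. Then for every $(1/p,1/q,1/r)$ in the interior of $\mathcal{R}(\mu,E)$ with $r>1$ and $p,q\le r$, the operator $\mathcal{M}_{\hat\mu,E}$ has $(p,q,r')$ sparse domination, where $\frac1r+\frac1{r'}=1$. That is, there are $\eta\in(0,1]$ and $C<\infty$ such that for all $f,g,h\in C_0^\infty(\mathbb{R}^d)$ the function $\mathcal{M}_{\hat\mu,E}(f,g)$ is finite almost everywhere, $\mathcal{M}_{\hat\mu,E}(f,g)\,\overline h$ is integrable, and there is an $\eta$-sparse collection $\mathcal{S}$ of cubes in $\mathbb{R}^d$ with $$|\langle\mathcal{M}_{\hat\mu,E}(f,g),h\rangle|\le C\sum_{Q\in\mathcal{S}}|Q|\,\langle f\rangle_{Q,p}\,\langle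 g\rangle_{Q,q}\,\langle h\rangle_{Q,r'},\qquad \langle f\rangle_{Q,p}=\Big(\frac1{|Q|}\int_Q|f|^p\Big)^{1/p}.$$ Here $\langle F,h\rangle=\int_{\mathbb{R}^d}F\,\overline h$, and $\mathcal{S}$ is $\eta$-sparse if every $Q\in\mathcal{S}$ has a measurable subset $E_Q\subset Q$ with $|E_Q|\ge\eta|Q|$ and the sets $E_Q$ are pairwise disjoint. -/

import Mathlib

open MeasureTheory Filter Topology
open scoped ENNReal NNReal FourierTransform ComplexConjugate

noncomputable section

namespace BilinearSparse

/-- The Euclidean space `ℝᵈ`. The space `ℝ²ᵈ` is written as the product `Rd d × Rd d`. -/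
abbrev Rd (d : ℕ) : Type := EuclideanSpace ℝ (Fin d)

/-- `f ∈ C₀^∞(ℝᵈ)`: smooth, complex valued, compactly supported. -/
def IsTestFunction {d : ℕ} (f : Rd d → ℂ) : Prop :=
  ContDiff ℝ (⊤ : ℕ∞) f ∧ HasCompactSupport f

/-- The minimal number `N(E, δ)` of closed intervals of length `δ` needed to cover `E`. -/
def intervalCoveringNumber (E : Set ℝ) (δ : ℝ) : ℕ :=
  sInf {n : ℕ | ∃ c : Fin n → ℝ, E ⊆ ⋃ i, Set.Icc (c i) (c i + δ)}

/-- The upper Minkowski dimension `limsup_{δ → 0⁺} log N(E, δ) / log (1 / δ)`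
(used for bounded nonempty sets `E ⊆ ℝ`). -/
def upperMinkowskiDim (E : Set ℝ) : EReal :=
  limsup (fun δ : ℝ =>
    ((Real.log (intervalCoveringNumber E δ) / Real.log (1 / δ) : ℝ) : EReal)) (𝓝[>] (0 : ℝ))

/-- The measure `μ` on `ℝ²ᵈ` is carried by a compact set. -/
def IsCompactlySupported {d : ℕ} (μ : Measure (Rd d × Rd d)) : Prop :=
  ∃ K : Set (Rd d × Rd d), IsCompact K ∧ μ Kᶜ = 0

/-- The Fourier transform `μ̂(ξ, η) = ∫ exp(-2πi (y·ξ + z·η)) dμ(y, z)`. -/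
def fourierMeasure {d : ℕ} (μ : Measure (Rd d × Rd d)) (ζ : Rd d × Rd d) : ℂ :=
  ∫ w : Rd d × Rd d,
    Complex.exp (-(2 * Real.pi * Complex.I) * ((inner ℝ w.1 ζ.1 + inner ℝ w.2 ζ.2 : ℝ) : ℂ)) ∂μ

/-- `μ̂` is `a`-admissible: `a > d / 2` and `|μ̂(ξ, η)| ≲ (1 + |ξ| + |η|)^(-a)`. -/
def IsAdmissible {d : ℕ} (μ : Measure (Rd d × Rd d)) (a : ℝ) : Prop :=
  (d : ℝ) / 2 < a ∧
    ∃ C : ℝ, ∀ ξ η : Rd d, ‖fourierMeasure μ (ξ, η)‖ ≤ C / (1 + ‖ξ‖ + ‖η‖) ^ a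

/-- The bilinear multiplier operator
`T_m(f, g)(x) = ∫ f̂(ξ) ĝ(η) m(ξ, η) exp(2πi x·(ξ + η)) dξ dη`. -/
def bilinearMultiplier {d : ℕ} (m : Rd d × Rd d → ℂ) (f g : Rd d → ℂ) (x : Rd d) : ℂ :=
  ∫ ζ : Rd d × Rd d, 𝓕 f ζ.1 * 𝓕 g ζ.2 * m ζ *
    Complex.exp (2 * Real.pi * Complex.I * ((inner ℝ x (ζ.1 + ζ.2) : ℝ) : ℂ))

/-- The dilated multiplier `m_t(ξ, η) = m(tξ, tη)`. -/
def dilate {d : ℕ} (m : Rd d × Rd d → ℂ) (t : ℝ) (ζ : Rd d × Rd d) : ℂ :=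
  m (t • ζ.1, t • ζ.2)

/-- The single-scale maximal operator `A_{m,E}(f, g)(x) = sup_{t ∈ E} |T_{m_t}(f, g)(x)|`. -/
def singleScaleMaximal {d : ℕ} (m : Rd d × Rd d → ℂ) (E : Set ℝ) (f g : Rd d → ℂ)
    (x : Rd d) : ℝ≥0∞ :=
  ⨆ t ∈ E, ‖bilinearMultiplier (dilate m t) f g x‖ₑ

/-- The multi-scale maximal operator
`M_{m,E}(f, g)(x) = sup_{l ∈ ℤ} sup_{t ∈ E} |T_{m_{t 2^l}}(f, g)(x)|`. -/
def multiScaleMaximal {d : ℕ} (m : Rd d × Rd d → ℂ) (E : Set ℝ) (f g : Rd d → ℂ)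
    (x : Rd d) : ℝ≥0∞ :=
  ⨆ l : ℤ, ⨆ t ∈ E, ‖bilinearMultiplier (dilate m (t * (2 : ℝ) ^ l)) f g x‖ₑ

/-- `B : L^p × L^q → L^r` is bounded, as an inequality on `C₀^∞ × C₀^∞`. -/
def IsBoundedBilinear {d : ℕ} (B : (Rd d → ℂ) → (Rd d → ℂ) → Rd d → ℝ≥0∞)
    (p q r : ℝ≥0∞) : Prop :=
  ∃ C : ℝ≥0, ∀ f g : Rd d → ℂ, IsTestFunction f → IsTestFunction g →
    eLpNorm (B f g) r volume ≤ C * eLpNorm f p volume * eLpNorm g q volume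

/-- The `L^p` improving region `R(μ, E)`: the set of all triples `(1/p, 1/q, 1/r)` with
`1 ≤ p, q ≤ ∞`, `r > 0`, `1/p + 1/q ≥ 1/r` for which `A_{μ̂,E} : L^p × L^q → L^r` is bounded. -/
def improvingRegion {d : ℕ} (μ : Measure (Rd d × Rd d)) (E : Set ℝ) : Set (ℝ × ℝ × ℝ) :=
  {u | ∃ p q r : ℝ≥0∞, 1 ≤ p ∧ 1 ≤ q ∧ 0 < r ∧ r⁻¹ ≤ p⁻¹ + q⁻¹ ∧
    IsBoundedBilinear (singleScaleMaximal (fourierMeasure μ) E) p q r ∧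
    u = (p⁻¹.toReal, q⁻¹.toReal, r⁻¹.toReal)}

/-- An axis-parallel cube in `ℝᵈ`, given by its lower corner and its side length. -/
structure Cube (d : ℕ) where
  corner : Rd d
  side : ℝ
  side_pos : 0 < side

/-- The (half-open) set of points of a cube. -/
def Cube.toSet {d : ℕ} (Q : Cube d) : Set (Rd d) :=
  {x | ∀ i, Q.corner i ≤ x i ∧ x i < Q.corner i + Q.side}

/-- A (possibly infinite) collection `S` of cubes is `η`-sparse: every `Q ∈ S` has a measurable
subset `F Q` with `|F Q| ≥ η |Q|`, and the sets `F Q` are pairwise disjoint. -/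
def IsSparse {d : ℕ} (η : ℝ) (S : Set (Cube d)) : Prop :=
  ∃ F : Cube d → Set (Rd d),
    (∀ Q ∈ S, MeasurableSet (F Q) ∧ F Q ⊆ Q.toSet ∧
      ENNReal.ofReal η * volume Q.toSet ≤ volume (F Q)) ∧
    S.PairwiseDisjoint F

/-- The local average `⟨f⟩_{Q,p} = (|Q|⁻¹ ∫_Q |f|^p)^(1/p)`. -/
def localAverage {d : ℕ} (f : Rd d → ℂ) (Q : Cube d) (p : ℝ) : ℝ≥0∞ :=
  ((volume Q.toSet)⁻¹ * ∫⁻ x in Q.toSet, ‖f x‖ₑ ^ p) ^ (1 / p)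

/-- The sparse form `∑_{Q ∈ S} |Q| ⟨f⟩_{Q,p} ⟨g⟩_{Q,q} ⟨h⟩_{Q,s}`. -/
def sparseForm {d : ℕ} (S : Set (Cube d)) (p q s : ℝ) (f g h : Rd d → ℂ) : ℝ≥0∞ :=
  ∑' Q : S, volume (Q : Cube d).toSet *
    (localAverage f Q p * localAverage g Q q * localAverage h Q s)

/-- A bisublinear operator `B` has `(p, q, s)` sparse domination: for some sparseness parameter
`η ∈ (0, 1]` and some constant `C`, for all `f, g, h ∈ C₀^∞` there is an `η`-sparse family `S`
with `|⟨B(f, g), h⟩| ≤ C ∑_{Q ∈ S} |Q| ⟨f⟩_{Q,p} ⟨g⟩_{Q,q} ⟨h⟩_{Q,s}`. That `B(f, g)` is finite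
almost everywhere and that the pairing converges absolutely is part of the assertion. -/
def HasSparseDomination {d : ℕ} (B : (Rd d → ℂ) → (Rd d → ℂ) → Rd d → ℝ≥0∞)
    (p q s : ℝ) : Prop :=
  ∃ η : ℝ, 0 < η ∧ η ≤ 1 ∧ ∃ C : ℝ≥0, ∀ f g h : Rd d → ℂ,
    IsTestFunction f → IsTestFunction g → IsTestFunction h →
      (∀ᵐ x, B f g x ≠ ∞) ∧
      Integrable (fun x => ((B f g x).toReal : ℂ) * conj (h x)) ∧
      ∃ S : Set (Cube d), IsSparse η S ∧
        ‖∫ x, ((B f g x).toReal : ℂ) * conj (h x)‖ₑ ≤ C * sparseForm S p q s f g h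

end BilinearSparse

end

open MeasureTheory Filter Topology
open scoped ENNReal NNReal FourierTransform ComplexConjugate

noncomputable section

namespace BilinearSparse

/-! On the space side, the multiplier operator with symbol `μ̂(tξ, tη)` is the average of `f(x - ty)
g(x - tz)` against `μ` (`bilinearMultiplier_fourierMeasure`). It is therefore local at scale `t`.
Sparse domination of the supremum over all scales rests on two facts about one scale: the `L^p`
improving bounds, which are given, and a power gain when an input has mean zero on cells much
smaller than `t`.

The gain starts in `L² × L² → L²`. A symbol bounded by `(1 + |ξ|)^(-b)` with `b > d/2` is bounded
there (`eLpNorm_bilinearMultiplier_le`). Because `2a > d + β`, the decay exponent `a` can be split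
into three parts: more than `d/2` for this bound, `θ > β/2` to pay for the supremum over `t ∈ E` by
chaining along nets of `E` (`fourierMeasure_holder`, `lintegral_iSup_sq_le_of_chaining`), and `ε >
0` to extract `|u|^ε` from the factor `1 - e(-u·ξ)` produced by the difference `f - f(· - u)`. This
is `l2_translation_estimate`.

At an interior point of the improving region the bounds also hold at nearby exponents in each
coordinate direction. All three functions in the trilinear form are cut into large, small and
intermediate values. Extreme values gain from the neighbouring exponents and intermediate ones are
handled in `L²`, so a power of `|u|` survives at the given exponents (`pairing_translation_gain`). A
function with mean zero on every cell of a given scale is an average of its translation differences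
at that scale, which gives the gain in the form needed (`pairing_mean_zero_gain`). Exchanging the
two inputs treats `g`, and dilation carries everything to every scale (`IsLocalizedFamily`).

The sparse family comes from a stopping time. Below a selected cube, one stops at the maximal cells
having a neighbour on which the average of `|f|^p` or `|g|^q` is far above its average on the
tripled cube. The points not stopped fill at least half of the cube, hence sparseness
(`isSparse_sel`). On a cell `R` lying in no stopping cell, `f` and `g` are split by
Calderón–Zygmund. Good against good is trivial in `L^∞`, and bad parts of scale `j` below that of
`R` gain `2^((j-k)ε)`, where `k` is the scale of `R` (`pairing_cell_le`). Hölder's inequality with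
exponents `r, r'` sums this over the cells governed by one selected cube
(`tsum_pairing_governed_le`), once linearization has made the parts of `h` used at different scales
disjoint. This summation and the preceding cell estimate use `p, q ≤ r`. Scales larger than the
supports sum geometrically, since `1/p + 1/q > 1/r`. -/

section

open SchwartzMap

/-! ### Multipliers as averages, and Plancherel's theorem. -/

/-- The character `s ↦ exp (2πis)`. -/
def unitChar (s : ℝ) : ℂ := Complex.exp (2 * Real.pi * Complex.I * (s : ℂ))

lemma unitChar_add (s t : ℝ) : unitChar (s + t) = unitChar s * unitChar t := by
  simp only [unitChar, ← Complex.exp_add]; push_cast; ring_nf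

@[simp] lemma norm_unitChar (s : ℝ) : ‖unitChar s‖ = 1 := by
  have : 2 * Real.pi * Complex.I * (s : ℂ) = ((2 * Real.pi * s : ℝ) : ℂ) * Complex.I := by
    push_cast; ring
  rw [unitChar, this, Complex.norm_exp_ofReal_mul_I]

@[fun_prop] lemma continuous_unitChar : Continuous unitChar := by
  unfold unitChar; fun_prop

lemma fourierMeasure_eq {d : ℕ} (μ : Measure (Rd d × Rd d)) (ζ : Rd d × Rd d) :
    fourierMeasure μ ζ = ∫ w, unitChar (-(inner ℝ w.1 ζ.1 + inner ℝ w.2 ζ.2)) ∂μ := by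
  unfold fourierMeasure unitChar
  congr 1 with w
  push_cast; ring_nf

lemma bilinearMultiplier_eq {d : ℕ} (m : Rd d × Rd d → ℂ) (f g : Rd d → ℂ) (x : Rd d) :
    bilinearMultiplier m f g x =
      ∫ ζ : Rd d × Rd d, 𝓕 f ζ.1 * 𝓕 g ζ.2 * m ζ * unitChar (inner ℝ x (ζ.1 + ζ.2)) := rfl

lemma fourierInv_eq_unitChar {d : ℕ} (f : Rd d → ℂ) (x : Rd d) :
    𝓕⁻ f x = ∫ ξ, f ξ * unitChar (inner ℝ x ξ) := by
  rw [Real.fourierInv_eq']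
  congr 1 with v
  rw [smul_eq_mul, mul_comm, unitChar, real_inner_comm]
  congr 2
  push_cast; ring

lemma fourier_eq_unitChar {d : ℕ} (f : Rd d → ℂ) (x : Rd d) :
    𝓕 f x = ∫ ξ, f ξ * unitChar (-inner ℝ x ξ) := by
  rw [← neg_neg x, ← Real.fourierInv_eq_fourier_neg, fourierInv_eq_unitChar]
  simp

/-- The bilinear average `∫ f(x - ty) g(x - tz) dμ(y, z)`. -/
def bilinearAverage {d : ℕ} (μ : Measure (Rd d × Rd d)) (t : ℝ) (f g : Rd d → ℂ) (x : Rd d) : ℂ :=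
  ∫ w, f (x - t • w.1) * g (x - t • w.2) ∂μ

lemma schwartz_fourierInv_fourier {d : ℕ} (f : 𝓢(Rd d, ℂ)) (x : Rd d) :
    ∫ ξ, 𝓕 (f : Rd d → ℂ) ξ * unitChar (inner ℝ x ξ) = f x := by
  rw [← fourierInv_eq_unitChar]
  have h : 𝓕 (f : Rd d → ℂ) = (𝓕 f : 𝓢(Rd d, ℂ)) := (SchwartzMap.fourier_coe f).symm
  have := Continuous.fourierInv_fourier_eq f.continuous f.integrable
    (by rw [h]; exact SchwartzMap.integrable _)
  rw [this]

lemma integrable_fourier_schwartz {d : ℕ} (f : 𝓢(Rd d, ℂ)) : Integrable (𝓕 (f : Rd d → ℂ)) := by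
  rw [← SchwartzMap.fourier_coe f]; exact SchwartzMap.integrable _

lemma continuous_fourier_schwartz {d : ℕ} (f : 𝓢(Rd d, ℂ)) : Continuous (𝓕 (f : Rd d → ℂ)) := by
  rw [← SchwartzMap.fourier_coe f]; exact SchwartzMap.continuous _

/-- Multiplying by a dilate of `μ̂` on the Fourier side is averaging against `μ`. -/
theorem bilinearMultiplier_fourierMeasure {d : ℕ} (μ : Measure (Rd d × Rd d)) [IsFiniteMeasure μ]
    (t : ℝ) (f g : 𝓢(Rd d, ℂ)) (x : Rd d) :
    bilinearMultiplier (dilate (fourierMeasure μ) t) f g x = bilinearAverage μ t f g x := by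
  have hprod : Integrable (fun ζ : Rd d × Rd d => 𝓕 (f : Rd d → ℂ) ζ.1 * 𝓕 (g : Rd d → ℂ) ζ.2)
      (volume.prod volume) := (integrable_fourier_schwartz f).mul_prod (integrable_fourier_schwartz g)
  have hcf := continuous_fourier_schwartz f
  have hcg := continuous_fourier_schwartz g
  calc bilinearMultiplier (dilate (fourierMeasure μ) t) f g x
      = ∫ ζ : Rd d × Rd d, ∫ w, 𝓕 (f : Rd d → ℂ) ζ.1 * 𝓕 (g : Rd d → ℂ) ζ.2 *
          (unitChar (-(inner ℝ w.1 (t • ζ.1) + inner ℝ w.2 (t • ζ.2))) *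
            unitChar (inner ℝ x (ζ.1 + ζ.2))) ∂μ := by
        rw [bilinearMultiplier_eq]
        congr 1 with ζ
        rw [dilate, fourierMeasure_eq, integral_const_mul, integral_mul_const]
        ring
    _ = ∫ w, (∫ ζ : Rd d × Rd d, 𝓕 (f : Rd d → ℂ) ζ.1 * 𝓕 (g : Rd d → ℂ) ζ.2 *
          (unitChar (-(inner ℝ w.1 (t • ζ.1) + inner ℝ w.2 (t • ζ.2))) *
            unitChar (inner ℝ x (ζ.1 + ζ.2)))) ∂μ := by
        apply integral_integral_swap
        have h1 : Integrable (fun p : (Rd d × Rd d) × (Rd d × Rd d) =>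
            𝓕 (f : Rd d → ℂ) p.1.1 * 𝓕 (g : Rd d → ℂ) p.1.2)
            ((volume.prod volume).prod μ) := hprod.comp_fst μ
        refine h1.mono ?_ (Eventually.of_forall fun p => ?_)
        · apply Continuous.aestronglyMeasurable
          simp only [Function.uncurry_def]
          fun_prop
        · simp [Function.uncurry_def]
    _ = bilinearAverage μ t f g x := by
        rw [bilinearAverage]
        congr 1 with w
        rw [← schwartz_fourierInv_fourier f, ← schwartz_fourierInv_fourier g, ← integral_prod_mul]
        congr 1 with ζ
        have : unitChar (-(inner ℝ w.1 (t • ζ.1) + inner ℝ w.2 (t • ζ.2))) *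
            unitChar (inner ℝ x (ζ.1 + ζ.2)) =
            unitChar (inner ℝ (x - t • w.1) ζ.1) * unitChar (inner ℝ (x - t • w.2) ζ.2) := by
          rw [← unitChar_add, ← unitChar_add]
          congr 1
          simp only [inner_sub_left, inner_add_right, inner_smul_left, inner_smul_right]
          simp; ring
        rw [this]; ring

/-- Fubini for the kernel `e(x·ξ)`, which is symmetric in its two variables. It moves the inverse
transform of a merely integrable function onto a test function. -/
lemma integral_fourierInv_mul {d : ℕ} {H : Rd d → ℂ} (hH : Integrable H) (φ : 𝓢(Rd d, ℂ)) :
    ∫ x, 𝓕⁻ H x * φ x = ∫ x, H x * 𝓕⁻ (φ : Rd d → ℂ) x := by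
  simp only [fourierInv_eq_unitChar]
  have h1 : Integrable (fun p : Rd d × Rd d => φ p.1 * H p.2) (volume.prod volume) :=
    φ.integrable.mul_prod hH
  have := integral_integral_swap (μ := (volume : Measure (Rd d))) (ν := (volume : Measure (Rd d)))
    (f := fun x ξ => (φ x * H ξ) * unitChar (inner ℝ x ξ)) (by
      refine h1.mono ?_ (Eventually.of_forall fun p => ?_)
      · apply h1.aestronglyMeasurable.mul
        apply Continuous.aestronglyMeasurable
        fun_prop
      · simp [Function.uncurry_def])
  calc ∫ x, (∫ ξ, H ξ * unitChar (inner ℝ x ξ)) * φ x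
      = ∫ x, ∫ ξ, (φ x * H ξ) * unitChar (inner ℝ x ξ) := by
        congr 1 with x
        rw [← integral_mul_const]; congr 1 with ξ; ring
    _ = ∫ ξ, ∫ x, (φ x * H ξ) * unitChar (inner ℝ x ξ) := this
    _ = _ := by
        congr 1 with ξ
        rw [← integral_const_mul]; congr 1 with x; rw [real_inner_comm]; ring

/-- Plancherel's theorem for the inverse Fourier integral on `L¹ ∩ L²`. -/
theorem eLpNorm_fourierInv {d : ℕ} {H : Rd d → ℂ} (hH : Integrable H) (hH2 : MemLp H 2) :
    eLpNorm (𝓕⁻ H) 2 volume = eLpNorm H 2 volume := by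
  have hcont : Continuous (𝓕⁻ H) := by
    have : 𝓕⁻ H = fun x => 𝓕 H (-x) := funext fun x => Real.fourierInv_eq_fourier_neg H x
    rw [this]
    exact (VectorFourier.fourierIntegral_continuous Real.continuous_fourierChar
      (by exact continuous_inner) hH).comp continuous_neg
  set G := 𝓕⁻ (hH2.toLp H) with hG
  have hGm : MemLp G 2 := Lp.memLp G
  -- The `L²` transform is an abstract extension, not an integral. The two are identified by testing
  -- against smooth compactly supported functions, where each lets the inverse transform pass to the
  -- test function.
  have key : (𝓕⁻ H) =ᵐ[volume] G := by
    refine ae_eq_of_integral_contDiff_smul_eq hcont.locallyIntegrable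
      (hGm.locallyIntegrable (by norm_num)) fun φ hφ hφc => ?_
    have hφ' : ContDiff ℝ (⊤ : ℕ∞) (fun x => (φ x : ℂ)) := Complex.ofRealCLM.contDiff.comp hφ
    have hφc' : HasCompactSupport (fun x => (φ x : ℂ)) :=
      hφc.comp_left (g := fun r : ℝ => (r : ℂ)) (by simp)
    set ψ : 𝓢(Rd d, ℂ) := hφc'.toSchwartzMap hφ'
    have e1 := integral_fourierInv_mul hH ψ
    have e2 := congrArg (fun T => T ψ) (Lp.fourierInv_toTemperedDistribution_eq (hH2.toLp H))
    simp only [TemperedDistribution.fourierInv_apply, Lp.toTemperedDistribution_apply] at e2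
    rw [← hG] at e2
    have e3 : ∫ x, ψ x • G x = ∫ x, (𝓕⁻ ψ) x • H x := by
      rw [← e2]
      apply integral_congr_ae
      filter_upwards [hH2.coeFn_toLp] with x hx
      rw [hx]
    have e4 : (𝓕⁻ ψ : 𝓢(Rd d, ℂ)) = 𝓕⁻ (ψ : Rd d → ℂ) := SchwartzMap.fourierInv_coe ψ
    have e5 : ∀ x, ψ x = (φ x : ℂ) := fun x => rfl
    calc ∫ x, φ x • 𝓕⁻ H x = ∫ x, 𝓕⁻ H x * ψ x := by
          congr 1 with x; rw [e5, Complex.real_smul, mul_comm]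
      _ = ∫ x, ψ x • G x := by
          rw [e1, e3]; congr 1 with x; rw [← e4, smul_eq_mul, mul_comm]
      _ = _ := by congr 1 with x; 
  rw [eLpNorm_congr_ae key, ← Lp.enorm_def, ← eLpNorm_congr_ae hH2.coeFn_toLp, ← Lp.enorm_def]
  have : ‖G‖ = ‖hH2.toLp H‖ := by
    rw [hG]; exact (Lp.fourierTransformₗᵢ (Rd d) ℂ).symm.norm_map _
  simp only [enorm, nnnorm, this]

end

/-! ### The `L² × L² → L²` bound for multipliers with decay. -/

section

open SchwartzMap

lemma schwartz_fourierInv_fourier_eq {d : ℕ} (f : 𝓢(Rd d, ℂ)) :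
    𝓕⁻ (𝓕 (f : Rd d → ℂ)) = f := by
  ext x
  rw [fourierInv_eq_unitChar, schwartz_fourierInv_fourier]

lemma eLpNorm_fourier_schwartz {d : ℕ} (f : 𝓢(Rd d, ℂ)) :
    eLpNorm (𝓕 (f : Rd d → ℂ)) 2 volume = eLpNorm f 2 volume := by
  conv_rhs => rw [← schwartz_fourierInv_fourier_eq f]
  refine (eLpNorm_fourierInv (integrable_fourier_schwartz f) ?_).symm
  rw [← SchwartzMap.fourier_coe f]
  exact (𝓕 f : 𝓢(Rd d, ℂ)).memLp 2 volume

lemma eLpNorm_two_eq {α E : Type*} [MeasurableSpace α] [NormedAddCommGroup E] (μ : Measure α)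
    (f : α → E) : eLpNorm f 2 μ = (∫⁻ x, ‖f x‖ₑ ^ (2 : ℝ) ∂μ) ^ (1 / 2 : ℝ) := by
  rw [eLpNorm_eq_lintegral_rpow_enorm_toReal (by norm_num) (by norm_num)]
  simp

lemma lintegral_sq_eq {α E : Type*} [MeasurableSpace α] [NormedAddCommGroup E] (μ : Measure α)
    (f : α → E) : ∫⁻ x, ‖f x‖ₑ ^ (2 : ℝ) ∂μ = (eLpNorm f 2 μ) ^ (2 : ℝ) := by
  rw [eLpNorm_two_eq, ← ENNReal.rpow_mul]; norm_num

lemma sq_lintegral_mul_le {α : Type*} [MeasurableSpace α] (μ : Measure α) {f g : α → ℝ≥0∞}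
    (hf : AEMeasurable f μ) (hg : AEMeasurable g μ) :
    (∫⁻ x, f x * g x ∂μ) ^ (2 : ℝ) ≤
      (∫⁻ x, f x ^ (2 : ℝ) ∂μ) * ∫⁻ x, g x ^ (2 : ℝ) ∂μ := by
  have := ENNReal.lintegral_mul_le_Lp_mul_Lq μ Real.HolderConjugate.two_two hf hg
  calc _ ≤ ((∫⁻ x, f x ^ (2 : ℝ) ∂μ) ^ (1 / 2 : ℝ) *
        (∫⁻ x, g x ^ (2 : ℝ) ∂μ) ^ (1 / 2 : ℝ)) ^ (2 : ℝ) :=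
        ENNReal.rpow_le_rpow this (by norm_num)
    _ = _ := by
        rw [ENNReal.mul_rpow_of_nonneg _ _ (by norm_num), ← ENNReal.rpow_mul, ← ENNReal.rpow_mul]
        norm_num

lemma lintegral_weight_lt_top {d : ℕ} {b : ℝ} (hb : (d : ℝ) < 2 * b) :
    ∫⁻ ξ : Rd d, (ENNReal.ofReal ((1 + ‖ξ‖) ^ (-b))) ^ (2 : ℝ) < ∞ := by
  have h : Integrable (fun ξ : Rd d => (1 + ‖ξ‖) ^ (-(2 * b))) :=
    integrable_one_add_norm (by simpa using hb)
  refine lt_of_eq_of_lt ?_ h.lintegral_lt_top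
  congr 1 with ξ
  have h1 : 0 ≤ 1 + ‖ξ‖ := by positivity
  rw [ENNReal.ofReal_rpow_of_nonneg (by positivity) (by norm_num), ← Real.rpow_mul h1]
  congr 2; ring

/-- The bilinear convolution bound behind `eLpNorm_bilinearMultiplier_le`. -/
lemma lintegral_twisted_conv_sq_le {d : ℕ} {b : ℝ} (hb : (d : ℝ) < 2 * b) (K : ℝ≥0)
    (w : Rd d × Rd d → ℂ) (hwb : ∀ ξ η, ‖w (ξ, η)‖ ≤ K * (1 + ‖ξ‖) ^ (-b))
    {F G : Rd d → ℂ} (hF : Measurable F) (hG : Measurable G) :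
    ∫⁻ ζ, ‖∫ ξ, F ξ * G (ζ - ξ) * w (ξ, ζ - ξ)‖ₑ ^ (2 : ℝ) ≤
      ((K : ℝ≥0∞) ^ (2 : ℝ) * ∫⁻ ξ : Rd d, (ENNReal.ofReal ((1 + ‖ξ‖) ^ (-b))) ^ (2 : ℝ)) *
        ((∫⁻ ξ, ‖F ξ‖ₑ ^ (2 : ℝ)) * ∫⁻ η, ‖G η‖ₑ ^ (2 : ℝ)) := by
  set W : ℝ≥0∞ := ∫⁻ ξ : Rd d, (ENNReal.ofReal ((1 + ‖ξ‖) ^ (-b))) ^ (2 : ℝ) with hW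
  have hWt : W < ∞ := lintegral_weight_lt_top hb
  -- Cauchy–Schwarz in `ξ` separates the weight, which is square integrable because `2b > d`, from
  -- `F(ξ) G(ζ - ξ)`. The integral in `ζ` of the square of the latter factors by Tonelli.
  have hpt : ∀ ζ, ‖∫ ξ, F ξ * G (ζ - ξ) * w (ξ, ζ - ξ)‖ₑ ^ (2 : ℝ) ≤
      (∫⁻ ξ, ‖F ξ‖ₑ ^ (2 : ℝ) * ‖G (ζ - ξ)‖ₑ ^ (2 : ℝ)) * ((K : ℝ≥0∞) ^ (2 : ℝ) * W) := by
    intro ζ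
    calc ‖∫ ξ, F ξ * G (ζ - ξ) * w (ξ, ζ - ξ)‖ₑ ^ (2 : ℝ)
        ≤ (∫⁻ ξ, (‖F ξ‖ₑ * ‖G (ζ - ξ)‖ₑ) *
            (K * ENNReal.ofReal ((1 + ‖ξ‖) ^ (-b)))) ^ (2 : ℝ) := by
          refine ENNReal.rpow_le_rpow ?_ (by norm_num)
          refine (enorm_integral_le_lintegral_enorm _).trans (lintegral_mono fun ξ => ?_)
          simp only [enorm_mul]
          gcongr
          rw [← ofReal_norm, ← ENNReal.ofReal_coe_nnreal, ← ENNReal.ofReal_mul K.coe_nonneg]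
          exact ENNReal.ofReal_le_ofReal (hwb _ _)
      _ ≤ (∫⁻ ξ, (‖F ξ‖ₑ * ‖G (ζ - ξ)‖ₑ) ^ (2 : ℝ)) *
          ∫⁻ ξ : Rd d, (K * ENNReal.ofReal ((1 + ‖ξ‖) ^ (-b))) ^ (2 : ℝ) := by
          apply sq_lintegral_mul_le
          · apply Measurable.aemeasurable
            have : Measurable fun ξ => G (ζ - ξ) := hG.comp (by fun_prop)
            fun_prop
          · have : Continuous fun ξ : Rd d => (1 + ‖ξ‖) ^ (-b) := by
              refine Continuous.rpow_const (by fun_prop) fun ξ => Or.inl ?_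
              positivity
            exact ((ENNReal.continuous_ofReal.comp this).measurable.const_mul _).aemeasurable
      _ = _ := by
          congr 1
          · congr 1 with ξ
            rw [ENNReal.mul_rpow_of_nonneg _ _ (by norm_num)]
          · rw [hW, ← lintegral_const_mul' _ _ (by simp)]
            congr 1 with ξ
            rw [ENNReal.mul_rpow_of_nonneg _ _ (by norm_num)]
  calc _ ≤ ∫⁻ ζ, (∫⁻ ξ, ‖F ξ‖ₑ ^ (2 : ℝ) * ‖G (ζ - ξ)‖ₑ ^ (2 : ℝ)) *
        ((K : ℝ≥0∞) ^ (2 : ℝ) * W) := lintegral_mono hpt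
    _ = (∫⁻ ζ, ∫⁻ ξ, ‖F ξ‖ₑ ^ (2 : ℝ) * ‖G (ζ - ξ)‖ₑ ^ (2 : ℝ)) *
        ((K : ℝ≥0∞) ^ (2 : ℝ) * W) := by
        rw [lintegral_mul_const']
        exact ENNReal.mul_ne_top (by simp) hWt.ne
    _ = _ := by
        rw [lintegral_lintegral_swap, mul_comm]
        · congr 1
          rw [← lintegral_mul_const _ (by fun_prop)]
          congr 1 with ξ
          have hGs : Measurable fun x => G (x - ξ) := hG.comp (measurable_id.sub_const ξ)
          rw [lintegral_const_mul _ (by fun_prop)]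
          congr 1
          exact lintegral_sub_right_eq_self (fun η => ‖G η‖ₑ ^ (2 : ℝ)) ξ
        · apply Measurable.aemeasurable
          simp only [Function.uncurry_def]
          exact ((hF.comp measurable_snd).enorm.pow_const _).mul
            ((hG.comp (measurable_fst.sub measurable_snd)).enorm.pow_const _)

/-- The shear `(ξ, η) ↦ (ξ, ξ + η)` groups the frequencies by their sum, which is the output
frequency. The output is thus the inverse transform of a twisted convolution, and Plancherel applies
to it. -/
lemma bilinear_fourier_integral_eq {d : ℕ} {F G : Rd d → ℂ} {w : Rd d × Rd d → ℂ} {K : ℝ}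
    (hFi : Integrable F) (hGi : Integrable G)
    (hw : Continuous w) (hwK : ∀ ζ, ‖w ζ‖ ≤ K) :
    Integrable (fun ζ => ∫ ξ, F ξ * G (ζ - ξ) * w (ξ, ζ - ξ)) ∧
    ∀ x, ∫ ζ : Rd d × Rd d, F ζ.1 * G ζ.2 * w ζ * unitChar (inner ℝ x (ζ.1 + ζ.2)) =
      𝓕⁻ (fun ζ => ∫ ξ, F ξ * G (ζ - ξ) * w (ξ, ζ - ξ)) x := by
  have hΦ : Integrable (fun ζ : Rd d × Rd d => F ζ.1 * G ζ.2 * w ζ) (volume.prod volume) :=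
    (hFi.mul_prod hGi).mul_bdd (c := K) hw.aestronglyMeasurable (Eventually.of_forall hwK)
  set Ψ : Rd d × Rd d → ℂ := fun p => F p.1 * G (p.2 - p.1) * w (p.1, p.2 - p.1) with hΨ
  have hshear : MeasurePreserving (fun z : Rd d × Rd d => (z.1, z.1 + z.2))
    (volume.prod volume) (volume.prod volume) := measurePreserving_prod_add volume volume
  have hemb : MeasurableEmbedding (fun z : Rd d × Rd d => (z.1, z.1 + z.2)) :=
    (MeasurableEquiv.shearAddRight (Rd d)).measurableEmbedding
  have hΨi : Integrable Ψ (volume.prod volume) := by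
    rw [← hshear.integrable_comp_emb hemb]
    refine hΦ.congr (Eventually.of_forall fun z => ?_)
    simp [hΨ]
  refine ⟨hΨi.integral_prod_right, fun x => ?_⟩
  rw [fourierInv_eq_unitChar]
  have h1 : Integrable (fun p : Rd d × Rd d => Ψ p * unitChar (inner ℝ x p.2))
      (volume.prod volume) :=
    hΨi.mul_bdd (c := 1) (by apply Continuous.aestronglyMeasurable; fun_prop)
      (Eventually.of_forall fun p => by simp)
  have h2 := hshear.integral_comp hemb (fun p : Rd d × Rd d => Ψ p * unitChar (inner ℝ x p.2))
  rw [integral_prod_symm _ h1] at h2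
  calc _ = ∫ z : Rd d × Rd d, Ψ (z.1, z.1 + z.2) * unitChar (inner ℝ x (z.1 + z.2)) := by
        congr 1 with z
        simp [hΨ]
    _ = _ := h2
    _ = _ := by
        congr 1 with ζ
        exact integral_mul_const (unitChar (inner ℝ x ζ)) fun ξ => Ψ (ξ, ζ)

/-- A bilinear multiplier which decays like `(1 + |ξ|)^(-b)` with `b > d / 2` maps `L² × L²` to
`L²`. -/
theorem eLpNorm_bilinearMultiplier_le {d : ℕ} {b : ℝ} (hb : (d : ℝ) < 2 * b) :
    ∃ C : ℝ≥0, ∀ (K : ℝ≥0) (w : Rd d × Rd d → ℂ), Continuous w →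
      (∀ ξ η, ‖w (ξ, η)‖ ≤ K * (1 + ‖ξ‖) ^ (-b)) → ∀ f g : 𝓢(Rd d, ℂ),
        eLpNorm (bilinearMultiplier w f g) 2 volume ≤
          C * K * eLpNorm f 2 volume * eLpNorm g 2 volume := by
  have hb0 : 0 < b := by have : (0 : ℝ) ≤ d := d.cast_nonneg; linarith
  set W : ℝ≥0∞ := ∫⁻ ξ : Rd d, (ENNReal.ofReal ((1 + ‖ξ‖) ^ (-b))) ^ (2 : ℝ) with hW
  have hWt : W < ∞ := lintegral_weight_lt_top hb
  refine ⟨(W ^ (1 / 2 : ℝ)).toNNReal, fun K w hw hwb f g => ?_⟩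
  rw [ENNReal.coe_toNNReal (ENNReal.rpow_ne_top_of_nonneg (by norm_num) hWt.ne)]
  have hwK : ∀ ζ, ‖w ζ‖ ≤ K := fun ζ => (hwb ζ.1 ζ.2).trans <| by
    have : (1 + ‖ζ.1‖) ^ (-b) ≤ 1 :=
      Real.rpow_le_one_of_one_le_of_nonpos (by linarith [norm_nonneg ζ.1]) (by linarith)
    exact mul_le_of_le_one_right K.2 this
  have hFc := continuous_fourier_schwartz f
  have hGc := continuous_fourier_schwartz g
  obtain ⟨hHi, hB⟩ := bilinear_fourier_integral_eq (integrable_fourier_schwartz f)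
    (integrable_fourier_schwartz g) hw hwK
  have hHb := lintegral_twisted_conv_sq_le hb K w hwb hFc.measurable hGc.measurable
  rw [lintegral_sq_eq, lintegral_sq_eq _ (𝓕 (f : Rd d → ℂ)), lintegral_sq_eq _ (𝓕 (g : Rd d → ℂ)),
    eLpNorm_fourier_schwartz, eLpNorm_fourier_schwartz, ← hW] at hHb
  generalize (fun ζ => ∫ ξ, 𝓕 (f : Rd d → ℂ) ξ * 𝓕 (g : Rd d → ℂ) (ζ - ξ) * w (ξ, ζ - ξ)) = H at *
  have hfin : eLpNorm H 2 volume ≤ W ^ (1 / 2 : ℝ) * K * eLpNorm f 2 volume *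
      eLpNorm g 2 volume := by
    rw [← ENNReal.rpow_le_rpow_iff (z := 2) (by norm_num)]
    refine hHb.trans (le_of_eq ?_)
    have e : (W ^ (1 / 2 : ℝ)) ^ (2 : ℝ) = W := by rw [← ENNReal.rpow_mul]; norm_num
    simp only [ENNReal.mul_rpow_of_nonneg _ _ (show (0 : ℝ) ≤ 2 by norm_num), e]
    ring
  have hHm : MemLp H 2 := ⟨hHi.1, hfin.trans_lt <| by
    refine ENNReal.mul_lt_top (ENNReal.mul_lt_top (ENNReal.mul_lt_top ?_ (by simp)) ?_) ?_
    · exact ENNReal.rpow_lt_top_of_nonneg (by norm_num) hWt.ne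
    · exact (f.memLp 2 volume).2
    · exact (g.memLp 2 volume).2⟩
  rw [show bilinearMultiplier w f g = 𝓕⁻ H from funext hB, eLpNorm_fourierInv hHi hHm]
  exact hfin

end

/-! ### Fourier decay of moments and regularity in the dilation parameter. -/

section

open SchwartzMap

lemma integrable_schwartz_mul_weight {d : ℕ} (F : 𝓢(Rd d, ℂ)) (a : ℝ) :
    Integrable (fun κ : Rd d => ‖F κ‖ * (1 + ‖κ‖) ^ a) := by
  obtain ⟨n, hn⟩ := exists_nat_ge a
  have h0 := F.integrable_pow_mul volume 0
  have h1 := F.integrable_pow_mul volume n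
  have h2 : Integrable (fun κ : Rd d =>
      (2 : ℝ) ^ (n - 1) * (‖κ‖ ^ 0 * ‖F κ‖ + ‖κ‖ ^ n * ‖F κ‖)) := (h0.add h1).const_mul _
  refine h2.mono' ?_ (Eventually.of_forall fun κ => ?_)
  · apply Continuous.aestronglyMeasurable
    have : Continuous fun ξ : Rd d => (1 + ‖ξ‖) ^ a :=
      Continuous.rpow_const (by fun_prop) fun ξ => Or.inl (by positivity)
    fun_prop
  · have h3 : (1 + ‖κ‖) ^ a ≤ (2 : ℝ) ^ (n - 1) * (1 + ‖κ‖ ^ n) := by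
      calc (1 + ‖κ‖) ^ a ≤ (1 + ‖κ‖) ^ (n : ℝ) :=
            Real.rpow_le_rpow_of_exponent_le (by linarith [norm_nonneg κ]) hn
        _ = (1 + ‖κ‖) ^ n := Real.rpow_natCast _ _
        _ ≤ _ := by
            have := add_pow_le (zero_le_one) (norm_nonneg κ) n
            simpa using this
    rw [Real.norm_of_nonneg (by positivity)]
    calc ‖F κ‖ * (1 + ‖κ‖) ^ a ≤ ‖F κ‖ * ((2 : ℝ) ^ (n - 1) * (1 + ‖κ‖ ^ n)) := by gcongr
      _ = _ := by ring

/-- Peetre's inequality: `1 + |ξ| + |η|` is at most its translate times `(1 + |κ|)(1 + |ι|)`. It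
lets polynomial decay survive convolution with a rapidly decreasing function. -/
lemma peetre_le {d : ℕ} {a : ℝ} (ha : 0 ≤ a) (ξ η κ ι : Rd d) :
    (1 + ‖ξ - κ‖ + ‖η - ι‖) ^ (-a) ≤
      (1 + ‖ξ‖ + ‖η‖) ^ (-a) * ((1 + ‖κ‖) ^ a * (1 + ‖ι‖) ^ a) := by
  have h1 : ‖ξ‖ ≤ ‖ξ - κ‖ + ‖κ‖ := by simpa using norm_add_le (ξ - κ) κ
  have h2 : ‖η‖ ≤ ‖η - ι‖ + ‖ι‖ := by simpa using norm_add_le (η - ι) ι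
  have h3 : 1 + ‖ξ‖ + ‖η‖ ≤ (1 + ‖ξ - κ‖ + ‖η - ι‖) * ((1 + ‖κ‖) * (1 + ‖ι‖)) := by
    have := norm_nonneg κ; have := norm_nonneg ι
    have := norm_nonneg (ξ - κ); have := norm_nonneg (η - ι)
    have : 0 ≤ ‖κ‖ * ‖ι‖ := by positivity
    have : 0 ≤ (‖ξ - κ‖ + ‖η - ι‖) * (‖κ‖ + ‖ι‖ + ‖κ‖ * ‖ι‖) := by positivity
    nlinarith
  rw [← Real.mul_rpow (by positivity) (by positivity), Real.rpow_neg (by positivity),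
    Real.rpow_neg (by positivity), ← div_eq_inv_mul, le_div_iff₀ (by positivity),
    inv_mul_le_iff₀ (by positivity), ← Real.mul_rpow (by positivity) (by positivity)]
  exact Real.rpow_le_rpow (by positivity) h3 ha

/-- Smooth densities do not destroy the Fourier decay of a measure. -/
lemma fourier_decay_mul_schwartz {d : ℕ} {μ : Measure (Rd d × Rd d)} [IsFiniteMeasure μ]
    {a C : ℝ} (ha : 0 ≤ a)
    (hC : ∀ ξ η, ‖fourierMeasure μ (ξ, η)‖ ≤ C * (1 + ‖ξ‖ + ‖η‖) ^ (-a)) (χ₁ χ₂ : 𝓢(Rd d, ℂ)) :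
    ∃ C' : ℝ, ∀ ξ η : Rd d,
      ‖∫ w, χ₁ w.1 * χ₂ w.2 * unitChar (-(inner ℝ w.1 ξ + inner ℝ w.2 η)) ∂μ‖ ≤
        C' * (1 + ‖ξ‖ + ‖η‖) ^ (-a) := by
  set F₁ : 𝓢(Rd d, ℂ) := 𝓕 χ₁ with hF₁
  set F₂ : 𝓢(Rd d, ℂ) := 𝓕 χ₂ with hF₂
  have e₁ : ∀ x, ∫ κ, F₁ κ * unitChar (inner ℝ x κ) = χ₁ x := fun x => by
    rw [← schwartz_fourierInv_fourier χ₁ x, hF₁, SchwartzMap.fourier_coe]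
  have e₂ : ∀ x, ∫ κ, F₂ κ * unitChar (inner ℝ x κ) = χ₂ x := fun x => by
    rw [← schwartz_fourierInv_fourier χ₂ x, hF₂, SchwartzMap.fourier_coe]
  have hC0 : 0 ≤ C := by
    have := (norm_nonneg _).trans (hC 0 0)
    simpa using this
  have hFF : Integrable (fun κ : Rd d × Rd d => F₁ κ.1 * F₂ κ.2) (volume.prod volume) :=
    F₁.integrable.mul_prod F₂.integrable
  set I : ℝ := ∫ κ : Rd d × Rd d, (‖F₁ κ.1‖ * (1 + ‖κ.1‖) ^ a) * (‖F₂ κ.2‖ * (1 + ‖κ.2‖) ^ a)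
    ∂(volume.prod volume)
  refine ⟨C * I, fun ξ η => ?_⟩
  -- A density `χ₁ ⊗ χ₂` on the space side convolves `μ̂` with `F₁ ⊗ F₂`. The decay is then kept by
  -- Peetre's inequality.
  have key : ∫ w, χ₁ w.1 * χ₂ w.2 * unitChar (-(inner ℝ w.1 ξ + inner ℝ w.2 η)) ∂μ =
      ∫ κ : Rd d × Rd d, F₁ κ.1 * F₂ κ.2 * fourierMeasure μ (ξ - κ.1, η - κ.2)
        ∂(volume.prod volume) := by
    calc _ = ∫ w, (∫ κ : Rd d × Rd d, F₁ κ.1 * F₂ κ.2 *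
          unitChar (-(inner ℝ w.1 (ξ - κ.1) + inner ℝ w.2 (η - κ.2))) ∂(volume.prod volume)) ∂μ := by
          congr 1 with w
          rw [← e₁, ← e₂, ← integral_prod_mul, ← integral_mul_const]
          congr 1 with κ
          have : unitChar (-(inner ℝ w.1 (ξ - κ.1) + inner ℝ w.2 (η - κ.2))) =
              unitChar (inner ℝ w.1 κ.1) * unitChar (inner ℝ w.2 κ.2) *
                unitChar (-(inner ℝ w.1 ξ + inner ℝ w.2 η)) := by
            rw [← unitChar_add, ← unitChar_add, inner_sub_right, inner_sub_right]
            congr 1; ring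
          rw [this]; ring
      _ = ∫ κ : Rd d × Rd d, (∫ w, F₁ κ.1 * F₂ κ.2 *
          unitChar (-(inner ℝ w.1 (ξ - κ.1) + inner ℝ w.2 (η - κ.2))) ∂μ) ∂(volume.prod volume) := by
          apply integral_integral_swap
          have h1 : Integrable (fun p : (Rd d × Rd d) × (Rd d × Rd d) => F₁ p.2.1 * F₂ p.2.2)
            (μ.prod (volume.prod volume)) := hFF.comp_snd μ
          refine h1.mono ?_ (Eventually.of_forall fun p => ?_)
          · apply Continuous.aestronglyMeasurable
            simp only [Function.uncurry_def]
            fun_prop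
          · simp [Function.uncurry_def]
      _ = _ := by
          congr 1 with κ
          rw [integral_const_mul, fourierMeasure_eq]
  rw [key]
  have hint : Integrable (fun κ : Rd d × Rd d =>
      (‖F₁ κ.1‖ * (1 + ‖κ.1‖) ^ a) * (‖F₂ κ.2‖ * (1 + ‖κ.2‖) ^ a)) (volume.prod volume) :=
    (integrable_schwartz_mul_weight F₁ a).mul_prod (integrable_schwartz_mul_weight F₂ a)
  have h2 := norm_integral_le_of_norm_le (hint.const_mul (C * (1 + ‖ξ‖ + ‖η‖) ^ (-a)))
    (f := fun κ => F₁ κ.1 * F₂ κ.2 * fourierMeasure μ (ξ - κ.1, η - κ.2))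
    (Eventually.of_forall fun κ => by
      rw [norm_mul, norm_mul]
      calc ‖F₁ κ.1‖ * ‖F₂ κ.2‖ * ‖fourierMeasure μ (ξ - κ.1, η - κ.2)‖
          ≤ ‖F₁ κ.1‖ * ‖F₂ κ.2‖ * (C * ((1 + ‖ξ‖ + ‖η‖) ^ (-a) *
            ((1 + ‖κ.1‖) ^ a * (1 + ‖κ.2‖) ^ a))) := by
            gcongr
            exact (hC _ _).trans (mul_le_mul_of_nonneg_left (peetre_le ha _ _ _ _) hC0)
        _ = _ := by ring)
  refine h2.trans (le_of_eq ?_)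
  rw [integral_const_mul]; ring

lemma exists_schwartz_cutoff (d : ℕ) (R : ℝ) :
    ∃ φ : Rd d → ℂ, ContDiff ℝ (⊤ : ℕ∞) φ ∧ HasCompactSupport φ ∧ ∀ x, ‖x‖ ≤ R → φ x = 1 := by
  let f : ContDiffBump (0 : Rd d) := ⟨max R 1, max R 1 + 1, by positivity, by linarith⟩
  refine ⟨fun x => (f x : ℂ), Complex.ofRealCLM.contDiff.comp f.contDiff,
    f.hasCompactSupport.comp_left (g := fun r : ℝ => (r : ℂ)) (by simp), fun x hx => ?_⟩
  have : f x = 1 := f.one_of_mem_closedBall (by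
    rw [mem_closedBall_zero_iff]; exact hx.trans (le_max_left R 1))
  simp [this]

lemma IsCompactlySupported.exists_radius {d : ℕ} {μ : Measure (Rd d × Rd d)}
    (hμ : IsCompactlySupported μ) : ∃ R : ℝ, 0 < R ∧ ∀ᵐ w ∂μ, ‖w.1‖ ≤ R ∧ ‖w.2‖ ≤ R := by
  obtain ⟨K, hK, hμK⟩ := hμ
  obtain ⟨R, hR⟩ := hK.isBounded.exists_norm_le
  refine ⟨max R 1, by positivity, ?_⟩
  have : ∀ᵐ w ∂μ, w ∈ K := by rw [ae_iff]; exact hμK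
  filter_upwards [this] with w hw
  have := hR w hw
  exact ⟨((norm_fst_le w).trans this).trans (le_max_left _ _),
    ((norm_snd_le w).trans this).trans (le_max_left _ _)⟩

/-- The first moments of a compactly supported measure inherit its Fourier decay. -/
lemma fourier_decay_moment {d : ℕ} {μ : Measure (Rd d × Rd d)} [IsFiniteMeasure μ]
    (hμ : IsCompactlySupported μ) {a C : ℝ} (ha : 0 ≤ a)
    (hC : ∀ ξ η, ‖fourierMeasure μ (ξ, η)‖ ≤ C * (1 + ‖ξ‖ + ‖η‖) ^ (-a)) :
    ∃ C' : ℝ, ∀ ξ η : Rd d, ∀ i : Fin d,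
      ‖∫ w, (w.1 i : ℂ) * unitChar (-(inner ℝ w.1 ξ + inner ℝ w.2 η)) ∂μ‖ ≤
        C' * (1 + ‖ξ‖ + ‖η‖) ^ (-a) ∧
      ‖∫ w, (w.2 i : ℂ) * unitChar (-(inner ℝ w.1 ξ + inner ℝ w.2 η)) ∂μ‖ ≤
        C' * (1 + ‖ξ‖ + ‖η‖) ^ (-a) := by
  obtain ⟨R, -, hR⟩ := hμ.exists_radius
  obtain ⟨φ, hφ, hφc, hφ1⟩ := exists_schwartz_cutoff d R
  let χ : 𝓢(Rd d, ℂ) := hφc.toSchwartzMap hφ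
  -- On the support of `μ` the cutoff `φ` equals 1, so a coordinate function may be replaced there
  -- by the Schwartz function `x_i φ`.
  have hψ : ∀ i : Fin d, ContDiff ℝ (⊤ : ℕ∞) (fun x : Rd d => (x i : ℂ) * φ x) := fun i => by
    refine ContDiff.mul (Complex.ofRealCLM.contDiff.comp ?_) hφ
    exact (EuclideanSpace.proj (𝕜 := ℝ) i).contDiff
  have hψc : ∀ i : Fin d, HasCompactSupport (fun x : Rd d => (x i : ℂ) * φ x) :=
    fun i => hφc.mul_left
  let ψ : Fin d → 𝓢(Rd d, ℂ) := fun i => (hψc i).toSchwartzMap (hψ i)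
  choose A hA using fun i => fourier_decay_mul_schwartz ha hC (ψ i) χ
  choose B hB using fun i => fourier_decay_mul_schwartz ha hC χ (ψ i)
  refine ⟨∑ i, (|A i| + |B i|), fun ξ η i => ?_⟩
  have hρ : 0 ≤ (1 + ‖ξ‖ + ‖η‖) ^ (-a) := by positivity
  have hle : |A i| + |B i| ≤ ∑ i, (|A i| + |B i|) :=
    Finset.single_le_sum (f := fun i => |A i| + |B i|) (fun j _ => by positivity)
      (Finset.mem_univ i)
  constructor
  · have : ∫ w, (w.1 i : ℂ) * unitChar (-(inner ℝ w.1 ξ + inner ℝ w.2 η)) ∂μ =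
        ∫ w, ψ i w.1 * χ w.2 * unitChar (-(inner ℝ w.1 ξ + inner ℝ w.2 η)) ∂μ := by
      apply integral_congr_ae
      filter_upwards [hR] with w hw
      simp [ψ, χ, hφ1 _ hw.1, hφ1 _ hw.2]
    rw [this]
    refine (hA i ξ η).trans (mul_le_mul_of_nonneg_right ?_ hρ)
    linarith [le_abs_self (A i), abs_nonneg (B i)]
  · have : ∫ w, (w.2 i : ℂ) * unitChar (-(inner ℝ w.1 ξ + inner ℝ w.2 η)) ∂μ =
        ∫ w, χ w.1 * ψ i w.2 * unitChar (-(inner ℝ w.1 ξ + inner ℝ w.2 η)) ∂μ := by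
      apply integral_congr_ae
      filter_upwards [hR] with w hw
      simp [ψ, χ, hφ1 _ hw.1, hφ1 _ hw.2]
    rw [this]
    refine (hB i ξ η).trans (mul_le_mul_of_nonneg_right ?_ hρ)
    linarith [le_abs_self (B i), abs_nonneg (A i)]

lemma hasDerivAt_unitChar_neg_mul (s t : ℝ) :
    HasDerivAt (fun t : ℝ => unitChar (-(t * s)))
      (-(2 * Real.pi * Complex.I) * s * unitChar (-(t * s))) t := by
  have h : HasDerivAt (fun t : ℝ => -(2 * Real.pi * Complex.I) * s * (t : ℂ))
      (-(2 * Real.pi * Complex.I) * s * 1) t :=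
    (Complex.ofRealCLM.hasDerivAt (x := t)).const_mul _
  have h2 := h.cexp
  have e : ∀ t : ℝ, unitChar (-(t * s)) =
      Complex.exp (-(2 * Real.pi * Complex.I) * s * (t : ℂ)) := fun t => by
    rw [unitChar]; push_cast; ring_nf
  simp only [e]
  convert h2 using 1
  ring

/-- The `t`-derivative of `μ̂(tξ, tη)` is a combination of Fourier transforms of first moments, with
coefficients the coordinates of `ξ` and `η`. By `fourier_decay_moment` it costs only a factor `|ξ| +
|η|` over the decay of `μ̂`. The mean value inequality finishes the argument. -/
lemma fourierMeasure_lipschitz {d : ℕ} {μ : Measure (Rd d × Rd d)} [IsFiniteMeasure μ]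
    (hμ : IsCompactlySupported μ) {a C : ℝ} (ha : 0 ≤ a)
    (hC : ∀ ξ η, ‖fourierMeasure μ (ξ, η)‖ ≤ C * (1 + ‖ξ‖ + ‖η‖) ^ (-a)) :
    ∃ C' : ℝ, 0 ≤ C' ∧ ∀ ξ η : Rd d, ∀ s ∈ Set.Icc (1 : ℝ) 2, ∀ t ∈ Set.Icc (1 : ℝ) 2,
      ‖fourierMeasure μ (t • ξ, t • η) - fourierMeasure μ (s • ξ, s • η)‖ ≤
        C' * (‖ξ‖ + ‖η‖) * (1 + ‖ξ‖ + ‖η‖) ^ (-a) * |t - s| := by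
  obtain ⟨R, hR0, hR⟩ := hμ.exists_radius
  obtain ⟨C₁, hC₁⟩ := fourier_decay_moment hμ ha hC
  refine ⟨2 * Real.pi * (d * |C₁|), by positivity, fun ξ η s hs t ht => ?_⟩
  set σ : Rd d × Rd d → ℝ := fun w => inner ℝ w.1 ξ + inner ℝ w.2 η with hσ
  have hσc : Continuous σ := by fun_prop
  have hF : ∀ t : ℝ, fourierMeasure μ (t • ξ, t • η) = ∫ w, unitChar (-(t * σ w)) ∂μ := fun t => by
    rw [fourierMeasure_eq]
    simp only [inner_smul_right, hσ, mul_add]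
  have hderiv : ∀ t : ℝ, HasDerivAt (fun t : ℝ => fourierMeasure μ (t • ξ, t • η))
      (∫ w, -(2 * Real.pi * Complex.I) * σ w * unitChar (-(t * σ w)) ∂μ) t := by
    intro t
    simp only [hF]
    have hbd : ∀ᵐ w ∂μ, |σ w| ≤ R * ‖ξ‖ + R * ‖η‖ := by
      filter_upwards [hR] with w hw
      refine (abs_add_le _ _).trans (add_le_add ?_ ?_)
      · exact (abs_real_inner_le_norm _ _).trans (by gcongr; exact hw.1)
      · exact (abs_real_inner_le_norm _ _).trans (by gcongr; exact hw.2)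
    refine (hasDerivAt_integral_of_dominated_loc_of_deriv_le (s := Set.univ)
      (bound := fun _ => 2 * Real.pi * (R * ‖ξ‖ + R * ‖η‖))
      (F' := fun t w => -(2 * Real.pi * Complex.I) * σ w * unitChar (-(t * σ w)))
      univ_mem ?_ ?_ ?_ ?_ ?_ ?_).2
    · exact Eventually.of_forall fun t => by
        apply Continuous.aestronglyMeasurable; fun_prop
    · refine Integrable.of_bound (C := 1) ?_ (Eventually.of_forall fun w => by simp)
      apply Continuous.aestronglyMeasurable; fun_prop
    · apply Continuous.aestronglyMeasurable; fun_prop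
    · filter_upwards [hbd] with w hw t _
      simp only [norm_mul, norm_neg, norm_unitChar, mul_one, Complex.norm_I, Complex.norm_real,
        Complex.norm_ofNat, Real.norm_eq_abs, abs_of_pos Real.pi_pos]
      gcongr
    · exact integrable_const _
    · exact Eventually.of_forall fun w t _ => hasDerivAt_unitChar_neg_mul (σ w) t
  have hbound : ∀ t ∈ Set.Icc (1 : ℝ) 2,
      ‖∫ w, -(2 * Real.pi * Complex.I) * σ w * unitChar (-(t * σ w)) ∂μ‖ ≤
        2 * Real.pi * (d * |C₁|) * (‖ξ‖ + ‖η‖) * (1 + ‖ξ‖ + ‖η‖) ^ (-a) := by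
    intro t ht
    have ht0 : (0 : ℝ) < t := by linarith [ht.1]
    set ρ := (1 + ‖ξ‖ + ‖η‖) ^ (-a) with hρ
    have hρ0 : 0 ≤ ρ := by positivity
    have hρt : (1 + ‖t • ξ‖ + ‖t • η‖) ^ (-a) ≤ ρ := by
      refine Real.rpow_le_rpow_of_nonpos (by positivity) ?_ (by linarith)
      rw [norm_smul, norm_smul, Real.norm_of_nonneg ht0.le]
      nlinarith [norm_nonneg ξ, norm_nonneg η, ht.1]
    have hu : ∀ w : Rd d × Rd d, unitChar (-(t * σ w)) =
        unitChar (-(inner ℝ w.1 (t • ξ) + inner ℝ w.2 (t • η))) := fun w => by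
      simp only [inner_smul_right, hσ, mul_add]
    have hm1 : ∀ i, ‖∫ w, (w.1 i : ℂ) * unitChar (-(t * σ w)) ∂μ‖ ≤ |C₁| * ρ := fun i => by
      simp only [hu]
      refine ((hC₁ (t • ξ) (t • η) i).1).trans ?_
      calc _ ≤ |C₁| * (1 + ‖t • ξ‖ + ‖t • η‖) ^ (-a) := by gcongr; exact le_abs_self _
        _ ≤ _ := by gcongr
    have hm2 : ∀ i, ‖∫ w, (w.2 i : ℂ) * unitChar (-(t * σ w)) ∂μ‖ ≤ |C₁| * ρ := fun i => by
      simp only [hu]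
      refine ((hC₁ (t • ξ) (t • η) i).2).trans ?_
      calc _ ≤ |C₁| * (1 + ‖t • ξ‖ + ‖t • η‖) ^ (-a) := by gcongr; exact le_abs_self _
        _ ≤ _ := by gcongr
    have hi1 : ∀ i, Integrable (fun w : Rd d × Rd d => (w.1 i : ℂ) * unitChar (-(t * σ w))) μ := by
      intro i
      refine Integrable.of_bound (C := R) (by apply Continuous.aestronglyMeasurable; fun_prop) ?_
      filter_upwards [hR] with w hw
      simpa using (PiLp.norm_apply_le w.1 i).trans hw.1
    have hi2 : ∀ i, Integrable (fun w : Rd d × Rd d => (w.2 i : ℂ) * unitChar (-(t * σ w))) μ := by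
      intro i
      refine Integrable.of_bound (C := R) (by apply Continuous.aestronglyMeasurable; fun_prop) ?_
      filter_upwards [hR] with w hw
      simpa using (PiLp.norm_apply_le w.2 i).trans hw.2
    have hsum : ∫ w, -(2 * Real.pi * Complex.I) * σ w * unitChar (-(t * σ w)) ∂μ =
        -(2 * Real.pi * Complex.I) *
          ((∑ i, (ξ i : ℂ) * ∫ w, (w.1 i : ℂ) * unitChar (-(t * σ w)) ∂μ) +
            ∑ i, (η i : ℂ) * ∫ w, (w.2 i : ℂ) * unitChar (-(t * σ w)) ∂μ) := by
      simp only [← integral_const_mul]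
      rw [← integral_finsetSum _ fun i _ => (hi1 i).const_mul _,
        ← integral_finsetSum _ fun i _ => (hi2 i).const_mul _,
        ← integral_add (integrable_finsetSum _ fun i _ => (hi1 i).const_mul _)
          (integrable_finsetSum _ fun i _ => (hi2 i).const_mul _), ← integral_const_mul]
      congr 1 with w
      have : (σ w : ℂ) = (∑ i, (ξ i : ℂ) * (w.1 i : ℂ)) + ∑ i, (η i : ℂ) * (w.2 i : ℂ) := by
        simp only [hσ, PiLp.inner_apply, RCLike.inner_apply, conj_trivial]
        push_cast; rfl
      rw [this]
      simp only [add_mul, mul_add, Finset.sum_mul, Finset.mul_sum]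
      congr 1 <;> exact Finset.sum_congr rfl fun i _ => by ring
    rw [hsum]
    simp only [norm_mul, norm_neg, Complex.norm_I, Complex.norm_real,
        Complex.norm_ofNat, Real.norm_eq_abs, abs_of_pos Real.pi_pos, mul_one]
    have h1 : ‖∑ i, (ξ i : ℂ) * ∫ w, (w.1 i : ℂ) * unitChar (-(t * σ w)) ∂μ‖ ≤
        d * (‖ξ‖ * (|C₁| * ρ)) := by
      refine (norm_sum_le_of_le (n := fun _ => ‖ξ‖ * (|C₁| * ρ)) _ fun i _ => ?_).trans_eq
        (by simp)
      rw [norm_mul]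
      exact mul_le_mul (by simpa using PiLp.norm_apply_le ξ i) (hm1 i) (norm_nonneg _)
        (norm_nonneg _)
    have h2 : ‖∑ i, (η i : ℂ) * ∫ w, (w.2 i : ℂ) * unitChar (-(t * σ w)) ∂μ‖ ≤
        d * (‖η‖ * (|C₁| * ρ)) := by
      refine (norm_sum_le_of_le (n := fun _ => ‖η‖ * (|C₁| * ρ)) _ fun i _ => ?_).trans_eq
        (by simp)
      rw [norm_mul]
      exact mul_le_mul (by simpa using PiLp.norm_apply_le η i) (hm2 i) (norm_nonneg _)
        (norm_nonneg _)
    calc _ ≤ 2 * Real.pi * (d * (‖ξ‖ * (|C₁| * ρ)) + d * (‖η‖ * (|C₁| * ρ))) := by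
          gcongr
          exact (norm_add_le _ _).trans (add_le_add h1 h2)
      _ = _ := by ring
  have := (convex_Icc (1 : ℝ) 2).norm_image_sub_le_of_norm_hasDerivWithin_le
    (f := fun t : ℝ => fourierMeasure μ (t • ξ, t • η))
    (fun t _ => (hderiv t).hasDerivWithinAt) hbound hs ht
  simpa [Real.norm_eq_abs] using this

/-- Hölder continuity in the dilation parameter of a measure with Fourier decay. -/
theorem fourierMeasure_holder {d : ℕ} {μ : Measure (Rd d × Rd d)} [IsFiniteMeasure μ]
    (hμ : IsCompactlySupported μ) {a C : ℝ} (ha : 0 ≤ a)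
    (hC : ∀ ξ η, ‖fourierMeasure μ (ξ, η)‖ ≤ C * (1 + ‖ξ‖ + ‖η‖) ^ (-a)) :
    ∃ C' : ℝ, 0 ≤ C' ∧ ∀ θ ∈ Set.Icc (0 : ℝ) 1, ∀ ξ η : Rd d, ∀ s ∈ Set.Icc (1 : ℝ) 2,
      ∀ t ∈ Set.Icc (1 : ℝ) 2,
      ‖fourierMeasure μ (t • ξ, t • η) - fourierMeasure μ (s • ξ, s • η)‖ ≤
        C' * |t - s| ^ θ * (1 + ‖ξ‖ + ‖η‖) ^ (θ - a) := by
  obtain ⟨L, hL0, hL⟩ := fourierMeasure_lipschitz hμ ha hC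
  have hC0 : 0 ≤ C := by simpa using (norm_nonneg _).trans (hC 0 0)
  refine ⟨L + 2 * C, by positivity, fun θ hθ ξ η s hs t ht => ?_⟩
  set ρ := ‖ξ‖ + ‖η‖ with hρ
  have hρ0 : 0 ≤ ρ := by positivity
  have hpos : 0 < 1 + ρ := by positivity
  have key : ‖fourierMeasure μ (t • ξ, t • η) - fourierMeasure μ (s • ξ, s • η)‖ ≤
      (L + 2 * C) * (|t - s| * ρ) ^ θ * (1 + ρ) ^ (-a) := by
    -- With `x = |t - s| ρ`, the Lipschitz bound and `x ≤ x^θ` serve for `x ≤ 1`. Pure decay and `1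
    -- ≤ x^θ` serve for `x ≥ 1`.
    rcases le_total (|t - s| * ρ) 1 with h | h
    · calc _ ≤ L * ρ * (1 + ‖ξ‖ + ‖η‖) ^ (-a) * |t - s| := hL ξ η s hs t ht
        _ = L * (|t - s| * ρ) * (1 + ρ) ^ (-a) := by rw [hρ, add_assoc]; ring
        _ ≤ _ := by
          gcongr
          · linarith
          · exact Real.self_le_rpow_of_le_one (by positivity) h hθ.2
    · have hdec : ∀ t ∈ Set.Icc (1 : ℝ) 2,
          ‖fourierMeasure μ (t • ξ, t • η)‖ ≤ C * (1 + ρ) ^ (-a) := fun t ht => by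
        refine (hC _ _).trans ?_
        refine mul_le_mul_of_nonneg_left ?_ hC0
        refine Real.rpow_le_rpow_of_nonpos (by positivity) ?_ (by linarith)
        have ht0 : (0 : ℝ) ≤ t := by linarith [ht.1]
        rw [norm_smul, norm_smul, Real.norm_of_nonneg ht0]
        nlinarith [norm_nonneg ξ, norm_nonneg η, ht.1]
      calc _ ≤ C * (1 + ρ) ^ (-a) + C * (1 + ρ) ^ (-a) :=
            (norm_sub_le _ _).trans (add_le_add (hdec t ht) (hdec s hs))
        _ = (2 * C) * 1 * (1 + ρ) ^ (-a) := by ring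
        _ ≤ _ := by
          gcongr
          · linarith
          · exact Real.one_le_rpow h hθ.1
  refine key.trans ?_
  rw [add_assoc, ← hρ, Real.mul_rpow (abs_nonneg _) hρ0, show θ - a = θ + -a by ring,
    Real.rpow_add hpos]
  have : ρ ^ θ ≤ (1 + ρ) ^ θ := Real.rpow_le_rpow hρ0 (by linarith) hθ.1
  calc _ ≤ (L + 2 * C) * (|t - s| ^ θ * (1 + ρ) ^ θ) * (1 + ρ) ^ (-a) := by gcongr
    _ = _ := by ring

end

/-! ### Chaining over the parameter set. -/

/-- Minkowski's inequality in `L²` for series of nonnegative functions. -/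
lemma lintegral_tsum_sq_le {X : Type*} [MeasurableSpace X] {ν : Measure X} {D : ℕ → X → ℝ≥0∞}
    (hD : ∀ j, Measurable (D j)) :
    (∫⁻ x, (∑' j, D j x) ^ (2 : ℝ) ∂ν) ^ (1 / 2 : ℝ) ≤
      ∑' j, (∫⁻ x, D j x ^ (2 : ℝ) ∂ν) ^ (1 / 2 : ℝ) := by
  set B : ℝ≥0∞ := ∑' j, (∫⁻ x, D j x ^ (2 : ℝ) ∂ν) ^ (1 / 2 : ℝ) with hB
  have hfin : ∀ J : ℕ, (∫⁻ x, (∑ j ∈ Finset.range J, D j x) ^ (2 : ℝ) ∂ν) ^ (1 / 2 : ℝ) ≤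
      ∑ j ∈ Finset.range J, (∫⁻ x, D j x ^ (2 : ℝ) ∂ν) ^ (1 / 2 : ℝ) := by
    intro J
    induction J with
    | zero => simp
    | succ J ih =>
      simp only [Finset.sum_range_succ]
      refine (ENNReal.lintegral_Lp_add_le (p := 2) (f := fun x => ∑ j ∈ Finset.range J, D j x)
        (g := D J) (Finset.measurable_fun_sum _ fun j _ => hD j).aemeasurable
        (hD J).aemeasurable (by norm_num)).trans ?_
      gcongr
  have hJ : ∀ J : ℕ, ∫⁻ x, (∑ j ∈ Finset.range J, D j x) ^ (2 : ℝ) ∂ν ≤ B ^ (2 : ℝ) := by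
    intro J
    have h1 := (hfin J).trans (ENNReal.sum_le_tsum _)
    have h2 := ENNReal.rpow_le_rpow h1 (show (0 : ℝ) ≤ 2 by norm_num)
    rwa [← ENNReal.rpow_mul, show (1 / 2 : ℝ) * 2 = 1 by norm_num, ENNReal.rpow_one] at h2
  have hmono : ∫⁻ x, (∑' j, D j x) ^ (2 : ℝ) ∂ν ≤ B ^ (2 : ℝ) := by
    have : ∀ x, (∑' j, D j x) ^ (2 : ℝ) =
        ⨆ J : ℕ, (∑ j ∈ Finset.range J, D j x) ^ (2 : ℝ) := by
      intro x
      rw [ENNReal.tsum_eq_iSup_nat]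
      exact (ENNReal.orderIsoRpow 2 (by norm_num)).map_iSup _
    simp only [this]
    rw [lintegral_iSup]
    · exact iSup_le hJ
    · intro J
      exact (Finset.measurable_fun_sum _ fun j _ => hD j).pow_const _
    · intro J J' hJJ x
      exact ENNReal.rpow_le_rpow
        (Finset.sum_le_sum_of_subset (Finset.range_mono hJJ)) (by norm_num)
  calc _ ≤ (B ^ (2 : ℝ)) ^ (1 / 2 : ℝ) := ENNReal.rpow_le_rpow hmono (by norm_num)
    _ = B := by rw [← ENNReal.rpow_mul]; norm_num

/-- Chaining in `L²`: a family which is Hölder continuous as a map to `L²` has a maximal function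
in `L²`, provided that the parameter set has nets of small cardinality. -/
theorem lintegral_iSup_sq_le_of_chaining {D : ℝ≥0} {G T : ℝ≥0} (hGT : G ^ (1 / 2 : ℝ) * T < 1) :
    ∃ C : ℝ≥0, ∀ {X : Type} [MeasurableSpace X] {ν : Measure X} {F : ℝ → X → ℂ} {E : Set ℝ}
      {N : ℕ → Finset ℝ} {A : ℝ≥0∞}, (∀ t, Measurable (F t)) → (∀ x, Continuous fun t => F t x) →
      (∀ j, ∀ s ∈ N j, s ∈ E) → (∀ j, ((N j).card : ℝ≥0∞) ≤ D * G ^ j) →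
      (∀ j, ∀ t ∈ E, ∃ s ∈ N j, |t - s| ≤ (1 / 2 : ℝ) ^ j) →
      (∀ t ∈ E, (∫⁻ x, ‖F t x‖ₑ ^ (2 : ℝ) ∂ν) ^ (1 / 2 : ℝ) ≤ A) →
      (∀ j, ∀ t ∈ E, ∀ s ∈ E, |t - s| ≤ (1 / 2 : ℝ) ^ j →
        (∫⁻ x, ‖F t x - F s x‖ₑ ^ (2 : ℝ) ∂ν) ^ (1 / 2 : ℝ) ≤ A * T ^ j) →
      (∫⁻ x, (⨆ t ∈ E, ‖F t x‖ₑ) ^ (2 : ℝ) ∂ν) ^ (1 / 2 : ℝ) ≤ C * A := by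
  -- The step from level `j` to level `j + 1` costs the square root of the net size, about
  -- `G^(j/2)`, and gains `T^j`. The ratio of the resulting geometric series is `R`.
  set R : ℝ≥0 := G ^ (1 / 2 : ℝ) * T with hR
  have hS : (∑' j : ℕ, ((D * G : ℝ≥0) : ℝ≥0∞) ^ (1 / 2 : ℝ) * (R : ℝ≥0∞) ^ j) ≠ ∞ := by
    rw [ENNReal.tsum_mul_left, ENNReal.tsum_geometric]
    refine ENNReal.mul_ne_top (ENNReal.rpow_ne_top_of_nonneg (by norm_num) ENNReal.coe_ne_top) ?_
    simpa [tsub_eq_zero_iff_le] using hGT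
  refine ⟨((D : ℝ≥0∞) ^ (1 / 2 : ℝ) +
    ∑' j : ℕ, ((D * G : ℝ≥0) : ℝ≥0∞) ^ (1 / 2 : ℝ) * (R : ℝ≥0∞) ^ j).toNNReal, ?_⟩
  intro X _ ν F E N A hFm hFc hNE hNc hN hA hAT
  rw [ENNReal.coe_toNNReal (ENNReal.add_ne_top.2
    ⟨ENNReal.rpow_ne_top_of_nonneg (by norm_num) (by simp), hS⟩)]
  -- A maximum over a finite set is dominated by the `ℓ²` sum, so in `L²` it costs the square root
  -- of the cardinality.
  have hfinsum : ∀ (S : Finset ℝ) (H : ℝ → X → ℂ) (a : ℝ≥0∞), (∀ s, Measurable (H s)) →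
      (∀ s ∈ S, (∫⁻ x, ‖H s x‖ₑ ^ (2 : ℝ) ∂ν) ^ (1 / 2 : ℝ) ≤ a) →
      (∫⁻ x, ((∑ s ∈ S, ‖H s x‖ₑ ^ (2 : ℝ)) ^ (1 / 2 : ℝ)) ^ (2 : ℝ) ∂ν) ^ (1 / 2 : ℝ) ≤
        (S.card : ℝ≥0∞) ^ (1 / 2 : ℝ) * a := by
    intro S H a hH ha
    have e : ∀ x : X, ((∑ s ∈ S, ‖H s x‖ₑ ^ (2 : ℝ)) ^ (1 / 2 : ℝ)) ^ (2 : ℝ) =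
        ∑ s ∈ S, ‖H s x‖ₑ ^ (2 : ℝ) := fun x => by
      rw [← ENNReal.rpow_mul]; norm_num
    simp only [e]
    rw [lintegral_finsetSum _ fun s _ => (hH s).enorm.pow_const _]
    have : ∑ s ∈ S, ∫⁻ x, ‖H s x‖ₑ ^ (2 : ℝ) ∂ν ≤ S.card * a ^ (2 : ℝ) := by
      rw [← nsmul_eq_mul]
      refine Finset.sum_le_card_nsmul _ _ _ fun s hs => ?_
      have := ENNReal.rpow_le_rpow (ha s hs) (show (0 : ℝ) ≤ 2 by norm_num)
      rwa [← ENNReal.rpow_mul, show (1 / 2 : ℝ) * 2 = 1 by norm_num, ENNReal.rpow_one] at this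
    refine (ENNReal.rpow_le_rpow this (by norm_num)).trans (le_of_eq ?_)
    rw [ENNReal.mul_rpow_of_nonneg _ _ (by norm_num), ← ENNReal.rpow_mul]
    norm_num
  have hle : ∀ (S : Finset ℝ) (H : ℝ → X → ℂ) (x : X), ∀ s ∈ S,
      ‖H s x‖ₑ ≤ (∑ s ∈ S, ‖H s x‖ₑ ^ (2 : ℝ)) ^ (1 / 2 : ℝ) := by
    intro S H x s hs
    have := Finset.single_le_sum (f := fun s => ‖H s x‖ₑ ^ (2 : ℝ)) (fun _ _ => zero_le) hs
    have := ENNReal.rpow_le_rpow this (show (0 : ℝ) ≤ 1 / 2 by norm_num)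
    rwa [← ENNReal.rpow_mul, show (2 : ℝ) * (1 / 2) = 1 by norm_num, ENNReal.rpow_one] at this
  choose! π hπN hπ using hN
  set M₀ : X → ℝ≥0∞ := fun x => (∑ s ∈ N 0, ‖F s x‖ₑ ^ (2 : ℝ)) ^ (1 / 2 : ℝ) with hM₀
  set Δ : ℕ → X → ℝ≥0∞ := fun j x =>
    (∑ s ∈ N (j + 1), ‖F s x - F (π j s) x‖ₑ ^ (2 : ℝ)) ^ (1 / 2 : ℝ) with hΔ
  have hM₀m : Measurable M₀ :=
    (Finset.measurable_fun_sum _ fun s _ => (hFm s).enorm.pow_const _).pow_const _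
  have hΔm : ∀ j, Measurable (Δ j) := fun j =>
    (Finset.measurable_fun_sum _ fun s _ =>
      ((hFm s).sub (hFm _)).enorm.pow_const _).pow_const _
  -- Telescoping: a point of the finest net is linked to the coarsest one by repeatedly passing to
  -- the nearby point `π` of the previous net.
  have hstep : ∀ x J, ∀ s ∈ N J, ‖F s x‖ₑ ≤ M₀ x + ∑ j ∈ Finset.range J, Δ j x := by
    intro x J
    induction J with
    | zero => 
      intro s hs
      simp only [Finset.range_zero, Finset.sum_empty, add_zero]
      exact hle (N 0) F x s hs
    | succ J ih =>
      intro s hs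
      have hsE := hNE _ s hs
      rw [Finset.sum_range_succ]
      calc ‖F s x‖ₑ = ‖F (π J s) x + (F s x - F (π J s) x)‖ₑ := by ring_nf
        _ ≤ ‖F (π J s) x‖ₑ + ‖F s x - F (π J s) x‖ₑ := enorm_add_le _ _
        _ ≤ (M₀ x + ∑ j ∈ Finset.range J, Δ j x) + Δ J x :=
          add_le_add (ih _ (hπN J s hsE))
            (hle (N (J + 1)) (fun s x => F s x - F (π J s) x) x s hs)
        _ = _ := by rw [add_assoc]
  -- The nets become dense in `E`, so continuity in `t` extends the chained bound from net points to
  -- all of `E`.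
  have hpt : ∀ x, (⨆ t ∈ E, ‖F t x‖ₑ) ≤ M₀ x + ∑' j, Δ j x := by
    intro x
    refine iSup₂_le fun t ht => ?_
    have hlim : Tendsto (fun J => π J t) atTop (𝓝 t) := by
      rw [tendsto_iff_dist_tendsto_zero]
      refine squeeze_zero (fun J => dist_nonneg) (fun J => ?_)
        (tendsto_pow_atTop_nhds_zero_of_lt_one (r := (1 / 2 : ℝ)) (by norm_num) (by norm_num))
      rw [dist_comm]; exact hπ J t ht
    have hlim2 : Tendsto (fun J => ‖F (π J t) x‖ₑ) atTop (𝓝 ‖F t x‖ₑ) :=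
      ((hFc x).enorm.tendsto t).comp hlim
    refine le_of_tendsto hlim2 (Eventually.of_forall fun J => ?_)
    refine (hstep x J _ (hπN J t ht)).trans ?_
    gcongr
    exact ENNReal.sum_le_tsum _
  calc (∫⁻ x, (⨆ t ∈ E, ‖F t x‖ₑ) ^ (2 : ℝ) ∂ν) ^ (1 / 2 : ℝ)
      ≤ (∫⁻ x, (M₀ x + ∑' j, Δ j x) ^ (2 : ℝ) ∂ν) ^ (1 / 2 : ℝ) :=
        ENNReal.rpow_le_rpow (lintegral_mono fun x =>
          ENNReal.rpow_le_rpow (hpt x) (by norm_num)) (by norm_num)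
    _ ≤ (∫⁻ x, M₀ x ^ (2 : ℝ) ∂ν) ^ (1 / 2 : ℝ) +
        (∫⁻ x, (∑' j, Δ j x) ^ (2 : ℝ) ∂ν) ^ (1 / 2 : ℝ) :=
        ENNReal.lintegral_Lp_add_le (f := M₀) (g := fun x => ∑' j, Δ j x) hM₀m.aemeasurable
          (Measurable.tsum hΔm).aemeasurable (by norm_num)
    _ ≤ (∫⁻ x, M₀ x ^ (2 : ℝ) ∂ν) ^ (1 / 2 : ℝ) +
        ∑' j, (∫⁻ x, Δ j x ^ (2 : ℝ) ∂ν) ^ (1 / 2 : ℝ) := by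
        gcongr; exact lintegral_tsum_sq_le hΔm
    _ ≤ (D : ℝ≥0∞) ^ (1 / 2 : ℝ) * A +
        ∑' j : ℕ, (((D * G : ℝ≥0) : ℝ≥0∞) ^ (1 / 2 : ℝ) * (R : ℝ≥0∞) ^ j) * A := by
        gcongr with j
        · refine (hfinsum (N 0) F A hFm fun s hs => hA s (hNE 0 s hs)).trans ?_
          gcongr
          simpa using hNc 0
        · refine (hfinsum (N (j + 1)) (fun s x => F s x - F (π j s) x) (A * T ^ j)
            (fun s => (hFm s).sub (hFm _)) fun s hs => ?_).trans ?_
          · have hsE := hNE _ s hs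
            exact hAT j s hsE _ (hNE j _ (hπN j s hsE)) (hπ j s hsE)
          · calc _ ≤ ((D : ℝ≥0∞) * G ^ (j + 1)) ^ (1 / 2 : ℝ) * (A * T ^ j) := by
                  gcongr; exact hNc (j + 1)
              _ = _ := by
                  have e : ((G : ℝ≥0∞) ^ j) ^ (1 / 2 : ℝ) = ((G : ℝ≥0∞) ^ (1 / 2 : ℝ)) ^ j := by
                    rw [← ENNReal.rpow_natCast, ← ENNReal.rpow_mul, mul_comm, ENNReal.rpow_mul,
                      ENNReal.rpow_natCast]
                  have h2 : (0 : ℝ) ≤ 1 / 2 := by norm_num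
                  simp only [pow_succ', hR, ENNReal.mul_rpow_of_nonneg _ _ h2, e,
                    ENNReal.coe_mul, mul_pow, ENNReal.coe_rpow_of_nonneg _ h2]
                  ring
    _ = _ := by rw [ENNReal.tsum_mul_right]; ring

/-- Covering intervals need not be centred in `E`, while chaining needs net points in `E`. One point
of `E` is picked from each interval that meets it. -/
lemma exists_net_of_cover {E : Set ℝ} {δ : ℝ} {n : ℕ} {c : Fin n → ℝ}
    (hc : E ⊆ ⋃ i, Set.Icc (c i) (c i + δ)) :
    ∃ N : Finset ℝ, (∀ s ∈ N, s ∈ E) ∧ N.card ≤ n ∧ ∀ t ∈ E, ∃ s ∈ N, |t - s| ≤ δ := by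
  classical
  have : ∀ i : Fin n, ∃ s, (∃ t ∈ E, t ∈ Set.Icc (c i) (c i + δ)) →
      s ∈ E ∧ s ∈ Set.Icc (c i) (c i + δ) := fun i => by
    by_cases h : ∃ t ∈ E, t ∈ Set.Icc (c i) (c i + δ)
    · obtain ⟨t, h1, h2⟩ := h; exact ⟨t, fun _ => ⟨h1, h2⟩⟩
    · exact ⟨0, fun h' => absurd h' h⟩
  choose p hp using this
  refine ⟨(Finset.univ.image p).filter (· ∈ E), fun s hs => (Finset.mem_filter.1 hs).2, ?_, ?_⟩
  · exact (Finset.card_filter_le _ _).trans (Finset.card_image_le.trans (by simp))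
  · intro t ht
    obtain ⟨i, hi⟩ := Set.mem_iUnion.1 (hc ht)
    obtain ⟨h1, h2⟩ := hp i ⟨t, ht, hi⟩
    refine ⟨p i, by simp [h1], ?_⟩
    rw [abs_le]; constructor <;> linarith [hi.1, hi.2, h2.1, h2.2]

/-- This guarantees that the minimum defining `intervalCoveringNumber` is attained at dyadic
lengths, and it supplies the nets for `γ = 1`. The additional interval beyond `2 ^ j` is for the
endpoint `t = 2`. -/
lemma dyadic_cover {E : Set ℝ} (hE : E ⊆ Set.Icc 1 2) (j : ℕ) :
    E ⊆ ⋃ i : Fin (2 ^ j + 1), Set.Icc (1 + (i : ℝ) * (1 / 2) ^ j)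
      (1 + (i : ℝ) * (1 / 2) ^ j + (1 / 2) ^ j) := by
  intro t ht
  obtain ⟨h1, h2⟩ := hE ht
  have hp : (0 : ℝ) < 2 ^ j := by positivity
  have hfl : ⌊(t - 1) * 2 ^ j⌋₊ < 2 ^ j + 1 := by
    rw [Nat.floor_lt' (by positivity)]; push_cast; nlinarith
  refine Set.mem_iUnion.2 ⟨⟨_, hfl⟩, ?_⟩
  have e1 := Nat.floor_le (show 0 ≤ (t - 1) * 2 ^ j by
    apply mul_nonneg; linarith; positivity)
  have e2 := (Nat.lt_floor_add_one ((t - 1) * 2 ^ j)).le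
  have e3 : (1 / 2 : ℝ) ^ j * 2 ^ j = 1 := by rw [← mul_pow]; norm_num
  have e4 : (0 : ℝ) < (1 / 2) ^ j := by positivity
  constructor
  · have := mul_le_mul_of_nonneg_right e1 e4.le
    rw [mul_assoc, mul_comm (2 ^ j : ℝ), e3] at this
    simp only; linarith
  · have := mul_le_mul_of_nonneg_right e2 e4.le
    rw [mul_assoc, mul_comm (2 ^ j : ℝ), e3] at this
    simp only; linarith

/-- A set of upper Minkowski dimension `β` has nets of cardinality `O(2^(γj))` for every
nonnegative `γ > β`, and also for `γ = 1`. -/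
lemma exists_nets {E : Set ℝ} (hE : E ⊆ Set.Icc 1 2) {β : ℝ}
    (hβ : upperMinkowskiDim E = (β : EReal)) {γ : ℝ} (hγ0 : 0 ≤ γ) (hγ : β < γ ∨ γ = 1) :
    ∃ (D : ℝ≥0) (N : ℕ → Finset ℝ), (∀ j, ∀ s ∈ N j, s ∈ E) ∧
      (∀ j, ((N j).card : ℝ≥0∞) ≤ D * (((2 : ℝ≥0) ^ γ : ℝ≥0) : ℝ≥0∞) ^ j) ∧
      ∀ j, ∀ t ∈ E, ∃ s ∈ N j, |t - s| ≤ (1 / 2 : ℝ) ^ j := by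
  rcases hγ with hγ | rfl
  · have hev := eventually_lt_of_limsup_lt (show upperMinkowskiDim E < (γ : EReal) by
      rw [hβ]; exact_mod_cast hγ)
    have hlim : Tendsto (fun j : ℕ => (1 / 2 : ℝ) ^ j) atTop (𝓝[>] 0) :=
      tendsto_nhdsWithin_iff.2 ⟨tendsto_pow_atTop_nhds_zero_of_lt_one (by norm_num) (by norm_num),
        Eventually.of_forall fun j => by simp⟩
    obtain ⟨j₀, hj₀⟩ := eventually_atTop.1 (hlim.eventually hev)
    have hcard : ∀ j, max j₀ 1 ≤ j → (intervalCoveringNumber E ((1 / 2) ^ j) : ℝ) ≤ 2 ^ (γ * j) := by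
      intro j hj
      have h1 := hj₀ j ((le_max_left _ _).trans hj)
      rw [EReal.coe_lt_coe_iff] at h1
      have hj1 : (1 : ℝ) ≤ j := by exact_mod_cast (le_max_right _ _).trans hj
      have hl : Real.log (1 / (1 / 2) ^ j) = j * Real.log 2 := by
        rw [one_div, ← inv_pow, Real.log_pow]; norm_num
      have hl2 := Real.log_pos (show (1 : ℝ) < 2 by norm_num)
      rw [hl, div_lt_iff₀ (by positivity)] at h1
      rcases Nat.eq_zero_or_pos (intervalCoveringNumber E ((1 / 2) ^ j)) with h0 | h0
      · rw [h0]; simp; positivity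
      · rw [← Real.log_le_log_iff (by exact_mod_cast h0) (by positivity),
          Real.log_rpow (by norm_num)]
        linarith
    have hnet : ∀ j : ℕ, ∃ N : Finset ℝ, (∀ s ∈ N, s ∈ E) ∧
        N.card ≤ intervalCoveringNumber E ((1 / 2) ^ j) ∧
        ∀ t ∈ E, ∃ s ∈ N, |t - s| ≤ (1 / 2 : ℝ) ^ j := by
      intro j
      obtain ⟨c, hc⟩ := Nat.sInf_mem (s := {n : ℕ | ∃ c : Fin n → ℝ,
        E ⊆ ⋃ i, Set.Icc (c i) (c i + (1 / 2) ^ j)}) ⟨_, _, dyadic_cover hE j⟩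
      exact exists_net_of_cover hc
    choose N hNE hNc hN using hnet
    set J := max j₀ 1
    -- The dimension controls only small scales. For `j < J` the finer net of level `J` is used, and
    -- its size is absorbed into the constant. Since `γ ≥ 0`, `γ max(j, J) ≤ γJ + γj`.
    refine ⟨(2 : ℝ≥0) ^ (γ * J), fun j => N (max j J), fun j => hNE _, fun j => ?_, fun j t ht => ?_⟩
    · have h1 : ((N (max j J)).card : ℝ) ≤ 2 ^ (γ * J) * (2 ^ γ) ^ j := by
        calc ((N (max j J)).card : ℝ) ≤ (intervalCoveringNumber E ((1 / 2) ^ (max j J)) : ℝ) := by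
              exact_mod_cast hNc _
          _ ≤ 2 ^ (γ * (max j J : ℕ)) := hcard _ (le_max_right _ _)
          _ ≤ 2 ^ (γ * J + γ * j) := by
              apply Real.rpow_le_rpow_of_exponent_le (by norm_num)
              rw [← mul_add]
              apply mul_le_mul_of_nonneg_left _ hγ0
              rw [Nat.cast_max]
              exact max_le (by linarith [(J.cast_nonneg : (0 : ℝ) ≤ J)])
                (by linarith [(j.cast_nonneg : (0 : ℝ) ≤ j)])
          _ = _ := by rw [Real.rpow_add (by norm_num), Real.rpow_mul (by norm_num),
              Real.rpow_mul (by norm_num), Real.rpow_natCast, Real.rpow_natCast]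
      have h2 : ((N (max j J)).card : ℝ≥0) ≤ 2 ^ (γ * J) * (2 ^ γ) ^ j := by
        rw [← NNReal.coe_le_coe]; push_cast; exact h1
      exact_mod_cast h2
    · obtain ⟨s, hs, hst⟩ := hN (max j J) t ht
      exact ⟨s, hs, hst.trans (pow_le_pow_of_le_one (by norm_num) (by norm_num) (le_max_left _ _))⟩
  · choose N hNE hNc hN using fun j => exists_net_of_cover (dyadic_cover hE j)
    refine ⟨2, N, hNE, fun j => ?_, hN⟩
    have : (N j).card ≤ 2 * 2 ^ j := (hNc j).trans (by have := Nat.one_le_two_pow (n := j); omega)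
    simp only [NNReal.rpow_one]
    exact_mod_cast this

/-! ### The translation estimate in `L² × L² → L²`. -/

section

open SchwartzMap

/-- Interpolation between the Lipschitz bound `2π|s|` and the trivial bound 2. -/
lemma norm_one_sub_unitChar_le {ε : ℝ} (hε0 : 0 ≤ ε) (hε1 : ε ≤ 1) (s : ℝ) :
    ‖1 - unitChar s‖ ≤ 2 * Real.pi * |s| ^ ε := by
  have hpi := Real.pi_gt_three
  rcases le_total |s| 1 with h | h
  · have h1 : ‖1 - unitChar s‖ ≤ 2 * Real.pi * |s| := by
      have e : unitChar s = Complex.exp (Complex.I * ((2 * Real.pi * s : ℝ) : ℂ)) := by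
        rw [unitChar]; push_cast; ring_nf
      rw [norm_sub_rev, e]
      refine (Real.norm_exp_I_mul_ofReal_sub_one_le).trans_eq ?_
      rw [Real.norm_eq_abs, abs_mul, abs_of_pos (by positivity)]
    refine h1.trans ?_
    gcongr
    exact Real.self_le_rpow_of_le_one (abs_nonneg _) h hε1
  · calc ‖1 - unitChar s‖ ≤ 1 + 1 := by simpa using norm_sub_le (1 : ℂ) (unitChar s)
      _ ≤ 2 * Real.pi * 1 := by linarith
      _ ≤ _ := by gcongr; exact Real.one_le_rpow h hε0

lemma continuous_fourierMeasure {d : ℕ} (μ : Measure (Rd d × Rd d)) [IsFiniteMeasure μ] :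
    Continuous (fourierMeasure μ) := by
  have : fourierMeasure μ = fun ζ => ∫ w, unitChar (-(inner ℝ w.1 ζ.1 + inner ℝ w.2 ζ.2)) ∂μ :=
    funext fun ζ => fourierMeasure_eq μ ζ
  rw [this]
  refine continuous_of_dominated (bound := fun _ => 1) (fun ζ => ?_) (fun ζ => ?_)
    (integrable_const _) (Eventually.of_forall fun w => by fun_prop)
  · apply Continuous.aestronglyMeasurable; fun_prop
  · exact Eventually.of_forall fun w => by simp

/-- Bilinear averages of bounded continuous functions are continuous in scale and position. -/
lemma continuous_bilinearAverage {d : ℕ} (μ : Measure (Rd d × Rd d)) [IsFiniteMeasure μ]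
    {f g : Rd d → ℂ} {A B : ℝ} (hf : Continuous f) (hg : Continuous g) (hA : ∀ x, ‖f x‖ ≤ A)
    (hB : ∀ x, ‖g x‖ ≤ B) :
    Continuous fun p : ℝ × Rd d => bilinearAverage μ p.1 f g p.2 := by
  unfold bilinearAverage
  refine continuous_of_dominated (bound := fun _ => A * B) (fun p => ?_) (fun p => ?_)
    (integrable_const _) (Eventually.of_forall fun w => by fun_prop)
  · apply Continuous.aestronglyMeasurable; fun_prop
  · refine Eventually.of_forall fun w => ?_
    rw [norm_mul]
    exact mul_le_mul (hA _) (hB _) (norm_nonneg _) ((norm_nonneg _).trans (hA 0))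

lemma schwartz_bounded {d : ℕ} (f : 𝓢(Rd d, ℂ)) : ∃ A : ℝ, ∀ x, ‖f x‖ ≤ A := by
  obtain ⟨A, hA⟩ := f.decay 0 0
  exact ⟨A, fun x => by simpa using hA.2 x⟩

lemma fourier_sub_translate {d : ℕ} (f : 𝓢(Rd d, ℂ)) (u ξ : Rd d) :
    𝓕 (fun y => f y - f (y - u)) ξ = (1 - unitChar (-inner ℝ u ξ)) * 𝓕 (f : Rd d → ℂ) ξ := by
  simp only [fourier_eq_unitChar]
  have hb : ∀ F : 𝓢(Rd d, ℂ), Integrable fun y => F y * unitChar (-inner ℝ ξ y) := fun F =>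
    F.integrable.mul_bdd (c := 1) (by apply Continuous.aestronglyMeasurable; fun_prop)
      (Eventually.of_forall fun p => by simp)
  have h2 := hb (f.compSubConstCLM ℂ u)
  simp only [SchwartzMap.compSubConstCLM_apply] at h2
  simp only [sub_mul]
  rw [integral_sub (hb f) h2, one_mul]
  congr 1
  have := integral_sub_right_eq_self (μ := (volume : Measure (Rd d)))
    (fun y => f y * unitChar (-inner ℝ ξ (y + u))) u
  simp only [sub_add_cancel] at this
  rw [this, ← integral_const_mul]
  congr 1 with y
  rw [inner_add_right, neg_add, unitChar_add, real_inner_comm u ξ]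
  ring

lemma bilinearMultiplier_sub {d : ℕ} {m m' : Rd d × Rd d → ℂ} {K : ℝ} (hm : Continuous m)
    (hm' : Continuous m') (hK : ∀ ζ, ‖m ζ‖ ≤ K) (hK' : ∀ ζ, ‖m' ζ‖ ≤ K) (f g : 𝓢(Rd d, ℂ))
    (x : Rd d) :
    bilinearMultiplier m f g x - bilinearMultiplier m' f g x =
      bilinearMultiplier (fun ζ => m ζ - m' ζ) f g x := by
  have hb : ∀ m : Rd d × Rd d → ℂ, Continuous m → (∀ ζ, ‖m ζ‖ ≤ K) →
      Integrable (fun ζ : Rd d × Rd d => 𝓕 (f : Rd d → ℂ) ζ.1 * 𝓕 (g : Rd d → ℂ) ζ.2 * m ζ *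
        unitChar (inner ℝ x (ζ.1 + ζ.2))) := fun m hm hK =>
    ((((integrable_fourier_schwartz f).mul_prod (integrable_fourier_schwartz g)).mul_bdd (c := K)
      hm.aestronglyMeasurable (Eventually.of_forall hK))).mul_bdd (c := 1)
      (by apply Continuous.aestronglyMeasurable; fun_prop) (Eventually.of_forall fun p => by simp)
  simp only [bilinearMultiplier_eq]
  rw [← integral_sub (hb m hm hK) (hb m' hm' hK')]
  congr 1 with ζ
  ring

/-- Here `κ` will be the decay in excess of `d/2`. Of it, `θ > γ/2` pays for chaining over nets of
size `2^(γj)`, `ε` pays for the translation, and something must remain. The alternative `γ = 1`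
keeps `γ/2` below the maximal Hölder exponent 1 when there is decay to spare. -/
lemma exists_chaining_exponents {κ β : ℝ} (hκ : 0 < κ) (hβ : β < 2 * κ) :
    ∃ γ θ ε : ℝ, 0 ≤ γ ∧ (β < γ ∨ γ = 1) ∧ γ / 2 < θ ∧ 0 ≤ θ ∧ θ ≤ 1 ∧ 0 < ε ∧ ε ≤ 1 ∧
      θ + ε < κ := by
  have h1 : ∃ γ : ℝ, 0 ≤ γ ∧ γ ≤ 1 ∧ (β < γ ∨ γ = 1) ∧ γ < 2 * κ := by
    have hm : max β 0 < 2 * κ := max_lt hβ (by linarith)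
    have hb : β ≤ max β 0 := le_max_left _ _
    have h0 : 0 ≤ max β 0 := le_max_right _ _
    rcases le_total ((max β 0 + 2 * κ) / 2) 1 with h | h
    · exact ⟨(max β 0 + 2 * κ) / 2, by linarith, h, Or.inl (by linarith), by linarith⟩
    · exact ⟨1, by norm_num, le_rfl, Or.inr rfl, by linarith⟩
  obtain ⟨γ, hγ0, hγ1, hγ, hγκ⟩ := h1
  have hm : γ / 2 < min 1 κ := lt_min (by linarith) (by linarith)
  have hm1 := min_le_left 1 κ
  have hm2 := min_le_right 1 κ
  refine ⟨γ, (γ / 2 + min 1 κ) / 2, min 1 ((κ - (γ / 2 + min 1 κ) / 2) / 2), hγ0, hγ,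
    by linarith, by linarith, by linarith, lt_min one_pos (by linarith), min_le_left _ _, ?_⟩
  have := min_le_right 1 ((κ - (γ / 2 + min 1 κ) / 2) / 2)
  linarith

/-- Continuity estimate at `L² × L² → L²` for the single scale maximal operator. -/
theorem l2_translation_estimate {d : ℕ} {E : Set ℝ} (hE : E ⊆ Set.Icc 1 2) {β : ℝ}
    (hβ : upperMinkowskiDim E = (β : EReal)) {μ : Measure (Rd d × Rd d)} [IsFiniteMeasure μ]
    (hμ : IsCompactlySupported μ) {a : ℝ} (ha : IsAdmissible μ a) (haβ : (d : ℝ) + β < 2 * a) :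
    ∃ ε : ℝ, 0 < ε ∧ ∃ C : ℝ≥0, ∀ (u : Rd d) (f g : 𝓢(Rd d, ℂ)),
      (∫⁻ x, (⨆ t ∈ E, ‖bilinearAverage μ t (fun y => f y - f (y - u)) g x‖ₑ) ^ (2 : ℝ)) ^
        (1 / 2 : ℝ) ≤
        C * ENNReal.ofReal (‖u‖ ^ ε) * eLpNorm f 2 volume * eLpNorm g 2 volume := by
  obtain ⟨had, C₀, hC₀⟩ := ha
  have hd0 : (0 : ℝ) ≤ d := d.cast_nonneg
  have ha0 : 0 ≤ a := by linarith
  have hC : ∀ ξ η : Rd d, ‖fourierMeasure μ (ξ, η)‖ ≤ C₀ * (1 + ‖ξ‖ + ‖η‖) ^ (-a) :=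
    fun ξ η => by
      rw [Real.rpow_neg (by positivity), ← div_eq_mul_inv]; exact hC₀ ξ η
  have hC₀0 : 0 ≤ C₀ := by simpa using (norm_nonneg _).trans (hC 0 0)
  obtain ⟨L, hL0, hL⟩ := fourierMeasure_holder hμ ha0 hC
  obtain ⟨γ, θ, ε, hγ0, hγ, hγθ, hθ0, hθ1, hε0, hε1, hκ⟩ :=
    exists_chaining_exponents (κ := a - d / 2) (β := β) (by linarith) (by linarith)
  -- The decay left after spending `θ` on Hölder continuity in `t` and `ε` on the translation. It
  -- still exceeds `d/2`.
  set b := a - θ - ε with hb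
  have hbd : (d : ℝ) < 2 * b := by linarith
  obtain ⟨Cb, hCb⟩ := eLpNorm_bilinearMultiplier_le hbd
  obtain ⟨D, N, hNE, hNc, hN⟩ := exists_nets hE hβ hγ0 hγ
  have hGT : ((2 : ℝ≥0) ^ γ) ^ (1 / 2 : ℝ) * (2 : ℝ≥0) ^ (-θ) < 1 := by
    rw [← NNReal.rpow_mul, ← NNReal.rpow_add (by norm_num)]
    exact NNReal.rpow_lt_one_of_one_lt_of_neg (by norm_num) (by linarith)
  obtain ⟨Cc, hCc⟩ := lintegral_iSup_sq_le_of_chaining (D := D) hGT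
  set M : ℝ := max C₀ L with hM
  have hM0 : 0 ≤ M := hC₀0.trans (le_max_left _ _)
  refine ⟨ε, hε0, Cc * Cb * (2 * Real.pi * M).toNNReal, fun u f g => ?_⟩
  have hu0 : 0 ≤ ‖u‖ ^ ε := by positivity
  -- The difference in `f` is moved into the symbol, so that the `L²` bound is applied to `f` itself
  -- and the factor `|u|^ε` is read off from the symbol.
  set w : ℝ → Rd d × Rd d → ℂ := fun t ζ =>
    (1 - unitChar (-inner ℝ u ζ.1)) * fourierMeasure μ (t • ζ.1, t • ζ.2) with hw
  have hμc := continuous_fourierMeasure μ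
  have hwc : ∀ t, Continuous (w t) := fun t => by fun_prop
  have hchar : ∀ ξ η : Rd d, ‖1 - unitChar (-inner ℝ u ξ)‖ ≤
      2 * Real.pi * ‖u‖ ^ ε * (1 + ‖ξ‖ + ‖η‖) ^ ε := fun ξ η => by
    refine (norm_one_sub_unitChar_le hε0.le hε1 _).trans ?_
    rw [abs_neg, mul_assoc (2 * Real.pi), ← Real.mul_rpow (by positivity) (by positivity)]
    gcongr
    refine (abs_real_inner_le_norm _ _).trans ?_
    gcongr
    linarith [norm_nonneg ξ, norm_nonneg η]
  have hfinal : ∀ ξ η : Rd d, (1 + ‖ξ‖ + ‖η‖) ^ (-b) ≤ (1 + ‖ξ‖) ^ (-b) := fun ξ η =>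
    Real.rpow_le_rpow_of_nonpos (by positivity) (by linarith [norm_nonneg η]) (by linarith)
  set K : ℝ≥0 := (2 * Real.pi * M).toNNReal * (‖u‖ ^ ε).toNNReal with hK
  have hKr : (K : ℝ) = 2 * Real.pi * M * ‖u‖ ^ ε := by
    rw [hK, NNReal.coe_mul, Real.coe_toNNReal _ (by positivity), Real.coe_toNNReal _ hu0]
  have hw1 : ∀ t ∈ E, ∀ ξ η, ‖w t (ξ, η)‖ ≤ K * (1 + ‖ξ‖) ^ (-b) := by
    intro t ht ξ η
    have ht1 := (hE ht).1
    have ht0 : (0 : ℝ) ≤ t := by linarith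
    have h1 : ‖fourierMeasure μ (t • ξ, t • η)‖ ≤ M * (1 + ‖ξ‖ + ‖η‖) ^ (-a) := by
      refine (hC _ _).trans (mul_le_mul (le_max_left _ _) ?_ (by positivity) hM0)
      refine Real.rpow_le_rpow_of_nonpos (by positivity) ?_ (by linarith)
      rw [norm_smul, norm_smul, Real.norm_of_nonneg ht0]
      nlinarith [norm_nonneg ξ, norm_nonneg η]
    calc ‖w t (ξ, η)‖ ≤ (2 * Real.pi * ‖u‖ ^ ε * (1 + ‖ξ‖ + ‖η‖) ^ ε) *
          (M * (1 + ‖ξ‖ + ‖η‖) ^ (-a)) := by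
          rw [hw, norm_mul]
          exact mul_le_mul (hchar ξ η) h1 (norm_nonneg _) (by positivity)
      _ = K * (1 + ‖ξ‖ + ‖η‖) ^ (ε - a) := by
          rw [hKr, sub_eq_add_neg, Real.rpow_add (by positivity)]; ring
      _ ≤ K * (1 + ‖ξ‖ + ‖η‖) ^ (-b) := by
          gcongr
          · linarith [norm_nonneg ξ, norm_nonneg η]
          · linarith
      _ ≤ _ := mul_le_mul_of_nonneg_left (hfinal ξ η) K.coe_nonneg
  have hw2 : ∀ j : ℕ, ∀ t ∈ E, ∀ s ∈ E, |t - s| ≤ (1 / 2 : ℝ) ^ j → ∀ ξ η,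
      ‖w t (ξ, η) - w s (ξ, η)‖ ≤ (K * ((2 : ℝ≥0) ^ (-θ)) ^ j : ℝ≥0) * (1 + ‖ξ‖) ^ (-b) := by
    intro j t ht s hs hts ξ η
    have hTj : |t - s| ^ θ ≤ ((2 : ℝ) ^ (-θ)) ^ j := by
      calc |t - s| ^ θ ≤ ((1 / 2 : ℝ) ^ j) ^ θ := Real.rpow_le_rpow (abs_nonneg _) hts hθ0
        _ = _ := by
          rw [one_div, ← Real.rpow_natCast, ← Real.rpow_natCast, ← Real.rpow_mul (by positivity),
            ← Real.rpow_mul (by positivity), Real.inv_rpow (by norm_num),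
            ← Real.rpow_neg (by norm_num)]
          congr 1; ring
    calc ‖w t (ξ, η) - w s (ξ, η)‖ ≤ (2 * Real.pi * ‖u‖ ^ ε * (1 + ‖ξ‖ + ‖η‖) ^ ε) *
          (M * |t - s| ^ θ * (1 + ‖ξ‖ + ‖η‖) ^ (θ - a)) := by
          simp only [hw]
          rw [← mul_sub, norm_mul]
          refine mul_le_mul (hchar ξ η) ((hL θ ⟨hθ0, hθ1⟩ ξ η s (hE hs) t (hE ht)).trans ?_)
            (norm_nonneg _) (by positivity)
          gcongr
          exact le_max_right _ _
      _ = K * |t - s| ^ θ * (1 + ‖ξ‖ + ‖η‖) ^ (-b) := by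
          rw [hKr, show -b = ε + (θ - a) by rw [hb]; ring, Real.rpow_add (by positivity)]; ring
      _ ≤ _ := by
          push_cast
          gcongr ?_ * ?_ * ?_
          exact hfinal ξ η
  have hwK : ∀ t ∈ E, ∀ ζ, ‖w t ζ‖ ≤ K := fun t ht ζ => (hw1 t ht ζ.1 ζ.2).trans <| by
    have : (1 + ‖ζ.1‖) ^ (-b) ≤ 1 :=
      Real.rpow_le_one_of_one_le_of_nonpos (by linarith [norm_nonneg ζ.1]) (by linarith)
    exact mul_le_of_le_one_right K.2 this
  set fu : 𝓢(Rd d, ℂ) := f - f.compSubConstCLM ℂ u with hfu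
  have hfu' : ∀ y, fu y = f y - f (y - u) := fun y => rfl
  have hF : ∀ t x, bilinearAverage μ t (fun y => f y - f (y - u)) g x =
      bilinearMultiplier (w t) f g x := by
    intro t x
    have := bilinearMultiplier_fourierMeasure μ t fu g x
    rw [show (fun y => f y - f (y - u)) = fu from rfl, ← this]
    simp only [bilinearMultiplier_eq]
    congr 1 with ζ
    rw [show (fu : Rd d → ℂ) = fun y => f y - f (y - u) from rfl, fourier_sub_translate, hw, dilate]
    ring
  obtain ⟨A, hA⟩ := schwartz_bounded fu
  obtain ⟨B, hB⟩ := schwartz_bounded g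
  have hcont := continuous_bilinearAverage μ fu.continuous g.continuous hA hB
  have hmain := hCc (ν := (volume : Measure (Rd d)))
    (F := fun t x => bilinearAverage μ t (fun y => f y - f (y - u)) g x) (E := E) (N := N)
    (A := Cb * K * eLpNorm f 2 volume * eLpNorm g 2 volume)
    (fun t => (hcont.comp (Continuous.prodMk_right t)).measurable)
    (fun x => hcont.comp (Continuous.prodMk_left x)) hNE hNc hN ?_ ?_
  · refine hmain.trans (le_of_eq ?_)
    rw [hK]
    simp only [ENNReal.coe_mul, ENNReal.ofReal]
    ring
  · intro t ht
    rw [← eLpNorm_two_eq]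
    have h := hCb K (w t) (hwc t) (hw1 t ht) f g
    rwa [show bilinearMultiplier (w t) f g = _ from (funext (hF t)).symm] at h
  · intro j t ht s hs hts
    rw [← eLpNorm_two_eq]
    have e : (fun x => bilinearAverage μ t (fun y => f y - f (y - u)) g x -
        bilinearAverage μ s (fun y => f y - f (y - u)) g x) =
        bilinearMultiplier (fun ζ => w t ζ - w s ζ) f g := funext fun x => by
      rw [hF, hF, bilinearMultiplier_sub (hwc t) (hwc s) (hwK t ht) (hwK s hs)]
    rw [e]
    refine (hCb _ _ ((hwc t).sub (hwc s)) (hw2 j t ht s hs hts) f g).trans (le_of_eq ?_)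
    push_cast
    ring

end

/-! ### From test functions to bounded functions of bounded support. -/

section

open SchwartzMap

/-- Bounded measurable functions with bounded support. -/
def IsBddCompact {d : ℕ} (f : Rd d → ℂ) : Prop :=
  Measurable f ∧ ∃ M : ℝ, (∀ x, ‖f x‖ ≤ M) ∧ ∀ x, M < ‖x‖ → f x = 0

/-- The `L^p` norm for a real exponent. -/
def lpn {d : ℕ} (p : ℝ) (f : Rd d → ℂ) : ℝ≥0∞ := (∫⁻ x, ‖f x‖ₑ ^ p) ^ (1 / p)

/-- The maximal function of the bilinear averages with parameters in `E`. -/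
def averageMax {d : ℕ} (μ : Measure (Rd d × Rd d)) (E : Set ℝ) (f g : Rd d → ℂ) (x : Rd d) :
    ℝ≥0∞ := ⨆ t ∈ E, ‖bilinearAverage μ t f g x‖ₑ

lemma eLpNorm_ofReal {d : ℕ} {ε : Type*} [TopologicalSpace ε] [ContinuousENorm ε] {p : ℝ}
    (hp : 0 < p) (f : Rd d → ε) :
    eLpNorm f (ENNReal.ofReal p) volume = (∫⁻ x, ‖f x‖ₑ ^ p) ^ (1 / p) := by
  rw [eLpNorm_eq_lintegral_rpow_enorm_toReal (by simpa using hp) (by simp),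
    ENNReal.toReal_ofReal hp.le]

lemma IsTestFunction.isBddCompact {d : ℕ} {f : Rd d → ℂ} (hf : IsTestFunction f) :
    IsBddCompact f := by
  obtain ⟨A, hA⟩ := hf.1.continuous.bounded_above_of_compact_support hf.2
  obtain ⟨B, hB⟩ := hf.2.isCompact.isBounded.exists_norm_le
  refine ⟨hf.1.continuous.measurable, max A B, fun x => (hA x).trans (le_max_left _ _),
    fun x hx => ?_⟩
  by_contra h
  exact absurd (hB x (subset_tsupport f h)) (not_le.2 ((le_max_right _ _).trans_lt hx))

/-- The inputs may depend on a parameter. This is needed for joint measurability in the translation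
and the position when translation differences are integrated. -/
lemma measurable_bilinearAverage {d : ℕ} {Y : Type*} [MeasurableSpace Y]
    (μ : Measure (Rd d × Rd d)) [IsFiniteMeasure μ]
    {F G : Y → Rd d → ℂ} (hF : Measurable fun p : Y × Rd d => F p.1 p.2)
    (hG : Measurable fun p : Y × Rd d => G p.1 p.2) (t : ℝ) {X : Y → Rd d} (hX : Measurable X) :
    Measurable fun y => bilinearAverage μ t (F y) (G y) (X y) := by
  unfold bilinearAverage
  refine StronglyMeasurable.measurable (StronglyMeasurable.integral_prod_right
    (f := fun (y : Y) (w : Rd d × Rd d) => F y (X y - t • w.1) * G y (X y - t • w.2)) ?_)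
  apply Measurable.stronglyMeasurable
  simp only [Function.uncurry_def]
  refine Measurable.mul ?_ ?_
  · exact hF.comp (measurable_fst.prodMk ((hX.comp measurable_fst).sub (by fun_prop)))
  · exact hG.comp (measurable_fst.prodMk ((hX.comp measurable_fst).sub (by fun_prop)))

lemma measurable_bilinearAverage' {d : ℕ} (μ : Measure (Rd d × Rd d)) [IsFiniteMeasure μ]
    {f g : Rd d → ℂ} (hf : Measurable f) (hg : Measurable g) (t : ℝ) :
    Measurable (bilinearAverage μ t f g) :=
  measurable_bilinearAverage μ (F := fun _ : Rd d => f) (G := fun _ => g) (X := id)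
    (hf.comp measurable_snd) (hg.comp measurable_snd) t measurable_id

/-- A supremum over uncountably many parameters of merely measurable averages need not be
measurable. Hence `E` is replaced by countable subsets from here on. -/
lemma measurable_averageMax {d : ℕ} (μ : Measure (Rd d × Rd d)) [IsFiniteMeasure μ]
    {E : Set ℝ} (hE : E.Countable) {f g : Rd d → ℂ} (hf : Measurable f) (hg : Measurable g) :
    Measurable (averageMax μ E f g) :=
  Measurable.biSup E hE fun t _ => (measurable_bilinearAverage' μ hf hg t).enorm

/-- Mollification of bounded measurable functions with bounded support. -/
lemma IsBddCompact.exists_approx {d : ℕ} {f : Rd d → ℂ} (hf : IsBddCompact f) :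
    ∃ (F : ℕ → Rd d → ℂ) (M : ℝ), (∀ n, IsTestFunction (F n)) ∧ (∀ n x, ‖F n x‖ ≤ M) ∧
      (∀ n x, M < ‖x‖ → F n x = 0) ∧ ∀ᵐ x, Tendsto (fun n => F n x) atTop (𝓝 (f x)) := by
  obtain ⟨hfm, M, hM, hM0⟩ := hf
  have hM00 : 0 ≤ M := (norm_nonneg _).trans (hM 0)
  let φ : ℕ → ContDiffBump (0 : Rd d) := fun n =>
    ⟨1 / ((n : ℝ) + 1), 2 / ((n : ℝ) + 1), by positivity, by gcongr; norm_num⟩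
  have hfi : LocallyIntegrable f := by
    refine (locallyIntegrable_const (M : ℝ)).mono hfm.aestronglyMeasurable
      (Eventually.of_forall fun x => ?_)
    rw [Real.norm_of_nonneg hM00]; exact hM x
  have hφ2 : ∀ n, (φ n).rOut ≤ 2 := fun n => by
    show 2 / ((n : ℝ) + 1) ≤ 2
    rw [div_le_iff₀ (by positivity)]
    have : (0 : ℝ) ≤ n := n.cast_nonneg
    linarith
  have hz : ∀ n x, M + 2 < ‖x‖ →
      convolution ((φ n).normed volume) f (ContinuousLinearMap.lsmul ℝ ℝ) volume x = 0 := by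
    intro n x hx
    rw [convolution_def]
    refine integral_eq_zero_of_ae (Eventually.of_forall fun t => ?_)
    by_cases ht : ‖t‖ ≤ 2
    · have : M < ‖x - t‖ := by
        have := norm_sub_norm_le x t
        linarith
      simp [hM0 _ this]
    · have : (φ n).normed volume t = 0 := by
        have : t ∉ Function.support ((φ n).normed volume) := by
          rw [(φ n).support_normed_eq, mem_ball_zero_iff]
          have := hφ2 n
          linarith
        simpa using this
      simp [this]
  refine ⟨fun n => convolution ((φ n).normed volume) f (ContinuousLinearMap.lsmul ℝ ℝ) volume,
    M + 2, fun n => ⟨?_, ?_⟩, fun n x => ?_, hz, ?_⟩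
  · exact (φ n).hasCompactSupport_normed.contDiff_convolution_left _
      (φ n).contDiff_normed hfi
  · exact HasCompactSupport.intro (isCompact_closedBall (0 : Rd d) (M + 2)) fun x hx =>
      hz n x (by simpa using hx)
  · beta_reduce
    rw [convolution_def]
    have hi : Integrable (fun t => (φ n).normed volume t * M) := (φ n).integrable_normed.mul_const M
    refine (norm_integral_le_of_norm_le hi (Eventually.of_forall fun t => ?_)).trans ?_
    · rw [ContinuousLinearMap.lsmul_apply, norm_smul, Real.norm_of_nonneg ((φ n).nonneg_normed t)]
      exact mul_le_mul_of_nonneg_left (hM _) ((φ n).nonneg_normed t)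
    · rw [integral_mul_const, (φ n).integral_normed]; linarith
  · refine ContDiffBump.ae_convolution_tendsto_right_of_locallyIntegrable (K := 2) ?_ ?_ hfi
    · show Tendsto (fun n : ℕ => 2 / ((n : ℝ) + 1)) atTop (𝓝 0)
      simpa [div_eq_mul_inv] using (tendsto_one_div_add_atTop_nhds_zero_nat (𝕜 := ℝ)).const_mul 2
    · refine Eventually.of_forall fun n => ?_
      show 2 / ((n : ℝ) + 1) ≤ 2 * (1 / ((n : ℝ) + 1))
      exact le_of_eq (by ring)

lemma tendsto_lpn {d : ℕ} {F : ℕ → Rd d → ℂ} {f : Rd d → ℂ} {M p : ℝ} (hp : 0 < p)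
    (hFm : ∀ n, Measurable (F n)) (hFM : ∀ n x, ‖F n x‖ ≤ M)
    (hF0 : ∀ n x, M < ‖x‖ → F n x = 0)
    (hlim : ∀ᵐ x, Tendsto (fun n => F n x) atTop (𝓝 (f x))) :
    Tendsto (fun n => lpn p (F n)) atTop (𝓝 (lpn p f)) := by
  unfold lpn
  have h : Tendsto (fun n => ∫⁻ x, ‖F n x‖ₑ ^ p) atTop (𝓝 (∫⁻ x, ‖f x‖ₑ ^ p)) := by
    refine tendsto_lintegral_of_dominated_convergence
      (bound := (Metric.closedBall (0 : Rd d) M).indicator fun _ => ENNReal.ofReal M ^ p)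
      (fun n => (hFm n).enorm.pow_const _) (fun n => Eventually.of_forall fun x => ?_) ?_ ?_
    · by_cases hx : x ∈ Metric.closedBall (0 : Rd d) M
      · simp only [Set.indicator_of_mem hx, ← ofReal_norm]
        exact ENNReal.rpow_le_rpow (ENNReal.ofReal_le_ofReal (hFM n x)) hp.le
      · simp [hF0 n x (by simpa using hx), hp]
    · rw [lintegral_indicator Metric.isClosed_closedBall.measurableSet, setLIntegral_const]
      exact ENNReal.mul_ne_top (ENNReal.rpow_ne_top_of_nonneg hp.le (by simp))
        (isCompact_closedBall (0 : Rd d) M).measure_lt_top.ne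
    · filter_upwards [hlim] with x hx
      exact ((ENNReal.continuous_rpow_const (y := p)).tendsto _).comp (hx.enorm)
  exact ((ENNReal.continuous_rpow_const (y := 1 / p)).tendsto _).comp h

/-- Since `μ` may be singular, almost everywhere statements cannot be evaluated along it at a fixed
`x`. For each fixed `w`, however, translation preserves null sets, and Fubini exchanges the
quantifiers for almost every `x`. Shrinking to a measurable set of full measure makes Fubini
applicable. -/
lemma ae_ae_sub_smul {d : ℕ} (μ : Measure (Rd d × Rd d)) [IsFiniteMeasure μ] {P : Rd d → Prop}
    (hP : ∀ᵐ x, P x) {φ : Rd d × Rd d → Rd d} (hφ : Measurable φ) :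
    ∀ᵐ x, ∀ᵐ w ∂μ, P (x - φ w) := by
  obtain ⟨S, hSP, hSm, hS⟩ : ∃ S : Set (Rd d), S ⊆ {x | P x} ∧ MeasurableSet S ∧
      ∀ᵐ x, x ∈ S := by
    refine ⟨(toMeasurable volume {x | ¬P x})ᶜ, ?_, (measurableSet_toMeasurable _ _).compl, ?_⟩
    · intro x hx
      by_contra h
      exact hx (subset_toMeasurable _ _ h)
    · rw [ae_iff]
      simp only [Set.mem_compl_iff, not_not]
      exact (measure_toMeasurable _).trans hP
  have h1 : ∀ᵐ w ∂μ, ∀ᵐ x : Rd d, x - φ w ∈ S := Eventually.of_forall fun w =>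
    (measurePreserving_sub_right volume (φ w)).quasiMeasurePreserving.ae hS
  have hm : MeasurableSet {q : Rd d × (Rd d × Rd d) | q.1 - φ q.2 ∈ S} :=
    (measurable_fst.sub (hφ.comp measurable_snd)) hSm
  have h2 := (Measure.ae_ae_comm (μ := (volume : Measure (Rd d))) (ν := μ) hm).2 h1
  filter_upwards [h2] with x hx
  filter_upwards [hx] with w hw using hSP hw

/-- Fatou's lemma for maximal bilinear averages. -/
lemma lintegral_averageMax_le_liminf {d : ℕ} (μ : Measure (Rd d × Rd d)) [IsFiniteMeasure μ]
    {E : Set ℝ} (hE : E.Countable) {F G : ℕ → Rd d → ℂ} {f g : Rd d → ℂ} {M r : ℝ} (hr : 0 < r)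
    (hFm : ∀ n, Measurable (F n)) (hGm : ∀ n, Measurable (G n))
    (hFM : ∀ n x, ‖F n x‖ ≤ M) (hGM : ∀ n x, ‖G n x‖ ≤ M)
    (hf : ∀ᵐ x, Tendsto (fun n => F n x) atTop (𝓝 (f x)))
    (hg : ∀ᵐ x, Tendsto (fun n => G n x) atTop (𝓝 (g x))) {A : ℕ → ℝ≥0∞} {B : ℝ≥0∞}
    (hA : ∀ n, (∫⁻ x, averageMax μ E (F n) (G n) x ^ r) ^ (1 / r) ≤ A n)
    (hAB : Tendsto A atTop (𝓝 B)) :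
    (∫⁻ x, averageMax μ E f g x ^ r) ^ (1 / r) ≤ B := by
  have hM0 : 0 ≤ M := (norm_nonneg _).trans (hFM 0 0)
  have hconv : ∀ᵐ x, ∀ t ∈ E, Tendsto (fun n => bilinearAverage μ t (F n) (G n) x) atTop
      (𝓝 (bilinearAverage μ t f g x)) := by
    rw [ae_ball_iff hE]
    intro t _
    filter_upwards [ae_ae_sub_smul μ hf (φ := fun w => t • w.1) (by fun_prop),
      ae_ae_sub_smul μ hg (φ := fun w => t • w.2) (by fun_prop)] with x hx1 hx2
    refine tendsto_integral_of_dominated_convergence (fun _ => M * M) (fun n => ?_)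
      (integrable_const _) (fun n => Eventually.of_forall fun w => ?_) ?_
    · apply Measurable.aestronglyMeasurable
      exact ((hFm n).comp (by fun_prop)).mul ((hGm n).comp (by fun_prop))
    · rw [norm_mul]
      exact mul_le_mul (hFM n _) (hGM n _) (norm_nonneg _) hM0
    · filter_upwards [hx1, hx2] with w h1 h2 using h1.mul h2
  have hle : ∀ᵐ x, averageMax μ E f g x ^ r ≤
      liminf (fun n => averageMax μ E (F n) (G n) x ^ r) atTop := by
    filter_upwards [hconv] with x hx
    have h1 : averageMax μ E f g x ≤ liminf (fun n => averageMax μ E (F n) (G n) x) atTop := by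
      refine iSup₂_le fun t ht => ?_
      rw [← ((hx t ht).enorm).liminf_eq]
      refine liminf_le_liminf (Eventually.of_forall fun n => ?_)
      exact le_iSup₂ (f := fun t (_ : t ∈ E) => ‖bilinearAverage μ t (F n) (G n) x‖ₑ) t ht
    refine (ENNReal.rpow_le_rpow h1 hr.le).trans (le_of_eq ?_)
    exact (ENNReal.orderIsoRpow r hr).liminf_apply
  have h2 : ∫⁻ x, averageMax μ E f g x ^ r ≤ B ^ r := by
    calc _ ≤ ∫⁻ x, liminf (fun n => averageMax μ E (F n) (G n) x ^ r) atTop :=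
          lintegral_mono_ae hle
      _ ≤ liminf (fun n => ∫⁻ x, averageMax μ E (F n) (G n) x ^ r) atTop :=
          lintegral_liminf_le fun n => (measurable_averageMax μ hE (hFm n) (hGm n)).pow_const _
      _ ≤ liminf (fun n => A n ^ r) atTop := by
          refine liminf_le_liminf (Eventually.of_forall fun n => ?_)
          have := ENNReal.rpow_le_rpow (hA n) hr.le
          rwa [← ENNReal.rpow_mul, one_div_mul_cancel hr.ne', ENNReal.rpow_one] at this
      _ = B ^ r := (((ENNReal.continuous_rpow_const (y := r)).tendsto _).comp hAB).liminf_eq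
  calc _ ≤ (B ^ r) ^ (1 / r) := ENNReal.rpow_le_rpow h2 (by positivity)
    _ = B := by rw [← ENNReal.rpow_mul, mul_one_div_cancel hr.ne', ENNReal.rpow_one]

lemma lpn_lt_top {d : ℕ} {f : Rd d → ℂ} (hf : IsBddCompact f) {p : ℝ} (hp : 0 < p) :
    lpn p f < ∞ := by
  obtain ⟨hfm, M, hM, hM0⟩ := hf
  unfold lpn
  refine ENNReal.rpow_lt_top_of_nonneg (by positivity) (ne_of_lt ?_)
  calc ∫⁻ x, ‖f x‖ₑ ^ p
      ≤ ∫⁻ x, (Metric.closedBall (0 : Rd d) M).indicator (fun _ => ENNReal.ofReal M ^ p) x := by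
        refine lintegral_mono fun x => ?_
        by_cases hx : x ∈ Metric.closedBall (0 : Rd d) M
        · simp only [Set.indicator_of_mem hx, ← ofReal_norm]
          exact ENNReal.rpow_le_rpow (ENNReal.ofReal_le_ofReal (hM x)) hp.le
        · rw [hM0 x (by simpa using hx)]
          simp [hp]
    _ < ∞ := by
        rw [lintegral_indicator Metric.isClosed_closedBall.measurableSet, setLIntegral_const]
        exact ENNReal.mul_lt_top (ENNReal.rpow_lt_top_of_nonneg hp.le (by simp))
          (isCompact_closedBall (0 : Rd d) M).measure_lt_top

/-- An `L^p × L^q → L^r` bound on test functions extends to bounded functions. -/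
theorem averageMax_bound_extend {d : ℕ} (μ : Measure (Rd d × Rd d)) [IsFiniteMeasure μ]
    {E : Set ℝ} (hE : E.Countable) {p q r : ℝ} (hp : 0 < p) (hq : 0 < q) (hr : 0 < r)
    {C : ℝ≥0∞} (hC : C ≠ ∞) {V : (Rd d → ℂ) → Rd d → ℂ}
    (hVm : ∀ f, Measurable f → Measurable (V f))
    (hVb : ∀ f M, (∀ x, ‖f x‖ ≤ M) → ∀ x, ‖V f x‖ ≤ 2 * M)
    (hVl : ∀ (F : ℕ → Rd d → ℂ) f, (∀ᵐ x, Tendsto (fun n => F n x) atTop (𝓝 (f x))) →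
      ∀ᵐ x, Tendsto (fun n => V (F n) x) atTop (𝓝 (V f x)))
    (h : ∀ f g, IsTestFunction f → IsTestFunction g →
      (∫⁻ x, averageMax μ E (V f) g x ^ r) ^ (1 / r) ≤ C * lpn p f * lpn q g)
    {f g : Rd d → ℂ} (hf : IsBddCompact f) (hg : IsBddCompact g) :
    (∫⁻ x, averageMax μ E (V f) g x ^ r) ^ (1 / r) ≤ C * lpn p f * lpn q g := by
  -- The inputs are approximated before `V` is applied, because the right-hand side involves the
  -- norms of `f` and not of `V f`. `V` will be the identity or a translation difference.
  obtain ⟨F, M, hF, hFM, hF0, hFl⟩ := hf.exists_approx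
  obtain ⟨G, M', hG, hGM, hG0, hGl⟩ := hg.exists_approx
  have hFm : ∀ n, Measurable (F n) := fun n => (hF n).1.continuous.measurable
  have hGm : ∀ n, Measurable (G n) := fun n => (hG n).1.continuous.measurable
  refine lintegral_averageMax_le_liminf μ hE hr (M := max (2 * M) M')
    (F := fun n => V (F n)) (G := G) (A := fun n => C * lpn p (F n) * lpn q (G n))
    (fun n => hVm _ (hFm n)) hGm
    (fun n x => (hVb _ _ (hFM n) x).trans (le_max_left _ _))
    (fun n x => (hGM n x).trans (le_max_right _ _)) (hVl _ _ hFl) hGl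
    (fun n => h _ _ (hF n) (hG n)) ?_
  have h1 := tendsto_lpn hp hFm hFM hF0 hFl
  have h2 := tendsto_lpn hq hGm hGM hG0 hGl
  refine ENNReal.Tendsto.mul (ENNReal.Tendsto.const_mul h1 (Or.inr hC))
    (Or.inr (lpn_lt_top hg hq).ne) h2
    (Or.inr (ENNReal.mul_ne_top hC (lpn_lt_top hf hp).ne))

lemma averageMax_eq_singleScaleMaximal {d : ℕ} (μ : Measure (Rd d × Rd d)) [IsFiniteMeasure μ]
    (E : Set ℝ) {f g : Rd d → ℂ} (hf : IsTestFunction f) (hg : IsTestFunction g) (x : Rd d) :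
    averageMax μ E f g x = singleScaleMaximal (fourierMeasure μ) E f g x := by
  have h := fun t => bilinearMultiplier_fourierMeasure μ t (hf.2.toSchwartzMap hf.1)
    (hg.2.toSchwartzMap hg.1) x
  have e1 : (hf.2.toSchwartzMap hf.1 : Rd d → ℂ) = f := rfl
  have e2 : (hg.2.toSchwartzMap hg.1 : Rd d → ℂ) = g := rfl
  rw [e1, e2] at h
  simp only [averageMax, singleScaleMaximal, h]

lemma averageMax_mono {d : ℕ} (μ : Measure (Rd d × Rd d)) {E E' : Set ℝ} (h : E' ⊆ E)
    (f g : Rd d → ℂ) (x : Rd d) : averageMax μ E' f g x ≤ averageMax μ E f g x :=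
  biSup_mono h

/-- The truncations and localizations to come destroy smoothness, so the bound is needed for bounded
measurable inputs, and measurability requires the countable `E'`. -/
theorem improvingRegion_bound {d : ℕ} {μ : Measure (Rd d × Rd d)} [IsFiniteMeasure μ]
    {E E' : Set ℝ} (hE' : E' ⊆ E) (hE'c : E'.Countable) {p q r : ℝ} (hp : 0 < p) (hq : 0 < q)
    (hr : 0 < r) (h : (1 / p, 1 / q, 1 / r) ∈ improvingRegion μ E) :
    ∃ C : ℝ≥0, ∀ f g, IsBddCompact f → IsBddCompact g →
      (∫⁻ x, averageMax μ E' f g x ^ r) ^ (1 / r) ≤ C * lpn p f * lpn q g := by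
  obtain ⟨P, Q, R, hP, hQ, hR, -, ⟨C, hC⟩, hu⟩ := h
  simp only [Prod.mk.injEq] at hu
  -- The region records exponents through `toReal` of the reciprocal, which is 0 both at `S = 0` and
  -- at `S = ∞`. A positive value excludes both and determines `S`.
  have key : ∀ {s : ℝ} {S : ℝ≥0∞}, 0 < s → 1 / s = S⁻¹.toReal → S = ENNReal.ofReal s := by
    intro s S hs h
    have h1 : 0 < S⁻¹.toReal := by rw [← h]; positivity
    have h2 := (ENNReal.toReal_pos_iff.1 h1)
    have h3 : S⁻¹ = ENNReal.ofReal (1 / s) := by rw [h, ENNReal.ofReal_toReal h2.2.ne]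
    rw [← inv_inv S, h3, one_div, ENNReal.ofReal_inv_of_pos hs, inv_inv]
  rw [key hp hu.1, key hq hu.2.1, key hr hu.2.2] at hC
  refine ⟨C, fun f g hf hg => ?_⟩
  refine averageMax_bound_extend μ hE'c hp hq hr (C := C) (by simp) (V := id) (fun f hf => hf)
    (fun f M hM x => (hM x).trans ?_) (fun F f h => h) (fun f g hf hg => ?_) hf hg
  · have := (norm_nonneg _).trans (hM 0); linarith
  · have := hC f g hf hg
    rw [eLpNorm_ofReal hr, eLpNorm_ofReal hp, eLpNorm_ofReal hq] at this
    refine le_trans (ENNReal.rpow_le_rpow (lintegral_mono fun x => ?_) (by positivity)) this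
    refine ENNReal.rpow_le_rpow ((averageMax_mono μ hE' _ _ x).trans_eq ?_) hr.le
    rw [enorm_eq_self]
    exact averageMax_eq_singleScaleMaximal μ E hf hg x

/-- The continuity estimate of `l2_translation_estimate` for bounded functions. -/
theorem l2_translation_bound {d : ℕ} {E E' : Set ℝ} (hE : E ⊆ Set.Icc 1 2) (hE' : E' ⊆ E)
    (hE'c : E'.Countable) {β : ℝ}
    (hβ : upperMinkowskiDim E = (β : EReal)) {μ : Measure (Rd d × Rd d)} [IsFiniteMeasure μ]
    (hμ : IsCompactlySupported μ) {a : ℝ} (ha : IsAdmissible μ a) (haβ : (d : ℝ) + β < 2 * a) :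
    ∃ ε : ℝ, 0 < ε ∧ ∃ C : ℝ≥0, ∀ (u : Rd d) (f g : Rd d → ℂ), IsBddCompact f → IsBddCompact g →
      (∫⁻ x, averageMax μ E' (fun y => f y - f (y - u)) g x ^ (2 : ℝ)) ^ (1 / (2 : ℝ)) ≤
        C * ENNReal.ofReal (‖u‖ ^ ε) * lpn 2 f * lpn 2 g := by
  obtain ⟨ε, hε, C, hC⟩ := l2_translation_estimate hE hβ hμ ha haβ
  refine ⟨ε, hε, C, fun u f g hf hg => ?_⟩
  refine averageMax_bound_extend μ hE'c two_pos two_pos two_pos (ENNReal.mul_ne_top (by simp)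
    (by simp)) (V := fun f y => f y - f (y - u)) (fun f hf => hf.sub (hf.comp (by fun_prop)))
    (fun f M hM x => ?_) (fun F f h => ?_) (fun f g hf hg => ?_) hf hg
  · refine (norm_sub_le _ _).trans ?_
    have := hM x; have := hM (x - u); linarith
  · have h' := (measurePreserving_sub_right (volume : Measure (Rd d)) u).quasiMeasurePreserving.ae h
    filter_upwards [h, h'] with x h1 h2 using h1.sub h2
  · have := hC u (hf.2.toSchwartzMap hf.1) (hg.2.toSchwartzMap hg.1)
    rw [eLpNorm_two_eq, eLpNorm_two_eq] at this
    refine le_trans (ENNReal.rpow_le_rpow (lintegral_mono fun x => ?_) (by positivity)) this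
    exact ENNReal.rpow_le_rpow (averageMax_mono μ hE' _ _ x) (by norm_num)

end

/-! ### The trilinear form and interpolation by truncation. -/

lemma IsBddCompact.indicator {d : ℕ} {f : Rd d → ℂ} (hf : IsBddCompact f) {S : Set (Rd d)}
    (hS : MeasurableSet S) : IsBddCompact (S.indicator f) := by
  obtain ⟨hfm, M, hM, hM0⟩ := hf
  refine ⟨hfm.indicator hS, M, fun x => ?_, fun x hx => ?_⟩
  · exact (norm_indicator_le_norm_self f x).trans (hM x)
  · simp [hM0 x hx]

lemma IsBddCompact.sub {d : ℕ} {f g : Rd d → ℂ} (hf : IsBddCompact f) (hg : IsBddCompact g) :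
    IsBddCompact (fun x => f x - g x) := by
  obtain ⟨hfm, M, hM, hM0⟩ := hf
  obtain ⟨hgm, M', hM', hM0'⟩ := hg
  have h1 := (norm_nonneg _).trans (hM 0)
  have h2 := (norm_nonneg _).trans (hM' 0)
  refine ⟨hfm.sub hgm, M + M', fun x => (norm_sub_le _ _).trans (add_le_add (hM x) (hM' x)),
    fun x hx => ?_⟩
  simp [hM0 x (by linarith), hM0' x (by linarith)]

lemma IsBddCompact.add {d : ℕ} {f g : Rd d → ℂ} (hf : IsBddCompact f) (hg : IsBddCompact g) :
    IsBddCompact (fun x => f x + g x) := by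
  obtain ⟨hfm, M, hM, hM0⟩ := hf
  obtain ⟨hgm, M', hM', hM0'⟩ := hg
  have h1 := (norm_nonneg _).trans (hM 0)
  have h2 := (norm_nonneg _).trans (hM' 0)
  refine ⟨hfm.add hgm, M + M', fun x => (norm_add_le _ _).trans (add_le_add (hM x) (hM' x)),
    fun x hx => ?_⟩
  simp [hM0 x (by linarith), hM0' x (by linarith)]

lemma IsBddCompact.translate {d : ℕ} {f : Rd d → ℂ} (hf : IsBddCompact f) (u : Rd d) :
    IsBddCompact (fun x => f (x - u)) := by
  obtain ⟨hfm, M, hM, hM0⟩ := hf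
  refine ⟨hfm.comp (by fun_prop), M + ‖u‖, fun x => ?_, fun x hx => hM0 _ ?_⟩
  · have := hM (x - u); linarith [norm_nonneg u]
  · have := norm_sub_norm_le x u; linarith

lemma integrable_bilinear_of_bound {d : ℕ} (μ : Measure (Rd d × Rd d)) [IsFiniteMeasure μ]
    {f g : Rd d → ℂ} (hf : IsBddCompact f) (hg : IsBddCompact g) (t : ℝ) (x : Rd d) :
    Integrable (fun w : Rd d × Rd d => f (x - t • w.1) * g (x - t • w.2)) μ := by
  obtain ⟨hfm, M, hM, -⟩ := hf
  obtain ⟨hgm, M', hM', -⟩ := hg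
  refine Integrable.of_bound (C := M * M') ?_ (Eventually.of_forall fun w => ?_)
  · exact ((hfm.comp (by fun_prop)).mul (hgm.comp (by fun_prop))).aestronglyMeasurable
  · rw [norm_mul]
    exact mul_le_mul (hM _) (hM' _) (norm_nonneg _) ((norm_nonneg _).trans (hM 0))

lemma bilinearAverage_add_left {d : ℕ} (μ : Measure (Rd d × Rd d)) [IsFiniteMeasure μ]
    {f f' g : Rd d → ℂ} (hf : IsBddCompact f) (hf' : IsBddCompact f') (hg : IsBddCompact g)
    (t : ℝ) (x : Rd d) :
    bilinearAverage μ t (fun y => f y + f' y) g x =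
      bilinearAverage μ t f g x + bilinearAverage μ t f' g x := by
  unfold bilinearAverage
  rw [← integral_add (integrable_bilinear_of_bound μ hf hg t x)
    (integrable_bilinear_of_bound μ hf' hg t x)]
  congr 1 with w
  ring

lemma bilinearAverage_add_right {d : ℕ} (μ : Measure (Rd d × Rd d)) [IsFiniteMeasure μ]
    {f g g' : Rd d → ℂ} (hf : IsBddCompact f) (hg : IsBddCompact g) (hg' : IsBddCompact g')
    (t : ℝ) (x : Rd d) :
    bilinearAverage μ t f (fun y => g y + g' y) x =
      bilinearAverage μ t f g x + bilinearAverage μ t f g' x := by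
  unfold bilinearAverage
  rw [← integral_add (integrable_bilinear_of_bound μ hf hg t x)
    (integrable_bilinear_of_bound μ hf hg' t x)]
  congr 1 with w
  ring

lemma averageMax_add_left_le {d : ℕ} (μ : Measure (Rd d × Rd d)) [IsFiniteMeasure μ] (E : Set ℝ)
    {f f' g : Rd d → ℂ} (hf : IsBddCompact f) (hf' : IsBddCompact f') (hg : IsBddCompact g)
    (x : Rd d) :
    averageMax μ E (fun y => f y + f' y) g x ≤ averageMax μ E f g x + averageMax μ E f' g x := by
  refine iSup₂_le fun t ht => ?_
  rw [bilinearAverage_add_left μ hf hf' hg]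
  refine (enorm_add_le _ _).trans (add_le_add ?_ ?_)
  · exact le_iSup₂ (f := fun t (_ : t ∈ E) => ‖bilinearAverage μ t f g x‖ₑ) t ht
  · exact le_iSup₂ (f := fun t (_ : t ∈ E) => ‖bilinearAverage μ t f' g x‖ₑ) t ht

lemma averageMax_add_right_le {d : ℕ} (μ : Measure (Rd d × Rd d)) [IsFiniteMeasure μ] (E : Set ℝ)
    {f g g' : Rd d → ℂ} (hf : IsBddCompact f) (hg : IsBddCompact g) (hg' : IsBddCompact g')
    (x : Rd d) :
    averageMax μ E f (fun y => g y + g' y) x ≤ averageMax μ E f g x + averageMax μ E f g' x := by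
  refine iSup₂_le fun t ht => ?_
  rw [bilinearAverage_add_right μ hf hg hg']
  refine (enorm_add_le _ _).trans (add_le_add ?_ ?_)
  · exact le_iSup₂ (f := fun t (_ : t ∈ E) => ‖bilinearAverage μ t f g x‖ₑ) t ht
  · exact le_iSup₂ (f := fun t (_ : t ∈ E) => ‖bilinearAverage μ t f g' x‖ₑ) t ht

lemma lpn_rpow {d : ℕ} {p : ℝ} (hp : 0 < p) (f : Rd d → ℂ) :
    lpn p f ^ p = ∫⁻ x, ‖f x‖ₑ ^ p := by
  rw [lpn, ← ENNReal.rpow_mul, one_div_mul_cancel hp.ne', ENNReal.rpow_one]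

lemma lpn_sub_le {d : ℕ} {p : ℝ} (hp : 1 ≤ p) {f g : Rd d → ℂ} (hf : Measurable f)
    (hg : Measurable g) : lpn p (fun x => f x - g x) ≤ lpn p f + lpn p g := by
  unfold lpn
  refine le_trans (ENNReal.rpow_le_rpow (lintegral_mono fun x => ?_) (by positivity))
    (ENNReal.lintegral_Lp_add_le (f := fun x => ‖f x‖ₑ) (g := fun x => ‖g x‖ₑ)
      hf.enorm.aemeasurable hg.enorm.aemeasurable hp)
  exact ENNReal.rpow_le_rpow (enorm_sub_le) (by linarith)

lemma lpn_translate {d : ℕ} (p : ℝ) (f : Rd d → ℂ) (u : Rd d) :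
    lpn p (fun x => f (x - u)) = lpn p f := by
  unfold lpn
  congr 1
  exact lintegral_sub_right_eq_self (fun x => ‖f x‖ₑ ^ p) u

lemma lpn_mono {d : ℕ} {p : ℝ} (hp : 0 ≤ p) {f g : Rd d → ℂ} (h : ∀ x, ‖f x‖ₑ ≤ ‖g x‖ₑ) :
    lpn p f ≤ lpn p g :=
  ENNReal.rpow_le_rpow (lintegral_mono fun x => ENNReal.rpow_le_rpow (h x) hp) (by positivity)

/-- The weights `A` and `B` stay on opposite sides so that the pointwise comparison can be
integrated before the common factor `A` is cancelled, which avoids divisions of extended reals. -/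
lemma lpn_le_of_pointwise {d : ℕ} {A B D : ℝ≥0∞} {e e' : ℝ} {f F : Rd d → ℂ}
    (hA : A ≠ ∞) (hB : B ≠ ∞) (hA0 : A ≠ 0) (he : 0 < e) (he' : 0 < e')
    (h : ∀ x, ‖F x‖ₑ ^ e' * A ≤ ‖f x‖ₑ ^ e * B)
    (hD : lpn e f ^ e * B ≤ (D * lpn e f) ^ e' * A) : lpn e' F ≤ D * lpn e f := by
  have h1 : lpn e' F ^ e' * A ≤ lpn e f ^ e * B := by
    rw [lpn_rpow he', lpn_rpow he, ← lintegral_mul_const' _ _ hA, ← lintegral_mul_const' _ _ hB]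
    exact lintegral_mono h
  have h2 := (ENNReal.mul_le_mul_iff_left hA0 hA).1 (h1.trans hD)
  exact (ENNReal.rpow_le_rpow_iff he').1 h2

/-- Truncation of a function into its large, small and intermediate values. -/
lemma exists_truncation {d : ℕ} {f : Rd d → ℂ} (hf : IsBddCompact f) {p p₁ p₂ c K : ℝ}
    (hp₁ : 0 < p₁) (h₁ : p₁ < p) (h₂ : p < p₂) (hc₁ : c ≤ p / p₁ - 1) (hc₂ : c ≤ 1 - p / p₂)
    (hK : |p - 2| / 2 ≤ K) {l : ℝ≥0∞} (hl : 1 ≤ l) (hl' : l ≠ ∞) :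
    ∃ fL fS fM : Rd d → ℂ, IsBddCompact fL ∧ IsBddCompact fS ∧ IsBddCompact fM ∧
      f = (fun x => fL x + (fS x + fM x)) ∧ lpn p₁ fL ≤ l ^ (-c) * lpn p f ∧
      lpn p₂ fS ≤ l ^ (-c) * lpn p f ∧ lpn 2 fM ≤ l ^ K * lpn p f ∧ lpn p fM ≤ lpn p f := by
  have hp : 0 < p := hp₁.trans h₁
  have hp₂ : 0 < p₂ := hp.trans h₂
  set N := lpn p f with hN
  have hNt : N ≠ ∞ := (lpn_lt_top hf hp).ne
  have hl0 : l ≠ 0 := (zero_lt_one.trans_le hl).ne'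
  have hmono : ∀ {a b : ℝ}, a ≤ b → l ^ a ≤ l ^ b := fun h => ENNReal.rpow_le_rpow_of_exponent_le hl h
  -- If the norm vanishes the thresholds degenerate. In that case `f` is zero almost everywhere and
  -- is put entirely into the first piece.
  rcases eq_or_ne N 0 with hN0 | hN0
  · have hz : lpn p₁ f = 0 := by
      have h1 : ∫⁻ x, ‖f x‖ₑ ^ p = 0 := by
        rw [← lpn_rpow hp, ← hN, hN0, ENNReal.zero_rpow_of_pos hp]
      rw [lintegral_eq_zero_iff (hf.1.enorm.pow_const _)] at h1
      rw [lpn, lintegral_eq_zero_iff (hf.1.enorm.pow_const _) |>.2,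
        ENNReal.zero_rpow_of_pos (by positivity)]
      filter_upwards [h1] with x hx
      simp only [Pi.zero_apply, ENNReal.rpow_eq_zero_iff_of_pos hp] at hx
      simp [hx, hp₁]
    have h0 : IsBddCompact (fun _ : Rd d => (0 : ℂ)) := ⟨measurable_const, 0, by simp, by simp⟩
    have hl0 : ∀ e : ℝ, 0 < e → lpn e (fun _ : Rd d => (0 : ℂ)) = 0 := fun e he => by
      simp [lpn, he]
    refine ⟨f, fun _ => 0, fun _ => 0, hf, h0, h0, by simp, by simp [hz], ?_, ?_, ?_⟩
    · simp [hl0 p₂ hp₂]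
    · simp [hl0 2 two_pos]
    · simp [hl0 p hp]
  -- The thresholds are `lN` and `N/l`. Above the first, `|f|^p₁ ≤ |f|^p (lN)^(p₁-p)` gains
  -- `l^(-(p/p₁-1))` in norm. Below the second, `p₂` gains `l^(-(1-p/p₂))`. Between them, passing to
  -- `L²` costs `l^(|p-2|/2)`.
  set SL : Set (Rd d) := {x | l * N < ‖f x‖ₑ} with hSL
  set SS : Set (Rd d) := {x | l * ‖f x‖ₑ ≤ N} with hSS
  have hSLm : MeasurableSet SL := measurableSet_lt measurable_const hf.1.enorm
  have hSSm : MeasurableSet SS := measurableSet_le (hf.1.enorm.const_mul _) measurable_const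
  have hdisj : ∀ x ∈ SL, x ∉ SS := fun x h1 h2 => by
    have h3 : ‖f x‖ₑ ≤ l * ‖f x‖ₑ := le_mul_of_one_le_left' hl
    have h4 : N ≤ l * N := le_mul_of_one_le_left' hl
    exact absurd (h3.trans (h2.trans h4)) (not_le.2 h1)
  refine ⟨SL.indicator f, SS.indicator f, (SL ∪ SS)ᶜ.indicator f, hf.indicator hSLm,
    hf.indicator hSSm, hf.indicator (hSLm.union hSSm).compl, ?_, ?_, ?_, ?_, ?_⟩
  · ext x
    by_cases h1 : x ∈ SL
    · simp [h1, hdisj x h1]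
    · by_cases h2 : x ∈ SS <;> simp [h1, h2]
  · refine lpn_le_of_pointwise (A := (l * N) ^ (p - p₁)) (B := 1)
      (ENNReal.rpow_ne_top_of_nonneg (by linarith) (ENNReal.mul_ne_top hl' hNt)) (by simp)
      ?_ hp hp₁ (fun x => ?_) ?_
    · simp [ENNReal.rpow_eq_zero_iff, hl0, hN0, ENNReal.mul_eq_top, hl', hNt]
    · by_cases hx : x ∈ SL
      · rw [Set.indicator_of_mem hx, mul_one]
        calc ‖f x‖ₑ ^ p₁ * (l * N) ^ (p - p₁) ≤ ‖f x‖ₑ ^ p₁ * ‖f x‖ₑ ^ (p - p₁) := by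
              exact mul_le_mul_right (ENNReal.rpow_le_rpow hx.le (by linarith)) _
          _ = ‖f x‖ₑ ^ p := by
              rw [← ENNReal.rpow_add_of_nonneg _ _ hp₁.le (by linarith)]; congr 1; ring
      · simp [hx, hp₁]
    · rw [mul_one, ENNReal.mul_rpow_of_nonneg _ _ hp₁.le,
        ENNReal.mul_rpow_of_nonneg _ _ (by linarith : 0 ≤ p - p₁), ← ENNReal.rpow_mul]
      calc N ^ p = N ^ p₁ * N ^ (p - p₁) := by
            rw [← ENNReal.rpow_add_of_nonneg _ _ hp₁.le (by linarith)]; congr 1; ring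
        _ ≤ (l ^ (-c * p₁) * l ^ (p - p₁)) * (N ^ p₁ * N ^ (p - p₁)) := by
            refine le_mul_of_one_le_left' ?_
            rw [← ENNReal.rpow_add _ _ hl0 hl', ← ENNReal.rpow_zero (x := l)]
            refine hmono ?_
            have : c * p₁ ≤ (p / p₁ - 1) * p₁ := by gcongr
            have e : (p / p₁ - 1) * p₁ = p - p₁ := by field_simp
            linarith
        _ = _ := by ring
  · refine lpn_le_of_pointwise (A := l ^ (p₂ - p)) (B := N ^ (p₂ - p))
      (ENNReal.rpow_ne_top_of_nonneg (by linarith) hl')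
      (ENNReal.rpow_ne_top_of_nonneg (by linarith) hNt)
      ?_ hp hp₂ (fun x => ?_) ?_
    · simp [ENNReal.rpow_eq_zero_iff, hl0, hl']
    · by_cases hx : x ∈ SS
      · rw [Set.indicator_of_mem hx]
        calc ‖f x‖ₑ ^ p₂ * l ^ (p₂ - p) = ‖f x‖ₑ ^ p * (l * ‖f x‖ₑ) ^ (p₂ - p) := by
              rw [ENNReal.mul_rpow_of_nonneg _ _ (by linarith : 0 ≤ p₂ - p)]
              conv_lhs => rw [show p₂ = p + (p₂ - p) by ring,
                ENNReal.rpow_add_of_nonneg _ _ hp.le (by linarith : 0 ≤ p₂ - p)]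
              ring_nf
          _ ≤ _ := by
              exact mul_le_mul_right (ENNReal.rpow_le_rpow hx (by linarith)) _
      · simp [hx, hp₂]
    · rw [ENNReal.mul_rpow_of_nonneg _ _ hp₂.le, ← ENNReal.rpow_mul,
        ← ENNReal.rpow_add_of_nonneg _ _ hp.le (by linarith : 0 ≤ p₂ - p),
        show p + (p₂ - p) = p₂ by ring]
      calc N ^ p₂ ≤ (l ^ (-c * p₂) * l ^ (p₂ - p)) * N ^ p₂ := by
            refine le_mul_of_one_le_left' ?_
            rw [← ENNReal.rpow_add _ _ hl0 hl', ← ENNReal.rpow_zero (x := l)]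
            refine hmono ?_
            have : c * p₂ ≤ (1 - p / p₂) * p₂ := by gcongr
            have e : (1 - p / p₂) * p₂ = p₂ - p := by field_simp
            linarith
        _ = _ := by ring
  · have hlK : l ^ (|p - 2| / 2) ≤ l ^ K := hmono hK
    refine le_trans ?_ (mul_le_mul_left hlK N)
    rcases le_total p 2 with h | h
    · rw [abs_of_nonpos (by linarith)]
      refine lpn_le_of_pointwise (A := 1) (B := (l * N) ^ (2 - p))
        (by simp) (ENNReal.rpow_ne_top_of_nonneg (by linarith) (ENNReal.mul_ne_top hl' hNt))
        (by simp) hp two_pos (fun x => ?_) ?_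
      · by_cases hx : x ∈ (SL ∪ SS)ᶜ
        · rw [Set.indicator_of_mem hx, mul_one]
          have hx1 : ‖f x‖ₑ ≤ l * N := not_lt.1 fun h => hx (Or.inl h)
          calc ‖f x‖ₑ ^ (2 : ℝ) = ‖f x‖ₑ ^ p * ‖f x‖ₑ ^ (2 - p) := by
                rw [← ENNReal.rpow_add_of_nonneg _ _ hp.le (by linarith)]; congr 1; ring
            _ ≤ _ := by gcongr
        · rw [Set.indicator_of_notMem hx]; simp
      · rw [mul_one, ENNReal.mul_rpow_of_nonneg _ _ (by linarith : 0 ≤ 2 - p),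
          ENNReal.mul_rpow_of_nonneg _ _ (by norm_num : (0 : ℝ) ≤ 2), ← ENNReal.rpow_mul,
          mul_left_comm, ← ENNReal.rpow_add_of_nonneg _ _ hp.le (by linarith)]
        refine le_of_eq ?_
        congr 2 <;> ring
    · rw [abs_of_nonneg (by linarith)]
      refine lpn_le_of_pointwise (A := N ^ (p - 2)) (B := l ^ (p - 2))
        (ENNReal.rpow_ne_top_of_nonneg (by linarith) hNt)
        (ENNReal.rpow_ne_top_of_nonneg (by linarith) hl')
        (by simp [ENNReal.rpow_eq_zero_iff, hN0, hNt]) hp two_pos (fun x => ?_) ?_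
      · by_cases hx : x ∈ (SL ∪ SS)ᶜ
        · rw [Set.indicator_of_mem hx]
          have hx1 : N ≤ l * ‖f x‖ₑ := (not_le.1 fun h => hx (Or.inr h)).le
          calc ‖f x‖ₑ ^ (2 : ℝ) * N ^ (p - 2) ≤ ‖f x‖ₑ ^ (2 : ℝ) * (l * ‖f x‖ₑ) ^ (p - 2) := by
                gcongr
            _ = (‖f x‖ₑ ^ (2 : ℝ) * ‖f x‖ₑ ^ (p - 2)) * l ^ (p - 2) := by
                rw [ENNReal.mul_rpow_of_nonneg _ _ (by linarith : 0 ≤ p - 2)]; ring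
            _ = _ := by
                rw [← ENNReal.rpow_add_of_nonneg _ _ (by norm_num) (by linarith)]
                congr 2; ring
        · rw [Set.indicator_of_notMem hx]; simp
      · rw [ENNReal.mul_rpow_of_nonneg _ _ (by norm_num : (0 : ℝ) ≤ 2), ← ENNReal.rpow_mul,
          mul_assoc, ← ENNReal.rpow_add_of_nonneg _ _ (by norm_num) (by linarith : 0 ≤ p - 2),
          mul_comm]
        refine le_of_eq ?_
        congr 2 <;> ring
  · refine lpn_mono hp.le fun x => ?_
    rw [enorm_indicator_eq_indicator_enorm]
    exact Set.indicator_le_self _ _ x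

/-- The trilinear form `∫ sup_{t ∈ E} |A_t(f, g)| |h|`. -/
def pairing {d : ℕ} (μ : Measure (Rd d × Rd d)) (E : Set ℝ) (f g h : Rd d → ℂ) : ℝ≥0∞ :=
  ∫⁻ x, averageMax μ E f g x * ‖h x‖ₑ

/-- Boundedness of the trilinear form on `L^p × L^q × L^s`. -/
def PairBound {d : ℕ} (μ : Measure (Rd d × Rd d)) (E : Set ℝ) (p q s : ℝ) (C : ℝ≥0) : Prop :=
  ∀ f g h, IsBddCompact f → IsBddCompact g → IsBddCompact h →
    pairing μ E f g h ≤ C * lpn p f * lpn q g * lpn s h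

lemma PairBound.mono {d : ℕ} {μ : Measure (Rd d × Rd d)} {E : Set ℝ} {p q s : ℝ} {C C' : ℝ≥0}
    (h : PairBound μ E p q s C) (hC : C ≤ C') : PairBound μ E p q s C' :=
  fun f g k hf hg hk => (h f g k hf hg hk).trans (by gcongr)

section pairing

variable {d : ℕ} {μ : Measure (Rd d × Rd d)} [IsFiniteMeasure μ] {E : Set ℝ}

lemma pairing_le_of_bound (hE : E.Countable) {r s : ℝ} (hrs : r.HolderConjugate s)
    {f g h : Rd d → ℂ} (hf : Measurable f) (hg : Measurable g) (hh : Measurable h) {A : ℝ≥0∞}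
    (hA : (∫⁻ x, averageMax μ E f g x ^ r) ^ (1 / r) ≤ A) :
    pairing μ E f g h ≤ A * lpn s h := by
  refine (ENNReal.lintegral_mul_le_Lp_mul_Lq volume hrs
    (measurable_averageMax μ hE hf hg).aemeasurable hh.enorm.aemeasurable).trans ?_
  exact mul_le_mul_left hA _

lemma pairing_add_left_le (hE : E.Countable) {f f' g h : Rd d → ℂ} (hf : IsBddCompact f)
    (hf' : IsBddCompact f') (hg : IsBddCompact g) (hh : IsBddCompact h) :
    pairing μ E (fun y => f y + f' y) g h ≤ pairing μ E f g h + pairing μ E f' g h := by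
  unfold pairing
  have hm : Measurable fun x => averageMax μ E f g x * ‖h x‖ₑ :=
    (measurable_averageMax μ hE hf.1 hg.1).mul hh.1.enorm
  rw [← lintegral_add_left hm]
  refine lintegral_mono fun x => ?_
  rw [← add_mul]
  exact mul_le_mul_left (averageMax_add_left_le μ E hf hf' hg x) _

lemma pairing_add_mid_le (hE : E.Countable) {f g g' h : Rd d → ℂ} (hf : IsBddCompact f)
    (hg : IsBddCompact g) (hg' : IsBddCompact g') (hh : IsBddCompact h) :
    pairing μ E f (fun y => g y + g' y) h ≤ pairing μ E f g h + pairing μ E f g' h := by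
  unfold pairing
  have hm : Measurable fun x => averageMax μ E f g x * ‖h x‖ₑ :=
    (measurable_averageMax μ hE hf.1 hg.1).mul hh.1.enorm
  rw [← lintegral_add_left hm]
  refine lintegral_mono fun x => ?_
  rw [← add_mul]
  exact mul_le_mul_left (averageMax_add_right_le μ E hf hg hg' x) _

lemma pairing_add_right_le (hE : E.Countable) {f g h h' : Rd d → ℂ} (hf : IsBddCompact f)
    (hg : IsBddCompact g) (hh : IsBddCompact h) :
    pairing μ E f g (fun y => h y + h' y) ≤ pairing μ E f g h + pairing μ E f g h' := by
  unfold pairing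
  have hm : Measurable fun x => averageMax μ E f g x * ‖h x‖ₑ :=
    (measurable_averageMax μ hE hf.1 hg.1).mul hh.1.enorm
  rw [← lintegral_add_left hm]
  refine lintegral_mono fun x => ?_
  rw [← mul_add]
  exact mul_le_mul_right (enorm_add_le _ _) _

/-- Interpolation by truncation: a power gain for translation differences in `L² × L² × L²`
propagates to every exponent triple which has bounded neighbours in each direction. -/
theorem pairing_translation_gain (hE : E.Countable) {p p₁ p₂ q q₁ q₂ s s₁ s₂ ε : ℝ}
    {C C₂ : ℝ≥0} (hp₁ : 1 ≤ p₁) (h₁ : p₁ < p) (h₂ : p < p₂) (hq₁ : 0 < q₁) (h₃ : q₁ < q)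
    (h₄ : q < q₂) (hs₁ : 0 < s₁) (h₅ : s₁ < s) (h₆ : s < s₂) (hε : 0 < ε)
    (B₀ : PairBound μ E p q s C) (B₁ : PairBound μ E p₁ q s C) (B₂ : PairBound μ E p₂ q s C)
    (B₃ : PairBound μ E p q₁ s C) (B₄ : PairBound μ E p q₂ s C) (B₅ : PairBound μ E p q s₁ C)
    (B₆ : PairBound μ E p q s₂ C)
    (hL2 : ∀ (u : Rd d) (f g : Rd d → ℂ), IsBddCompact f → IsBddCompact g →
      (∫⁻ x, averageMax μ E (fun y => f y - f (y - u)) g x ^ (2 : ℝ)) ^ (1 / (2 : ℝ)) ≤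
        C₂ * ENNReal.ofReal (‖u‖ ^ ε) * lpn 2 f * lpn 2 g) :
    ∃ ε' : ℝ, 0 < ε' ∧ ∃ C' : ℝ≥0, ∀ (u : Rd d) (f g h : Rd d → ℂ), IsBddCompact f →
      IsBddCompact g → IsBddCompact h →
      pairing μ E (fun y => f y - f (y - u)) g h ≤
        C' * ENNReal.ofReal (‖u‖ ^ ε') * lpn p f * lpn q g * lpn s h := by
  have hp : 0 < p := by linarith
  have hq : 0 < q := by linarith
  have hs : 0 < s := by linarith
  obtain ⟨c, hc0, hcp₁, hcp₂, hcq₁, hcq₂, hcs₁, hcs₂⟩ : ∃ c : ℝ, 0 < c ∧ c ≤ p / p₁ - 1 ∧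
      c ≤ 1 - p / p₂ ∧ c ≤ q / q₁ - 1 ∧ c ≤ 1 - q / q₂ ∧ c ≤ s / s₁ - 1 ∧ c ≤ 1 - s / s₂ := by
    have a : ∀ {x y : ℝ}, 0 < x → x < y → 0 < y / x - 1 := fun hx hxy => by
      rw [sub_pos, one_lt_div hx]; exact hxy
    have b : ∀ {x y : ℝ}, 0 < x → x < y → 0 < 1 - x / y := fun hx hxy => by
      rw [sub_pos, div_lt_one (hx.trans hxy)]; exact hxy
    refine ⟨min (min (min (p / p₁ - 1) (1 - p / p₂)) (min (q / q₁ - 1) (1 - q / q₂)))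
      (min (s / s₁ - 1) (1 - s / s₂)), ?_, ?_⟩
    · exact lt_min (lt_min (lt_min (a (by linarith) h₁) (b hp h₂)) (lt_min (a hq₁ h₃) (b hq h₄)))
        (lt_min (a hs₁ h₅) (b hs h₆))
    · simp
  set K : ℝ := max (max (|p - 2| / 2) (|q - 2| / 2)) (|s - 2| / 2) with hK
  have hKp : |p - 2| / 2 ≤ K := (le_max_left _ _).trans (le_max_left _ _)
  have hKq : |q - 2| / 2 ≤ K := (le_max_right _ _).trans (le_max_left _ _)
  have hKs : |s - 2| / 2 ≤ K := le_max_right _ _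
  have hK0 : 0 ≤ K := le_trans (by positivity) hKp
  -- With `l = |u|^(-τ)` the extreme pieces gain `l^(-c) = |u|^(τc)`, while the triple of
  -- intermediate pieces retains `|u|^(ε - 3Kτ)`. This `τ` makes the two equal.
  set τ : ℝ := ε / (3 * K + c) with hτ
  have hden : 0 < 3 * K + c := by positivity
  have hτ0 : 0 < τ := by positivity
  have hτe : τ * c = ε - 3 * K * τ := by rw [hτ]; field_simp; ring
  have lpnV : ∀ {e : ℝ} (u : Rd d) {f : Rd d → ℂ}, 1 ≤ e → Measurable f →
      lpn e (fun y => f y - f (y - u)) ≤ 2 * lpn e f := fun {e} u {f} he hf => by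
    have h' : Measurable fun y => f (y - u) := hf.comp (by fun_prop)
    refine (lpn_sub_le he hf h').trans_eq ?_
    rw [lpn_translate, two_mul]
  -- Six terms contain an extreme piece. Each costs `2C`, as a translation difference at most
  -- doubles the norm. The remaining term costs `C₂`.
  refine ⟨τ * c, by positivity, 12 * C + C₂, fun u f g h hf hg hh => ?_⟩
  have hV : ∀ {f : Rd d → ℂ}, IsBddCompact f → IsBddCompact (fun y => f y - f (y - u)) :=
    fun hf => hf.sub (hf.translate u)
  have bd : ∀ {a b e : ℝ}, 1 ≤ a → PairBound μ E a b e C → ∀ f g h, IsBddCompact f →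
      IsBddCompact g → IsBddCompact h → pairing μ E (fun y => f y - f (y - u)) g h ≤
        2 * C * lpn a f * lpn b g * lpn e h := by
    intro a b e ha hB f g h hf hg hh
    refine (hB _ g h (hV hf) hg hh).trans ?_
    calc _ ≤ C * (2 * lpn a f) * lpn b g * lpn e h := by gcongr; exact lpnV u ha hf.1
      _ = _ := by ring
  have hp1 : 1 ≤ p := by linarith
  rcases eq_or_ne u 0 with rfl | hu
  · have : pairing μ E (fun y => f y - f (y - 0)) g h = 0 := by
      have : ∀ x, averageMax μ E (fun y => f y - f (y - 0)) g x = 0 := fun x => by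
        simp [averageMax, bilinearAverage]
      simp only [pairing, this, zero_mul, lintegral_zero]
    rw [this]; exact zero_le
  have hu0 : 0 < ‖u‖ := norm_pos_iff.2 hu
  rcases le_or_gt 1 ‖u‖ with hu1 | hu1
  · refine (bd hp1 B₀ f g h hf hg hh).trans ?_
    have : 1 ≤ ENNReal.ofReal (‖u‖ ^ (τ * c)) := by
      rw [← ENNReal.ofReal_one]
      exact ENNReal.ofReal_le_ofReal (Real.one_le_rpow hu1 (by positivity))
    gcongr ?_ * _ * _ * _
    calc (2 * C : ℝ≥0∞) ≤ (12 * C + C₂ : ℝ≥0) * 1 := by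
          rw [mul_one]
          have : (2 * C : ℝ≥0) ≤ 12 * C + C₂ := by
            refine le_add_right ?_
            gcongr; norm_num
          exact_mod_cast this
      _ ≤ _ := by gcongr
  set l : ℝ≥0∞ := ENNReal.ofReal (‖u‖ ^ (-τ)) with hl
  have hl1 : 1 ≤ l := by
    rw [hl, ← ENNReal.ofReal_one]
    exact ENNReal.ofReal_le_ofReal
      (Real.one_le_rpow_of_pos_of_le_one_of_nonpos hu0 hu1.le (by linarith))
  have hlt : l ≠ ∞ := ENNReal.ofReal_ne_top
  set δ : ℝ≥0∞ := ENNReal.ofReal (‖u‖ ^ (τ * c)) with hδ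
  have hlc : l ^ (-c) = δ := by
    rw [hl, hδ, ENNReal.ofReal_rpow_of_pos (by positivity), ← Real.rpow_mul hu0.le]
    congr 2; ring
  have hlK : ENNReal.ofReal (‖u‖ ^ ε) * (l ^ K * l ^ K * l ^ K) = δ := by
    have : l ^ K * l ^ K * l ^ K = ENNReal.ofReal (‖u‖ ^ (-τ * (3 * K))) := by
      rw [hl, ENNReal.ofReal_rpow_of_pos (by positivity), ← Real.rpow_mul hu0.le,
        ← ENNReal.ofReal_mul (by positivity), ← ENNReal.ofReal_mul (by positivity),
        ← Real.rpow_add hu0, ← Real.rpow_add hu0]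
      congr 2; ring
    rw [this, hδ, ← ENNReal.ofReal_mul (by positivity), ← Real.rpow_add hu0, hτe]
    congr 2; ring
  obtain ⟨fL, fS, fM, hfL, hfS, hfM, ef, nfL, nfS, nfM, nfM'⟩ :=
    exists_truncation hf (by linarith) h₁ h₂ hcp₁ hcp₂ hKp hl1 hlt
  obtain ⟨gL, gS, gM, hgL, hgS, hgM, eg, ngL, ngS, ngM, ngM'⟩ :=
    exists_truncation hg hq₁ h₃ h₄ hcq₁ hcq₂ hKq hl1 hlt
  obtain ⟨kL, kS, kM, hkL, hkS, hkM, eh, nkL, nkS, nkM, -⟩ :=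
    exists_truncation hh hs₁ h₅ h₆ hcs₁ hcs₂ hKs hl1 hlt
  rw [hlc] at nfL nfS ngL ngS nkL nkS
  set X := lpn p f
  set Y := lpn q g
  set Z := lpn s h
  have hfSM := hfS.add hfM
  have hgSM := hgS.add hgM
  have hkSM := hkS.add hkM
  have T1 : pairing μ E (fun y => fL y - fL (y - u)) g h ≤ 2 * C * δ * X * Y * Z :=
    (bd hp₁ B₁ _ _ _ hfL hg hh).trans <| by
      calc _ ≤ 2 * C * (δ * X) * Y * Z := by gcongr
        _ = _ := by ring
  have T2 : pairing μ E (fun y => fS y - fS (y - u)) g h ≤ 2 * C * δ * X * Y * Z :=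
    (bd (by linarith) B₂ _ _ _ hfS hg hh).trans <| by
      calc _ ≤ 2 * C * (δ * X) * Y * Z := by gcongr
        _ = _ := by ring
  have T3 : pairing μ E (fun y => fM y - fM (y - u)) gL h ≤ 2 * C * δ * X * Y * Z :=
    (bd hp1 B₃ _ _ _ hfM hgL hh).trans <| by
      calc _ ≤ 2 * C * X * (δ * Y) * Z := by gcongr
        _ = _ := by ring
  have T4 : pairing μ E (fun y => fM y - fM (y - u)) gS h ≤ 2 * C * δ * X * Y * Z :=
    (bd hp1 B₄ _ _ _ hfM hgS hh).trans <| by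
      calc _ ≤ 2 * C * X * (δ * Y) * Z := by gcongr
        _ = _ := by ring
  have T5 : pairing μ E (fun y => fM y - fM (y - u)) gM kL ≤ 2 * C * δ * X * Y * Z :=
    (bd hp1 B₅ _ _ _ hfM hgM hkL).trans <| by
      calc _ ≤ 2 * C * X * Y * (δ * Z) := by gcongr
        _ = _ := by ring
  have T6 : pairing μ E (fun y => fM y - fM (y - u)) gM kS ≤ 2 * C * δ * X * Y * Z :=
    (bd hp1 B₆ _ _ _ hfM hgM hkS).trans <| by
      calc _ ≤ 2 * C * X * Y * (δ * Z) := by gcongr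
        _ = _ := by ring
  -- The only term with all three pieces intermediate, and the only one that uses the `L²` estimate.
  have T7 : pairing μ E (fun y => fM y - fM (y - u)) gM kM ≤ C₂ * δ * X * Y * Z := by
    refine (pairing_le_of_bound hE Real.HolderConjugate.two_two (hV hfM).1 hgM.1 hkM.1
      (hL2 u fM gM hfM hgM)).trans ?_
    calc _ ≤ C₂ * ENNReal.ofReal (‖u‖ ^ ε) * (l ^ K * X) * (l ^ K * Y) * (l ^ K * Z) := by gcongr
      _ = C₂ * (ENNReal.ofReal (‖u‖ ^ ε) * (l ^ K * l ^ K * l ^ K)) * X * Y * Z := by ring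
      _ = _ := by rw [hlK]
  have S1 : pairing μ E (fun y => f y - f (y - u)) g h ≤
      pairing μ E (fun y => fL y - fL (y - u)) g h +
        (pairing μ E (fun y => fS y - fS (y - u)) g h +
          pairing μ E (fun y => fM y - fM (y - u)) g h) := by
    have e : (fun y => f y - f (y - u)) = fun y => (fL y - fL (y - u)) +
        ((fS y - fS (y - u)) + (fM y - fM (y - u))) := by
      ext y
      rw [show f y = fL y + (fS y + fM y) from congrFun ef y,
        show f (y - u) = fL (y - u) + (fS (y - u) + fM (y - u)) from congrFun ef (y - u)]
      ring
    rw [e]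
    refine (pairing_add_left_le hE (hV hfL) ((hV hfS).add (hV hfM)) hg hh).trans ?_
    gcongr
    exact pairing_add_left_le hE (hV hfS) (hV hfM) hg hh
  have S2 : pairing μ E (fun y => fM y - fM (y - u)) g h ≤
      pairing μ E (fun y => fM y - fM (y - u)) gL h +
        (pairing μ E (fun y => fM y - fM (y - u)) gS h +
          pairing μ E (fun y => fM y - fM (y - u)) gM h) := by
    conv_lhs => rw [eg]
    refine (pairing_add_mid_le hE (hV hfM) hgL hgSM hh).trans ?_
    gcongr
    exact pairing_add_mid_le hE (hV hfM) hgS hgM hh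
  have S3 : pairing μ E (fun y => fM y - fM (y - u)) gM h ≤
      pairing μ E (fun y => fM y - fM (y - u)) gM kL +
        (pairing μ E (fun y => fM y - fM (y - u)) gM kS +
          pairing μ E (fun y => fM y - fM (y - u)) gM kM) := by
    conv_lhs => rw [eh]
    refine (pairing_add_right_le hE (hV hfM) hgM hkL).trans ?_
    gcongr
    exact pairing_add_right_le hE (hV hfM) hgM hkS
  calc _ ≤ _ := S1
    _ ≤ 2 * C * δ * X * Y * Z + (2 * C * δ * X * Y * Z + (2 * C * δ * X * Y * Z +
        (2 * C * δ * X * Y * Z + (2 * C * δ * X * Y * Z + (2 * C * δ * X * Y * Z +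
          C₂ * δ * X * Y * Z))))) := by
      gcongr
      refine S2.trans ?_
      gcongr
      refine S3.trans ?_
      gcongr
    _ = _ := by push_cast; ring

end pairing

/-! ### Exchanging the inputs, and exponents near an interior point. -/

lemma integral_map_swap {d : ℕ} (μ : Measure (Rd d × Rd d)) (F : Rd d × Rd d → ℂ) :
    ∫ w, F w ∂(μ.map Prod.swap) = ∫ w, F w.swap ∂μ := by
  have : MeasurableEmbedding (Prod.swap : Rd d × Rd d → Rd d × Rd d) :=
    MeasurableEquiv.prodComm.measurableEmbedding
  exact this.integral_map _

lemma bilinearAverage_swap {d : ℕ} (μ : Measure (Rd d × Rd d)) (t : ℝ) (f g : Rd d → ℂ)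
    (x : Rd d) : bilinearAverage (μ.map Prod.swap) t f g x = bilinearAverage μ t g f x := by
  unfold bilinearAverage
  rw [integral_map_swap]
  congr 1 with w
  exact mul_comm _ _

lemma averageMax_swap {d : ℕ} (μ : Measure (Rd d × Rd d)) (E : Set ℝ) (f g : Rd d → ℂ)
    (x : Rd d) : averageMax (μ.map Prod.swap) E f g x = averageMax μ E g f x := by
  simp only [averageMax, bilinearAverage_swap]

lemma PairBound.swap {d : ℕ} {μ : Measure (Rd d × Rd d)} {E : Set ℝ} {p q s : ℝ} {C : ℝ≥0}
    (h : PairBound μ E p q s C) : PairBound (μ.map Prod.swap) E q p s C := by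
  intro f g k hf hg hk
  have := h g f k hg hf hk
  simp only [pairing, averageMax_swap] at this ⊢
  refine this.trans_eq ?_
  ring

lemma IsCompactlySupported.swap {d : ℕ} {μ : Measure (Rd d × Rd d)}
    (h : IsCompactlySupported μ) : IsCompactlySupported (μ.map Prod.swap) := by
  obtain ⟨K, hK, h0⟩ := h
  refine ⟨Prod.swap ⁻¹' K, ?_, ?_⟩
  · exact (Homeomorph.prodComm (Rd d) (Rd d)).isCompact_preimage.2 hK
  · rw [Measure.map_apply measurable_swap]
    · exact h0
    · exact (measurable_swap hK.measurableSet).compl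

lemma IsAdmissible.swap {d : ℕ} {μ : Measure (Rd d × Rd d)} {a : ℝ}
    (h : IsAdmissible μ a) : IsAdmissible (μ.map Prod.swap) a := by
  obtain ⟨h1, C, hC⟩ := h
  refine ⟨h1, C, fun ξ η => ?_⟩
  have : fourierMeasure (μ.map Prod.swap) (ξ, η) = fourierMeasure μ (η, ξ) := by
    rw [fourierMeasure_eq, fourierMeasure_eq, integral_map_swap]
    congr 1 with w
    simp [add_comm]
  rw [this, add_right_comm]
  exact hC η ξ

/-- Exponents near an interior point of the improving region. -/
lemma exists_neighbour_bounds {d : ℕ} {μ : Measure (Rd d × Rd d)} [IsFiniteMeasure μ]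
    {E E' : Set ℝ} (hE' : E' ⊆ E) (hE'c : E'.Countable) {p q r : ℝ}
    (h : (1 / p, 1 / q, 1 / r) ∈ interior (improvingRegion μ E)) (hr : 1 < r) :
    ∃ (p₁ p₂ q₁ q₂ s₁ s₂ : ℝ) (C : ℝ≥0), 1 ≤ p₁ ∧ p₁ < p ∧ p < p₂ ∧ 1 ≤ q₁ ∧ q₁ < q ∧ q < q₂ ∧
      0 < s₁ ∧ s₁ < r / (r - 1) ∧ r / (r - 1) < s₂ ∧
      PairBound μ E' p q (r / (r - 1)) C ∧ PairBound μ E' p₁ q (r / (r - 1)) C ∧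
      PairBound μ E' p₂ q (r / (r - 1)) C ∧ PairBound μ E' p q₁ (r / (r - 1)) C ∧
      PairBound μ E' p q₂ (r / (r - 1)) C ∧ PairBound μ E' p q s₁ C ∧ PairBound μ E' p q s₂ C := by
  rw [mem_interior_iff_mem_nhds, Metric.mem_nhds_iff] at h
  obtain ⟨κ₀, hκ₀, hball⟩ := h
  have hr0 : 0 < r := by linarith
  have hir : 0 < 1 / r := by positivity
  have hir1 : 1 / r < 1 := by rw [div_lt_one hr0]; exact hr
  -- Shifts by `2κ` stay in the ball around the point, though only shifts by `κ` will be used. The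
  -- other two constraints keep the shifted `1/r` and `1/s` positive.
  obtain ⟨κ, hκ0, hκ1, hκ2, hκ3⟩ : ∃ κ : ℝ, 0 < κ ∧ κ < κ₀ / 2 ∧ κ < 1 / r ∧ κ < 1 - 1 / r :=
    ⟨min (κ₀ / 2) (min (1 / r) (1 - 1 / r)) / 2, by
      have : 0 < min (κ₀ / 2) (min (1 / r) (1 - 1 / r)) :=
        lt_min (by linarith) (lt_min hir (by linarith))
      refine ⟨by linarith, ?_, ?_, ?_⟩
      · linarith [min_le_left (κ₀ / 2) (min (1 / r) (1 - 1 / r))]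
      · linarith [(min_le_right (κ₀ / 2) (min (1 / r) (1 - 1 / r))).trans (min_le_left _ _)]
      · linarith [(min_le_right (κ₀ / 2) (min (1 / r) (1 - 1 / r))).trans (min_le_right _ _)]⟩
  have hmem : ∀ x y z : ℝ, |x| ≤ 2 * κ → |y| ≤ 2 * κ → |z| ≤ 2 * κ →
      (1 / p + x, 1 / q + y, 1 / r + z) ∈ improvingRegion μ E := by
    intro x y z hx hy hz
    apply hball
    simp only [Metric.mem_ball, Prod.dist_eq, Real.dist_eq, add_sub_cancel_left]
    exact max_lt (by linarith) (max_lt (by linarith) (by linarith))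
  have hrange : ∀ {x y z : ℝ}, (x, y, z) ∈ improvingRegion μ E → 0 ≤ x ∧ x ≤ 1 ∧ 0 ≤ y ∧ y ≤ 1 := by
    rintro x y z ⟨P, Q, R, hP, hQ, -, -, -, hu⟩
    simp only [Prod.mk.injEq] at hu
    have key : ∀ {S : ℝ≥0∞}, 1 ≤ S → S⁻¹.toReal ≤ 1 := fun hS => by
      rw [← ENNReal.toReal_one]
      exact ENNReal.toReal_mono (by simp) (ENNReal.inv_le_one.2 hS)
    rw [hu.1, hu.2.1]
    exact ⟨ENNReal.toReal_nonneg, key hP, ENNReal.toReal_nonneg, key hQ⟩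
  have hκκ : |(2 * κ)| ≤ 2 * κ := (abs_of_pos (by linarith)).le
  have hκn : |(-(2 * κ))| ≤ 2 * κ := by rw [abs_neg]; exact hκκ
  have h0 : |(0 : ℝ)| ≤ 2 * κ := by rw [abs_zero]; linarith
  have hk : |κ| ≤ 2 * κ := by rw [abs_of_pos hκ0]; linarith
  have hkn : |(-κ)| ≤ 2 * κ := by rw [abs_neg]; exact hk
  -- Points of the region have their first two coordinates in `[0, 1]`. Applied to shifts by `±2κ`,
  -- this puts `1/p ± κ` and `1/q ± κ` strictly inside `(0, 1)`, so that `p₁, q₁ ≥ 1`.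
  obtain ⟨-, hp1, -, hq1⟩ := hrange (hmem _ _ _ hκκ hκκ h0)
  obtain ⟨hp0, -, hq0, -⟩ := hrange (hmem _ _ _ hκn hκn h0)
  have pos_of : ∀ {x : ℝ}, 0 < 1 / x → 0 < x := fun h => by simpa using h
  have hp : 0 < p := pos_of (by linarith)
  have hq : 0 < q := pos_of (by linarith)
  set s := r / (r - 1) with hs
  have hs0 : 0 < s := div_pos hr0 (by linarith)
  have his : 1 / s = 1 - 1 / r := by rw [hs]; field_simp
  have hconj : ∀ {x y : ℝ}, 0 < x → 0 < y → 1 / x + 1 / y = 1 → x.HolderConjugate y := by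
    intro x y hx hy hxy
    rw [Real.holderConjugate_iff]
    refine ⟨?_, by simpa using hxy⟩
    have h1 : 0 < 1 / y := by positivity
    have h2 : 1 / x < 1 := by linarith
    rwa [div_lt_one hx] at h2
  -- Duality turns a shift of `1/r` by `z` into a shift of the reciprocal dual exponent by `-z`.
  have PB : ∀ {a b e x y z : ℝ}, 0 < a → 0 < b → 0 < e → 1 / a = 1 / p + x → 1 / b = 1 / q + y →
      1 / e = 1 / s - z → 0 < 1 / r + z → |x| ≤ 2 * κ → |y| ≤ 2 * κ → |z| ≤ 2 * κ →
      ∃ C : ℝ≥0, PairBound μ E' a b e C := by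
    intro a b e x y z ha hb he hax hby hez hz0 hx hy hz
    have hρ : 0 < 1 / (1 / r + z) := by positivity
    have hm := hmem x y z hx hy hz
    rw [← hax, ← hby, ← one_div_one_div (1 / r + z)] at hm
    obtain ⟨C, hC⟩ := improvingRegion_bound hE' hE'c ha hb hρ hm
    refine ⟨C, fun f g k hf hg hk => pairing_le_of_bound hE'c (hconj hρ he ?_) hf.1 hg.1 hk.1
      (hC f g hf hg)⟩
    rw [one_div_one_div, hez, his]; ring
  have lt_of : ∀ {x y : ℝ}, 0 < x → 0 < y → 1 / y < 1 / x → x < y := fun hx hy h =>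
    (one_div_lt_one_div hy hx).1 h
  have ip : 0 < 1 / p := by positivity
  have iq : 0 < 1 / q := by positivity
  have hsi : 0 < 1 / s := by positivity
  obtain ⟨C₀, c₀⟩ := PB (x := 0) (y := 0) (z := 0) hp hq hs0 (by ring) (by ring) (by ring)
    (by linarith) h0 h0 h0
  have up₁ : 0 < 1 / (1 / p + κ) := by positivity
  have up₂ : 0 < 1 / (1 / p + -κ) := one_div_pos.2 (by linarith)
  have uq₁ : 0 < 1 / (1 / q + κ) := by positivity
  have uq₂ : 0 < 1 / (1 / q + -κ) := one_div_pos.2 (by linarith)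
  have us₁ : 0 < 1 / (1 / s + κ) := by positivity
  have us₂ : 0 < 1 / (1 / s + -κ) := one_div_pos.2 (by linarith)
  obtain ⟨C₁, c₁⟩ := PB (y := 0) (z := 0) up₁ hq hs0 (one_div_one_div _) (by ring) (by ring)
    (by linarith) hk h0 h0
  obtain ⟨C₂, c₂⟩ := PB (y := 0) (z := 0) up₂ hq hs0 (one_div_one_div _) (by ring) (by ring)
    (by linarith) hkn h0 h0
  obtain ⟨C₃, c₃⟩ := PB (x := 0) (z := 0) hp uq₁ hs0 (by ring) (one_div_one_div _) (by ring)
    (by linarith) h0 hk h0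
  obtain ⟨C₄, c₄⟩ := PB (x := 0) (z := 0) hp uq₂ hs0 (by ring) (one_div_one_div _) (by ring)
    (by linarith) h0 hkn h0
  obtain ⟨C₅, c₅⟩ := PB (x := 0) (y := 0) (z := -κ) hp hq us₁ (by ring) (by ring)
    (by rw [one_div_one_div]; ring) (by linarith) h0 h0 hkn
  obtain ⟨C₆, c₆⟩ := PB (x := 0) (y := 0) (z := κ) hp hq us₂ (by ring) (by ring)
    (by rw [one_div_one_div]; ring) (by linarith) h0 h0 hk
  refine ⟨_, _, _, _, _, _, C₀ + C₁ + C₂ + C₃ + C₄ + C₅ + C₆, ?_, ?_, ?_, ?_, ?_, ?_, us₁, ?_, ?_,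
    c₀.mono ?_, c₁.mono ?_, c₂.mono ?_, c₃.mono ?_, c₄.mono ?_, c₅.mono ?_, c₆.mono ?_⟩
  · rw [le_div_iff₀ (by positivity)]; linarith
  · exact lt_of up₁ hp (by rw [one_div_one_div]; linarith)
  · exact lt_of hp up₂ (by rw [one_div_one_div]; linarith)
  · rw [le_div_iff₀ (by positivity)]; linarith
  · exact lt_of uq₁ hq (by rw [one_div_one_div]; linarith)
  · exact lt_of hq uq₂ (by rw [one_div_one_div]; linarith)
  · exact lt_of us₁ hs0 (by rw [one_div_one_div]; linarith)
  · exact lt_of hs0 us₂ (by rw [one_div_one_div]; linarith)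
  all_goals
    rw [← NNReal.coe_le_coe]; push_cast
    linarith [C₀.2, C₁.2, C₂.2, C₃.2, C₄.2, C₅.2, C₆.2, C₀.coe_nonneg, C₁.coe_nonneg,
      C₂.coe_nonneg, C₃.coe_nonneg, C₄.coe_nonneg, C₅.coe_nonneg, C₆.coe_nonneg]

/-! ### Dyadic cells and the gain for functions of mean zero. -/

/-- The index of the dyadic cell of side `2 ^ k` which contains `x`. -/
def idx {d : ℕ} (k : ℤ) (x : Rd d) : Fin d → ℤ := fun i => ⌊x i / 2 ^ k⌋

/-- The dyadic cell of side `2 ^ k` with index `n`. -/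
def cell {d : ℕ} (k : ℤ) (n : Fin d → ℤ) : Set (Rd d) := {x | idx k x = n}

lemma measurable_idx {d : ℕ} (k : ℤ) : Measurable (idx (d := d) k) :=
  measurable_pi_lambda _ fun i => Int.measurable_floor.comp (by fun_prop)

lemma measurableSet_cell {d : ℕ} (k : ℤ) (n : Fin d → ℤ) : MeasurableSet (cell k n) :=
  measurable_idx k (measurableSet_singleton n)

lemma mem_cell_iff {d : ℕ} {k : ℤ} {n : Fin d → ℤ} {x : Rd d} :
    x ∈ cell k n ↔ ∀ i, n i * 2 ^ k ≤ x i ∧ x i < n i * 2 ^ k + 2 ^ k := by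
  have h2 : (0 : ℝ) < 2 ^ k := by positivity
  simp only [cell, Set.mem_ofPred_eq, funext_iff, idx, Int.floor_eq_iff, le_div_iff₀ h2,
    div_lt_iff₀ h2, add_mul, one_mul]

lemma ofReal_two_zpow (k : ℤ) : ENNReal.ofReal ((2 : ℝ) ^ k) = (2 : ℝ≥0∞) ^ (k : ℝ) := by
  rw [← Real.rpow_intCast, ← ENNReal.ofReal_rpow_of_pos (by norm_num)]
  norm_num

lemma volume_box {d : ℕ} (c : Fin d → ℝ) (s : ℝ) :
    volume {x : Rd d | ∀ i, c i ≤ x i ∧ x i < c i + s} = ENNReal.ofReal s ^ d := by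
  have e : {x : Rd d | ∀ i, c i ≤ x i ∧ x i < c i + s} =
      (WithLp.ofLp : Rd d → Fin d → ℝ) ⁻¹' (Set.univ.pi fun i => Set.Ico (c i) (c i + s)) := by
    ext x; simp [Set.mem_pi]
  rw [e, (PiLp.volume_preserving_ofLp (Fin d)).measure_preimage
    (MeasurableSet.univ_pi fun i => measurableSet_Ico).nullMeasurableSet, Real.volume_pi_Ico]
  simp

lemma volume_cell {d : ℕ} (k : ℤ) (n : Fin d → ℤ) :
    volume (cell k n) = (2 : ℝ≥0∞) ^ ((k : ℝ) * d) := by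
  have e : cell k n = {x : Rd d | ∀ i, n i * 2 ^ k ≤ x i ∧ x i < n i * 2 ^ k + 2 ^ k} := by
    ext x; exact mem_cell_iff
  rw [e, volume_box (fun i => n i * 2 ^ k), ofReal_two_zpow, ENNReal.rpow_mul,
    ENNReal.rpow_natCast]

lemma two_rpow_ne_zero (x : ℝ) : (2 : ℝ≥0∞) ^ x ≠ 0 := by
  simp [ENNReal.rpow_eq_zero_iff]

lemma two_rpow_ne_top (x : ℝ) : (2 : ℝ≥0∞) ^ x ≠ ∞ := by
  simp [ENNReal.rpow_eq_top_iff]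

lemma two_rpow_add (x y : ℝ) : (2 : ℝ≥0∞) ^ (x + y) = 2 ^ x * 2 ^ y :=
  ENNReal.rpow_add _ _ (by norm_num) (by norm_num)

lemma norm_le_of_coord_le {d : ℕ} {v : Rd d} {B : ℝ} (hB : 0 ≤ B) (h : ∀ i, |v i| ≤ B) :
    ‖v‖ ≤ d * B := by
  rw [EuclideanSpace.norm_eq]
  refine Real.sqrt_le_iff.2 ⟨by positivity, ?_⟩
  calc ∑ i, ‖v i‖ ^ 2 ≤ ∑ _i : Fin d, B ^ 2 := by
        refine Finset.sum_le_sum fun i _ => ?_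
        rw [Real.norm_eq_abs]
        exact pow_le_pow_left₀ (abs_nonneg _) (h i) 2
    _ = d * B ^ 2 := by simp
    _ ≤ _ := by
        rw [mul_pow]
        gcongr
        rcases Nat.eq_zero_or_pos d with h | h
        · simp [h]
        · have : (1 : ℝ) ≤ d := by exact_mod_cast h
          nlinarith

lemma norm_sub_le_of_idx_eq {d : ℕ} {k : ℤ} {x y : Rd d} (h : idx k x = idx k y) :
    ‖x - y‖ ≤ d * 2 ^ k := by
  have h2 : (0 : ℝ) < 2 ^ k := by positivity
  have hx := mem_cell_iff.1 (show x ∈ cell k (idx k y) from h)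
  have hy := mem_cell_iff.1 (show y ∈ cell k (idx k y) from rfl)
  refine norm_le_of_coord_le h2.le fun i => ?_
  rw [PiLp.sub_apply, abs_le]
  constructor <;> linarith [(hx i).1, (hx i).2, (hy i).1, (hy i).2]

section cancellation

variable {d : ℕ} {μ : Measure (Rd d × Rd d)} [IsFiniteMeasure μ] {E : Set ℝ}

/-- The restriction of `b` to the points which stay in their cell under translation by `u`. -/
@[irreducible] def cellShift (j : ℤ) (b : Rd d → ℂ) (u y : Rd d) : ℂ :=
  {y | idx j (y + u) = idx j y}.indicator b y

lemma measurable_cellShift (j : ℤ) {b : Rd d → ℂ} (hb : Measurable b) :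
    Measurable fun p : Rd d × Rd d => cellShift j b p.1 p.2 := by
  have : (fun p : Rd d × Rd d => cellShift j b p.1 p.2) =
      {p : Rd d × Rd d | idx j (p.2 + p.1) = idx j p.2}.indicator fun p => b p.2 := by
    ext p; simp [cellShift, Set.indicator]
  rw [this]
  refine (hb.comp measurable_snd).indicator (measurableSet_eq_fun ?_ ?_)
  · exact (measurable_idx j).comp (by fun_prop)
  · exact (measurable_idx j).comp measurable_snd

lemma measurable_cellShift_sub (j : ℤ) {b : Rd d → ℂ} (hb : Measurable b) :
    Measurable fun p : Rd d × Rd d => cellShift j b p.1 p.2 - cellShift j b p.1 (p.2 - p.1) := by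
  have h := measurable_cellShift j hb
  have hφ : Measurable fun p : Rd d × Rd d => (p.1, p.2 - p.1) :=
    measurable_fst.prodMk (measurable_snd.sub measurable_fst)
  exact h.sub (h.comp hφ)

lemma isBddCompact_cellShift (j : ℤ) {b : Rd d → ℂ} (hb : IsBddCompact b) (u : Rd d) :
    IsBddCompact (cellShift j b u) := by
  unfold cellShift
  exact hb.indicator
    (measurableSet_eq_fun ((measurable_idx j).comp (by fun_prop)) (measurable_idx j))

lemma cellShift_eq_zero {j : ℤ} {b : Rd d → ℂ} {u y : Rd d} (hu : (d : ℝ) * 2 ^ j < ‖u‖) :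
    cellShift j b u y = 0 := by
  unfold cellShift
  refine Set.indicator_of_notMem (fun h => ?_) _
  have := norm_sub_le_of_idx_eq (show idx j (y + u) = idx j y from h)
  rw [add_sub_cancel_left] at this
  linarith

/-- Integrated over `u`, the first term counts the shifts that keep `y` in its cell and yields the
volume of the cell times `b y`. The second term yields the integral of `b` over the cell, which is
0. Hence `b` is an average of translation differences, and only shifts up to the diameter of a cell
contribute. -/
lemma integral_cellShift (j : ℤ) {b : Rd d → ℂ} (hb : IsBddCompact b)
    (h0 : ∀ n, ∫ y in cell j n, b y = 0) (y : Rd d) :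
    ∫ u in Metric.closedBall (0 : Rd d) (d * 2 ^ j),
      (cellShift j b u y - cellShift j b u (y - u)) =
        ((2 : ℝ≥0∞) ^ ((j : ℝ) * d)).toReal * b y := by
  rw [setIntegral_eq_integral_of_forall_compl_eq_zero]
  swap
  · intro u hu
    rw [mem_closedBall_zero_iff, not_le] at hu
    rw [cellShift_eq_zero hu, cellShift_eq_zero hu, sub_zero]
  have e1 : (fun u => cellShift j b u y) =
      fun u => (cell j (idx j y)).indicator (fun _ => b y) (y + u) := by
    ext u
    simp only [cellShift, Set.indicator, cell, Set.mem_ofPred_eq]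
    congr
  have e2 : (fun u => cellShift j b u (y - u)) =
      fun u => (cell j (idx j y)).indicator b (y - u) := by
    ext u; simp only [cellShift, Set.indicator, cell, Set.mem_ofPred_eq, sub_add_cancel, eq_comm]
  have hc : volume (cell j (idx j y)) ≠ ∞ := by rw [volume_cell]; exact two_rpow_ne_top _
  have i1 : Integrable ((cell j (idx j y)).indicator fun _ : Rd d => b y) :=
    (integrable_indicator_iff (measurableSet_cell j _)).2 (integrableOn_const hc)
  have i2 : Integrable ((cell j (idx j y)).indicator b) := by
    obtain ⟨hbm, M, hM, -⟩ := hb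
    refine (integrable_indicator_iff (measurableSet_cell j _)).2 ?_
    exact Measure.integrableOn_of_bounded (M := M) hc hbm.aestronglyMeasurable
      (Eventually.of_forall hM)
  rw [integral_sub, e1, e2, integral_add_left_eq_self (fun u => (cell j (idx j y)).indicator _ u),
    integral_sub_left_eq_self (fun u => (cell j (idx j y)).indicator b u),
    integral_indicator (measurableSet_cell _ _), integral_indicator (measurableSet_cell _ _), h0,
    sub_zero, setIntegral_const, measureReal_def, volume_cell, Complex.real_smul]
  · rw [e1]; exact i1.comp_add_left y
  · rw [e2]; exact i2.comp_sub_left y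

/-- The representation of `b` by `integral_cellShift` passes through the bilinear average by Fubini.
The supremum over `t` is then taken inside the integral in `u`. -/
lemma averageMax_le_lintegral_cellShift (j : ℤ) {b g : Rd d → ℂ} (hb : IsBddCompact b)
    (hg : IsBddCompact g) (h0 : ∀ n, ∫ y in cell j n, b y = 0) (x : Rd d) :
    (2 : ℝ≥0∞) ^ ((j : ℝ) * d) * averageMax μ E b g x ≤
      ∫⁻ u in Metric.closedBall (0 : Rd d) (d * 2 ^ j),
        averageMax μ E (fun y => cellShift j b u y - cellShift j b u (y - u)) g x := by
  obtain ⟨U, hUe⟩ : ∃ U, U = Metric.closedBall (0 : Rd d) (d * 2 ^ j) := ⟨_, rfl⟩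
  obtain ⟨v, hv⟩ : ∃ v, v = (2 : ℝ≥0∞) ^ ((j : ℝ) * d) := ⟨_, rfl⟩
  have hI := integral_cellShift j hb h0
  rw [← hUe, ← hv] at hI
  rw [← hUe, ← hv]
  have hU : volume U < ∞ := by rw [hUe]; exact measure_closedBall_lt_top
  have : IsFiniteMeasure (volume.restrict U) := ⟨by simpa using hU⟩
  have hvt : v ≠ ∞ := hv ▸ two_rpow_ne_top _
  obtain ⟨hbm, M, hM, -⟩ := id hb
  obtain ⟨hgm, N, hN, -⟩ := id hg
  have hcs : ∀ u y, ‖cellShift j b u y‖ ≤ M := fun u y => by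
    unfold cellShift; exact (norm_indicator_le_norm_self _ _).trans (hM y)
  have hmV := measurable_cellShift_sub j hbm
  simp only [averageMax]
  rw [ENNReal.mul_iSup]
  refine iSup_le fun t => ?_
  rw [ENNReal.mul_iSup]
  refine iSup_le fun ht => ?_
  have key : (v.toReal : ℂ) * bilinearAverage μ t b g x =
      ∫ u in U, bilinearAverage μ t (fun y => cellShift j b u y - cellShift j b u (y - u)) g x := by
    unfold bilinearAverage
    rw [integral_integral_swap, ← integral_const_mul]
    · refine integral_congr_ae (Eventually.of_forall fun w => ?_)
      simp only
      rw [integral_mul_const, hI, mul_assoc]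
    · refine Integrable.of_bound (C := (M + M) * N) ?_ (Eventually.of_forall fun p => ?_)
      · apply Measurable.aestronglyMeasurable
        simp only [Function.uncurry_def]
        refine Measurable.mul ?_ (hgm.comp (by fun_prop))
        exact hmV.comp (measurable_fst.prodMk (by fun_prop))
      · simp only [Function.uncurry_def, norm_mul]
        have hM0 : 0 ≤ M := (norm_nonneg _).trans (hM 0)
        exact mul_le_mul ((norm_sub_le _ _).trans (add_le_add (hcs _ _) (hcs _ _))) (hN _)
          (norm_nonneg _) (by positivity)
  calc v * ‖bilinearAverage μ t b g x‖ₑ = ‖(v.toReal : ℂ) * bilinearAverage μ t b g x‖ₑ := by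
        rw [enorm_mul]
        congr 1
        rw [← ofReal_norm, Complex.norm_real, Real.norm_of_nonneg ENNReal.toReal_nonneg,
          ENNReal.ofReal_toReal hvt]
    _ ≤ _ := by
        rw [key]
        refine (enorm_integral_le_lintegral_enorm _).trans (lintegral_mono fun u => ?_)
        exact le_iSup₂ (f := fun t (_ : t ∈ E) => ‖bilinearAverage μ t
          (fun y => cellShift j b u y - cellShift j b u (y - u)) g x‖ₑ) t ht

/-- A gain for translation differences yields a gain for functions whose means over the cells of a
given scale vanish. -/
theorem pairing_mean_zero_gain (hE : E.Countable) {p q s ε : ℝ} {C : ℝ≥0} (hp : 0 < p)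
    (hε : 0 < ε)
    (hC : ∀ (u : Rd d) (f g h : Rd d → ℂ), IsBddCompact f → IsBddCompact g → IsBddCompact h →
      pairing μ E (fun y => f y - f (y - u)) g h ≤
        C * ENNReal.ofReal (‖u‖ ^ ε) * lpn p f * lpn q g * lpn s h) :
    ∃ C' : ℝ≥0, ∀ (j : ℤ) (b g h : Rd d → ℂ), IsBddCompact b → IsBddCompact g → IsBddCompact h →
      (∀ n, ∫ y in cell j n, b y = 0) →
      pairing μ E b g h ≤ C' * (2 : ℝ≥0∞) ^ ((j : ℝ) * ε) * lpn p b * lpn q g * lpn s h := by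
  have hB : volume (Metric.closedBall (0 : Rd d) d) ≠ ∞ := measure_closedBall_lt_top.ne
  refine ⟨(volume (Metric.closedBall (0 : Rd d) d)).toNNReal * (C * Real.toNNReal (d ^ ε)),
    fun j b g h hb hg hh h0 => ?_⟩
  set U := Metric.closedBall (0 : Rd d) (d * 2 ^ j) with hUdef
  set v := (2 : ℝ≥0∞) ^ ((j : ℝ) * d) with hv
  have h2 : (0 : ℝ) < 2 ^ j := by positivity
  -- The ball of shifts is a fixed multiple of the cell volume `v`, so `v` cancels against the
  -- normalization of the average.
  have hU : volume U = v * volume (Metric.closedBall (0 : Rd d) d) := by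
    rw [hUdef, mul_comm, Measure.addHaar_closedBall_mul volume 0 h2.le (by positivity)]
    congr 1
    rw [finrank_euclideanSpace, Fintype.card_fin, ENNReal.ofReal_pow h2.le, ofReal_two_zpow, hv,
      ENNReal.rpow_mul, ENNReal.rpow_natCast]
  have hmV := measurable_cellShift_sub j hb.1
  have step : v * pairing μ E b g h ≤ ∫⁻ u in U,
      pairing μ E (fun y => cellShift j b u y - cellShift j b u (y - u)) g h := by
    unfold pairing
    rw [lintegral_lintegral_swap, ← lintegral_const_mul' _ _ (two_rpow_ne_top _)]
    · refine lintegral_mono fun x => ?_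
      rw [← mul_assoc, lintegral_mul_const' _ _ enorm_ne_top]
      exact mul_le_mul_left (averageMax_le_lintegral_cellShift j hb hg h0 x) _
    · apply Measurable.aemeasurable
      refine Measurable.mul ?_ (hh.1.enorm.comp measurable_snd)
      refine Measurable.biSup E hE fun t _ => Measurable.enorm ?_
      refine measurable_bilinearAverage μ
        (F := fun (p : Rd d × Rd d) y => cellShift j b p.1 y - cellShift j b p.1 (y - p.1))
        (G := fun _ => g) ?_ (hg.1.comp measurable_snd) t measurable_snd
      exact hmV.comp ((measurable_fst.comp measurable_fst).prodMk measurable_snd)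
  have bound : ∀ u ∈ U, pairing μ E (fun y => cellShift j b u y - cellShift j b u (y - u)) g h ≤
      C * (Real.toNNReal (d ^ ε) * (2 : ℝ≥0∞) ^ ((j : ℝ) * ε)) * lpn p b * lpn q g * lpn s h := by
    intro u hu
    refine (hC u _ g h (isBddCompact_cellShift j hb u) hg hh).trans ?_
    have : ENNReal.ofReal (‖u‖ ^ ε) ≤ Real.toNNReal (d ^ ε) * (2 : ℝ≥0∞) ^ ((j : ℝ) * ε) := by
      rw [ENNReal.rpow_mul, ← ofReal_two_zpow, ENNReal.ofReal_rpow_of_pos h2]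
      change _ ≤ ENNReal.ofReal _ * _
      rw [← ENNReal.ofReal_mul (by positivity), ← Real.mul_rpow (by positivity) h2.le]
      exact ENNReal.ofReal_le_ofReal (Real.rpow_le_rpow (norm_nonneg _)
        (mem_closedBall_zero_iff.1 hu) hε.le)
    have h2 : lpn p (cellShift j b u) ≤ lpn p b := lpn_mono hp.le fun x => by
      unfold cellShift; exact enorm_indicator_le_enorm_self _ _
    gcongr
  have h3 : v * pairing μ E b g h ≤ v * (volume (Metric.closedBall (0 : Rd d) d) *
      (C * (Real.toNNReal (d ^ ε) * (2 : ℝ≥0∞) ^ ((j : ℝ) * ε)) * lpn p b * lpn q g *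
        lpn s h)) := by
    refine step.trans ((setLIntegral_mono measurable_const bound).trans_eq ?_)
    rw [setLIntegral_const, hU]
    ring
  refine ((ENNReal.mul_le_mul_iff_right (two_rpow_ne_zero _) (two_rpow_ne_top _)).1 h3).trans_eq ?_
  push_cast
  rw [ENNReal.coe_toNNReal hB]
  ring

end cancellation

/-! ### Transfer to all dyadic scales. -/

/-- The dilate of a set of parameters by `2 ^ l`. -/
def scaleSet (E : Set ℝ) (l : ℤ) : Set ℝ := (fun t => t * (2 : ℝ) ^ l) '' E

section scaling

variable {d : ℕ}

lemma bilinearAverage_scale (μ : Measure (Rd d × Rd d)) (t c : ℝ) (f g : Rd d → ℂ) (x : Rd d) :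
    bilinearAverage μ (t * c) f g (c • x) =
      bilinearAverage μ t (fun y => f (c • y)) (fun y => g (c • y)) x := by
  simp only [bilinearAverage, smul_sub, smul_smul, mul_comm t c]

lemma averageMax_scaleSet (μ : Measure (Rd d × Rd d)) (E : Set ℝ) (l : ℤ) (f g : Rd d → ℂ)
    (x : Rd d) : averageMax μ (scaleSet E l) f g ((2 : ℝ) ^ l • x) =
      averageMax μ E (fun y => f ((2 : ℝ) ^ l • y)) (fun y => g ((2 : ℝ) ^ l • y)) x := by
  simp only [averageMax, scaleSet, iSup_image, bilinearAverage_scale]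

lemma lintegral_scale (l : ℤ) {F : Rd d → ℝ≥0∞} (hF : Measurable F) :
    ∫⁻ x, F ((2 : ℝ) ^ l • x) = (2 : ℝ≥0∞) ^ (-((l : ℝ) * d)) * ∫⁻ x, F x := by
  have h2 : (0 : ℝ) < 2 ^ l := by positivity
  have h := lintegral_map (μ := (volume : Measure (Rd d))) hF (measurable_const_smul ((2 : ℝ) ^ l))
  rw [← h, Measure.map_addHaar_smul volume h2.ne', lintegral_smul_measure, smul_eq_mul,
    finrank_euclideanSpace, Fintype.card_fin, abs_of_pos (by positivity),
    ENNReal.ofReal_inv_of_pos (by positivity), ENNReal.ofReal_pow h2.le, ofReal_two_zpow,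
    ENNReal.rpow_neg, ENNReal.rpow_mul, ENNReal.rpow_natCast]

lemma lpn_scale (l : ℤ) {p : ℝ} (hp : 0 ≤ p) {f : Rd d → ℂ} (hf : Measurable f) :
    lpn p (fun y => f ((2 : ℝ) ^ l • y)) = (2 : ℝ≥0∞) ^ (-((l : ℝ) * d) / p) * lpn p f := by
  unfold lpn
  rw [lintegral_scale l (F := fun x => ‖f x‖ₑ ^ p) (hf.enorm.pow_const p),
    ENNReal.mul_rpow_of_nonneg _ _ (by positivity), ← ENNReal.rpow_mul]
  congr 2; ring

lemma IsBddCompact.scale {f : Rd d → ℂ} (hf : IsBddCompact f) (l : ℤ) :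
    IsBddCompact (fun y => f ((2 : ℝ) ^ l • y)) := by
  obtain ⟨h1, M, h2, h3⟩ := hf
  have hl : (0 : ℝ) < 2 ^ l := by positivity
  refine ⟨h1.comp (by fun_prop), max M (M / 2 ^ l), fun x => (h2 _).trans (le_max_left _ _),
    fun x hx => h3 _ ?_⟩
  rw [norm_smul, Real.norm_of_nonneg hl.le]
  have := (le_max_right _ _).trans_lt hx
  rwa [div_lt_iff₀ hl, mul_comm] at this

lemma idx_scale (j l : ℤ) (x : Rd d) : idx j ((2 : ℝ) ^ l • x) = idx (j - l) x := by
  ext i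
  simp only [idx, PiLp.smul_apply, smul_eq_mul]
  rw [zpow_sub₀ (by norm_num)]
  congr 1
  field_simp

lemma integral_cell_scale (j l : ℤ) (b : Rd d → ℂ) (h0 : ∀ n, ∫ y in cell j n, b y = 0)
    (n : Fin d → ℤ) : ∫ y in cell (j - l) n, b ((2 : ℝ) ^ l • y) = 0 := by
  have e : (cell (j - l) n).indicator (fun y => b ((2 : ℝ) ^ l • y)) =
      fun y => (cell j n).indicator b ((2 : ℝ) ^ l • y) := by
    ext y
    have : y ∈ cell (j - l) n ↔ (2 : ℝ) ^ l • y ∈ cell j n := by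
      simp only [cell, Set.mem_ofPred_eq, idx_scale]
    by_cases h : y ∈ cell (j - l) n
    · rw [Set.indicator_of_mem h, Set.indicator_of_mem (this.1 h)]
    · rw [Set.indicator_of_notMem h, Set.indicator_of_notMem (fun h' => h (this.2 h'))]
  rw [← integral_indicator (measurableSet_cell _ _), e,
    Measure.integral_comp_smul volume (fun y => (cell j n).indicator b y),
    integral_indicator (measurableSet_cell _ _), h0, smul_zero]

lemma pairing_scaleSet {μ : Measure (Rd d × Rd d)} [IsFiniteMeasure μ] {E : Set ℝ}
    (hE : E.Countable) (l : ℤ) {f g h : Rd d → ℂ} (hf : Measurable f) (hg : Measurable g)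
    (hh : Measurable h) :
    pairing μ (scaleSet E l) f g h = (2 : ℝ≥0∞) ^ ((l : ℝ) * d) *
      pairing μ E (fun y => f ((2 : ℝ) ^ l • y)) (fun y => g ((2 : ℝ) ^ l • y))
        (fun y => h ((2 : ℝ) ^ l • y)) := by
  unfold pairing
  simp only [← averageMax_scaleSet]
  rw [lintegral_scale l (F := fun x => averageMax μ (scaleSet E l) f g x * ‖h x‖ₑ), ← mul_assoc,
    ← two_rpow_add, add_neg_cancel, ENNReal.rpow_zero, one_mul]
  exact (measurable_averageMax μ (hE.image _) hf hg).mul hh.enorm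

/-- The change of variables contributes `2^(ld)` and each norm of exponent `e` contributes
`2^(-ld/e)`. For `s` dual to `r` the total exponent is `ld(1/r - 1/p - 1/q)`. -/
lemma pairing_scaleSet_le {μ : Measure (Rd d × Rd d)} [IsFiniteMeasure μ] {E : Set ℝ}
    (hE : E.Countable) (l : ℤ) {p q s : ℝ} (hp : 0 ≤ p) (hq : 0 ≤ q) (hs : 0 ≤ s) {C : ℝ≥0∞}
    {f g h : Rd d → ℂ} (hf : Measurable f) (hg : Measurable g) (hh : Measurable h)
    (hC : pairing μ E (fun y => f ((2 : ℝ) ^ l • y)) (fun y => g ((2 : ℝ) ^ l • y))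
        (fun y => h ((2 : ℝ) ^ l • y)) ≤ C * lpn p (fun y => f ((2 : ℝ) ^ l • y)) *
          lpn q (fun y => g ((2 : ℝ) ^ l • y)) * lpn s (fun y => h ((2 : ℝ) ^ l • y))) :
    pairing μ (scaleSet E l) f g h ≤
      C * (2 : ℝ≥0∞) ^ ((l : ℝ) * (d * (1 - 1 / p - 1 / q - 1 / s))) * lpn p f *
        lpn q g * lpn s h := by
  rw [pairing_scaleSet hE l hf hg hh]
  rw [lpn_scale l hp hf, lpn_scale l hq hg, lpn_scale l hs hh] at hC
  refine (mul_le_mul_right hC _).trans_eq ?_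
  have : (l : ℝ) * (d * (1 - 1 / p - 1 / q - 1 / s)) = (l : ℝ) * d + (-((l : ℝ) * d) / p +
    (-((l : ℝ) * d) / q + -((l : ℝ) * d) / s)) := by ring
  rw [this, two_rpow_add, two_rpow_add, two_rpow_add]
  ring

end scaling

/-- A family of parameter sets, one for every dyadic scale, whose averages live at that scale and
satisfy scale invariant bounds, with a gain for functions without low frequencies. -/
structure IsLocalizedFamily {d : ℕ} (μ : Measure (Rd d × Rd d)) (A : ℤ → Set ℝ)
    (p q r ε : ℝ) (C : ℝ≥0) : Prop where
  countable : ∀ k, (A k).Countable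
  support : ∀ k, ∀ t ∈ A k, ∀ᵐ w ∂μ, ‖t • w.1‖ ≤ 2 ^ k ∧ ‖t • w.2‖ ≤ 2 ^ k
  bound : ∀ (k : ℤ) (f g h : Rd d → ℂ), IsBddCompact f → IsBddCompact g → IsBddCompact h →
    pairing μ (A k) f g h ≤ C * (2 : ℝ≥0∞) ^ ((k : ℝ) * (d * (1 / r - 1 / p - 1 / q))) *
      lpn p f * lpn q g * lpn (r / (r - 1)) h
  gain_left : ∀ (k j : ℤ) (f g h : Rd d → ℂ), j ≤ k → IsBddCompact f → IsBddCompact g →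
    IsBddCompact h → (∀ n, ∫ y in cell j n, f y = 0) →
    pairing μ (A k) f g h ≤ C * (2 : ℝ≥0∞) ^ (((j : ℝ) - k) * ε) *
      (2 : ℝ≥0∞) ^ ((k : ℝ) * (d * (1 / r - 1 / p - 1 / q))) *
      lpn p f * lpn q g * lpn (r / (r - 1)) h
  gain_right : ∀ (k j : ℤ) (f g h : Rd d → ℂ), j ≤ k → IsBddCompact f → IsBddCompact g →
    IsBddCompact h → (∀ n, ∫ y in cell j n, g y = 0) →
    pairing μ (A k) f g h ≤ C * (2 : ℝ≥0∞) ^ (((j : ℝ) - k) * ε) *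
      (2 : ℝ≥0∞) ^ ((k : ℝ) * (d * (1 / r - 1 / p - 1 / q))) *
      lpn p f * lpn q g * lpn (r / (r - 1)) h

/-- Scale invariant bounds near an interior point of the improving region. -/
theorem exists_isLocalizedFamily {d : ℕ} {E E' : Set ℝ} (hE : E ⊆ Set.Icc 1 2) (hE' : E' ⊆ E)
    (hE'c : E'.Countable) {β : ℝ} (hβ : upperMinkowskiDim E = (β : EReal))
    {μ : Measure (Rd d × Rd d)} [IsFiniteMeasure μ] (hμ : IsCompactlySupported μ) {a : ℝ}
    (ha : IsAdmissible μ a) (haβ : (d : ℝ) + β < 2 * a) {p q r : ℝ}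
    (h : (1 / p, 1 / q, 1 / r) ∈ interior (improvingRegion μ E)) (hr : 1 < r) :
    1 ≤ p ∧ 1 ≤ q ∧ ∃ (c : ℤ) (ε : ℝ) (C : ℝ≥0), 0 < ε ∧
      IsLocalizedFamily μ (fun k => scaleSet E' (k - c)) p q r ε C := by
  obtain ⟨p₁, p₂, q₁, q₂, s₁, s₂, C₀, hp₁, h₁, h₂, hq₁, h₃, h₄, hs₁, h₅, h₆, B₀, B₁, B₂, B₃, B₄,
    B₅, B₆⟩ := exists_neighbour_bounds hE' hE'c h hr
  refine ⟨by linarith, by linarith, ?_⟩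
  set s := r / (r - 1) with hs
  have hr1 : 0 < r - 1 := by linarith
  have hr0 : 0 < r := by linarith
  have hθ : ∀ l : ℝ, l * (d * (1 - 1 / p - 1 / q - 1 / s)) = l * (d * (1 / r - 1 / p - 1 / q)) := by
    intro l; rw [hs]; field_simp; ring
  have : IsFiniteMeasure (μ.map Prod.swap) := inferInstance
  obtain ⟨ε₁, hε₁, C₁, hC₁⟩ := l2_translation_bound hE hE' hE'c hβ hμ ha haβ
  -- The gain in the second input is the gain in the first for the measure with exchanged factors,
  -- which satisfies the same hypotheses.
  obtain ⟨ε₂, hε₂, C₂, hC₂⟩ := l2_translation_bound hE hE' hE'c hβ hμ.swap ha.swap haβ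
  obtain ⟨ε₃, hε₃, C₃, hC₃⟩ := pairing_translation_gain hE'c hp₁ h₁ h₂ (by linarith) h₃ h₄ hs₁ h₅ h₆
    hε₁ B₀ B₁ B₂ B₃ B₄ B₅ B₆ hC₁
  obtain ⟨ε₄, hε₄, C₄, hC₄⟩ := pairing_translation_gain hE'c hq₁ h₃ h₄ (by linarith) h₁ h₂ hs₁ h₅ h₆
    hε₂ B₀.swap B₃.swap B₄.swap B₁.swap B₂.swap B₅.swap B₆.swap hC₂
  have hp : 0 < p := by linarith
  have hq : 0 < q := by linarith
  have hs0 : 0 < s := by linarith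
  obtain ⟨C₅, hC₅⟩ := pairing_mean_zero_gain hE'c hp hε₃ hC₃
  obtain ⟨C₆, hC₆⟩ := pairing_mean_zero_gain hE'c hq hε₄ hC₄
  obtain ⟨R, hR, hsupp⟩ := hμ.exists_radius
  -- Parameters lie in `[1, 2]` and `μ` lives within radius `R`, so shifting the scale index by `c`
  -- makes the averages of index `k` move points by at most `2^k`.
  obtain ⟨c, hc⟩ : ∃ c : ℕ, 2 * R ≤ 2 ^ c := by
    obtain ⟨c, hc⟩ := pow_unbounded_of_one_lt (2 * R) (one_lt_two)
    exact ⟨c, hc.le⟩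
  set D : ℝ := d * (1 / r - 1 / p - 1 / q)
  set T : ℝ → ℝ≥0 := fun x => ((2 : ℝ≥0∞) ^ x).toNNReal with hT
  have hTc : ∀ x, (T x : ℝ≥0∞) = 2 ^ x := fun x => ENNReal.coe_toNNReal (two_rpow_ne_top x)
  have hT1 : ∀ x, (2 : ℝ≥0∞) ^ x = T x := fun x => (hTc x).symm
  have hsplit : ∀ k : ℤ, (2 : ℝ≥0∞) ^ (((k - c : ℤ) : ℝ) * D) = T (-(c * D)) * 2 ^ ((k : ℝ) * D) := by
    intro k
    rw [hTc, ← two_rpow_add]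
    congr 1; push_cast; ring
  -- For `j ≤ k` the smaller of the two gains is the weaker bound, so it serves for both inputs. The
  -- index shift by `c` goes into the constant.
  have hgain : ∀ {k j : ℤ} {ε' : ℝ}, j ≤ k → min ε₃ ε₄ ≤ ε' →
      (2 : ℝ≥0∞) ^ (((j - (k - c) : ℤ) : ℝ) * ε') ≤
        T (c * ε') * 2 ^ (((j : ℝ) - k) * min ε₃ ε₄) := by
    intro k j ε' hjk hε'
    rw [hTc, ← two_rpow_add]
    refine ENNReal.rpow_le_rpow_of_exponent_le (by norm_num) ?_
    push_cast
    have : (j : ℝ) ≤ k := by exact_mod_cast hjk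
    nlinarith
  refine ⟨c, min ε₃ ε₄, T (-(c * D)) * (C₀ + C₅ * T (c * ε₃) + C₆ * T (c * ε₄)),
    lt_min hε₃ hε₄, ⟨fun k => hE'c.image _, ?_, ?_, ?_, ?_⟩⟩
  · rintro k _ ⟨t, ht, rfl⟩
    filter_upwards [hsupp] with w hw
    have ht2 := hE (hE' ht)
    have key : ∀ y : Rd d, ‖y‖ ≤ R → ‖(t * (2 : ℝ) ^ (k - (c : ℤ))) • y‖ ≤ 2 ^ k := by
      intro y hy
      have h2 : (0 : ℝ) < 2 ^ (k - (c : ℤ)) := by positivity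
      have h3 : (2 : ℝ) ^ k = 2 ^ (k - (c : ℤ)) * 2 ^ c := by
        rw [← zpow_natCast, ← zpow_add₀ (by norm_num)]; simp
      rw [norm_smul, norm_mul, Real.norm_of_nonneg (by linarith [ht2.1]),
        Real.norm_of_nonneg h2.le, h3]
      have : t * ‖y‖ ≤ 2 * R := mul_le_mul ht2.2 hy (norm_nonneg _) (by norm_num)
      calc _ = 2 ^ (k - (c : ℤ)) * (t * ‖y‖) := by ring
        _ ≤ _ := by gcongr; linarith
    exact ⟨key _ hw.1, key _ hw.2⟩
  · intro k f g h hf hg hh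
    refine (pairing_scaleSet_le hE'c (k - c) hp.le hq.le hs0.le hf.1 hg.1 hh.1
      (B₀ _ _ _ (hf.scale _) (hg.scale _) (hh.scale _))).trans ?_
    rw [hθ, hsplit]
    gcongr ?_ * _ * _ * _
    rw [← mul_assoc]
    gcongr
    rw [mul_comm]
    push_cast
    gcongr
    rw [add_assoc]
    exact le_self_add
  · intro k j f g h hjk hf hg hh h0
    refine (pairing_scaleSet_le hE'c (k - c) hp.le hq.le hs0.le hf.1 hg.1 hh.1
      (hC₅ (j - (k - c)) _ _ _ (hf.scale _) (hg.scale _) (hh.scale _)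
        (integral_cell_scale j _ f h0))).trans ?_
    rw [hθ, hsplit]
    gcongr ?_ * _ * _ * _
    calc _ ≤ C₅ * (T (c * ε₃) * (2 : ℝ≥0∞) ^ (((j : ℝ) - k) * min ε₃ ε₄)) *
          (T (-(c * D)) * 2 ^ ((k : ℝ) * D)) := by
          gcongr; exact hgain hjk (min_le_left _ _)
      _ = (T (-(c * D)) * (C₅ * T (c * ε₃))) * 2 ^ (((j : ℝ) - k) * min ε₃ ε₄) *
          2 ^ ((k : ℝ) * D) := by ring
      _ ≤ _ := by
          gcongr
          push_cast
          gcongr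
          rw [add_right_comm]
          exact le_add_self
  · intro k j f g h hjk hf hg hh h0
    have e : ∀ E'' f g h, pairing (μ.map Prod.swap) E'' g f h = pairing μ E'' f g h := by
      intro E'' f g h; simp only [pairing, averageMax_swap]
    refine (pairing_scaleSet_le hE'c (k - c) hp.le hq.le hs0.le hf.1 hg.1 hh.1
      (C := C₆ * 2 ^ (((j - (k - c) : ℤ) : ℝ) * ε₄)) ?_).trans ?_
    · rw [← e]
      refine (hC₆ (j - (k - c)) _ _ _ (hg.scale _) (hf.scale _) (hh.scale _)
        (integral_cell_scale j _ g h0)).trans_eq ?_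
      ring
    rw [hθ, hsplit]
    gcongr ?_ * _ * _ * _
    calc _ ≤ C₆ * (T (c * ε₄) * (2 : ℝ≥0∞) ^ (((j : ℝ) - k) * min ε₃ ε₄)) *
          (T (-(c * D)) * 2 ^ ((k : ℝ) * D)) := by
          gcongr; exact hgain hjk (min_le_right _ _)
      _ = (T (-(c * D)) * (C₆ * T (c * ε₄))) * 2 ^ (((j : ℝ) - k) * min ε₃ ε₄) *
          2 ^ ((k : ℝ) * D) := by ring
      _ ≤ _ := by
          gcongr
          push_cast
          gcongr
          exact le_add_self

/-! ### Heavy cells, stopping times and sparseness. -/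

/-- Dyadic cubes, given by scale and index. -/
abbrev DyadicCube (d : ℕ) : Type := ℤ × (Fin d → ℤ)

/-- Equality or adjacency of the indices of two cells of the same scale. -/
def Near {d : ℕ} (m n : Fin d → ℤ) : Prop := ∀ i, |m i - n i| ≤ 1

section dyadic

variable {d : ℕ}

lemma idx_succ (k : ℤ) (x : Rd d) (i : Fin d) : idx (k + 1) x i = idx k x i / 2 := by
  simp only [idx]
  rw [zpow_add_one₀ (by norm_num), ← div_div]
  exact_mod_cast Int.floor_div_natCast (x i / 2 ^ k) 2

lemma idx_eq_of_le {k k' : ℤ} {x y : Rd d} (h : idx k x = idx k y) (hk : k ≤ k') :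
    idx k' x = idx k' y := by
  induction k', hk using Int.leInduction with
  | base => exact h
  | succ m hm ih => ext i; rw [idx_succ, idx_succ, ih]

lemma Near.symm {m n : Fin d → ℤ} (h : Near m n) : Near n m := fun i => by
  rw [abs_sub_comm]; exact h i

lemma near_self (m : Fin d → ℤ) : Near m m := fun i => by simp

/-- Passing to the parent halves the indices, and halving with floor keeps integers at distance at
most 1 within distance 1. -/
lemma near_of_le {k k' : ℤ} {x y : Rd d} (h : Near (idx k x) (idx k y)) (hk : k ≤ k') :
    Near (idx k' x) (idx k' y) := by
  induction k', hk using Int.leInduction with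
  | base => exact h
  | succ m hm ih =>
    intro i
    have := ih i
    rw [idx_succ, idx_succ]
    rw [abs_le] at this ⊢
    omega

/-- The lower corner of a cell. -/
def cellPt (k : ℤ) (n : Fin d → ℤ) : Rd d := WithLp.toLp 2 fun i => n i * 2 ^ k

@[simp] lemma idx_cellPt (k : ℤ) (n : Fin d → ℤ) : idx k (cellPt k n) = n := by
  ext i
  have h2 : (2 : ℝ) ^ k ≠ 0 := by positivity
  simp [idx, cellPt, mul_div_cancel_right₀ _ h2]

/-- The union of a dyadic cube and its neighbours. -/
def tri (Q : DyadicCube d) : Set (Rd d) := {x | Near (idx Q.1 x) Q.2}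

lemma measurableSet_idx (k : ℤ) (P : (Fin d → ℤ) → Prop) : MeasurableSet {x : Rd d | P (idx k x)} :=
  measurable_idx k (Set.to_countable {n | P n}).measurableSet

lemma measurableSet_tri (Q : DyadicCube d) : MeasurableSet (tri Q) :=
  measurableSet_idx Q.1 fun n => Near n Q.2

lemma cell_subset_tri (Q : DyadicCube d) : cell Q.1 Q.2 ⊆ tri Q := fun x hx => by
  rw [tri, Set.mem_ofPred_eq, show idx Q.1 x = Q.2 from hx]
  exact near_self _

/-- The cube which consists of a dyadic cube and its neighbours. -/
def triCube (Q : DyadicCube d) : Cube d where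
  corner := WithLp.toLp 2 fun i => ((Q.2 i : ℝ) - 1) * 2 ^ Q.1
  side := 3 * 2 ^ Q.1
  side_pos := by positivity

lemma toSet_triCube (Q : DyadicCube d) : (triCube Q).toSet = tri Q := by
  ext x
  have h2 : (0 : ℝ) < 2 ^ Q.1 := by positivity
  have hx : ∀ i, (idx Q.1 x i : ℝ) * 2 ^ Q.1 ≤ x i ∧ x i < (idx Q.1 x i : ℝ) * 2 ^ Q.1 + 2 ^ Q.1 :=
    mem_cell_iff.1 rfl
  simp only [Cube.toSet, triCube, tri, Near, Set.mem_ofPred_eq, idx]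
  refine forall_congr' fun i => ?_
  have e1 : ((Q.2 i : ℝ) - 1) * 2 ^ Q.1 ≤ x i ↔ Q.2 i - 1 ≤ ⌊x i / 2 ^ Q.1⌋ := by
    rw [Int.le_floor, le_div_iff₀ h2]; push_cast; rfl
  have e2 : x i < ((Q.2 i : ℝ) - 1) * 2 ^ Q.1 + 3 * 2 ^ Q.1 ↔ ⌊x i / 2 ^ Q.1⌋ < Q.2 i + 2 := by
    rw [Int.floor_lt, div_lt_iff₀ h2]; push_cast
    rw [show ((Q.2 i : ℝ) - 1) * 2 ^ Q.1 + 3 * 2 ^ Q.1 = (Q.2 i + 2) * 2 ^ Q.1 by ring]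
  rw [e1, e2, abs_le]
  omega

lemma volume_tri (Q : DyadicCube d) :
    volume (tri Q) = 3 ^ d * (2 : ℝ≥0∞) ^ ((Q.1 : ℝ) * d) := by
  rw [← toSet_triCube]
  refine (volume_box _ _).trans ?_
  simp only [triCube]
  rw [ENNReal.ofReal_mul (by norm_num), mul_pow, ofReal_two_zpow, ENNReal.rpow_mul,
    ENNReal.rpow_natCast]
  norm_num

lemma triCube_injective : Function.Injective (triCube (d := d)) := by
  rintro ⟨k, m⟩ ⟨k', m'⟩ h
  simp only [triCube, Cube.mk.injEq] at h
  have hk : k = k' := by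
    have : (2 : ℝ) ^ k = 2 ^ k' := by linarith [h.2]
    exact zpow_right_injective₀ (by norm_num) (by norm_num) this
  subst hk
  have h2 : (2 : ℝ) ^ k ≠ 0 := by positivity
  refine Prod.ext rfl (funext fun i => ?_)
  have := congrArg (fun v : Rd d => v i) h.1
  simp only [mul_eq_mul_right_iff, h2, or_false] at this
  exact_mod_cast (by linarith : (m i : ℝ) = m' i)

/-- The average of `F` over the cell of scale `k` with index `n` exceeds a fixed multiple of the
average of `F` over the threefold enlargement of `Q`. -/
def Heavy (F : Rd d → ℝ≥0∞) (Q : DyadicCube d) (k : ℤ) (n : Fin d → ℤ) : Prop :=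
  4 * 3 ^ d * (∫⁻ y in tri Q, F y) * (2 : ℝ≥0∞) ^ ((k : ℝ) * d) <
    (2 : ℝ≥0∞) ^ ((Q.1 : ℝ) * d) * ∫⁻ y in cell k n ∩ tri Q, F y

/-- `k` is the largest scale at which the cell containing `x` is heavy. -/
def MaxHeavy (F : Rd d → ℝ≥0∞) (Q : DyadicCube d) (k : ℤ) (x : Rd d) : Prop :=
  Heavy F Q k (idx k x) ∧ ∀ k', k < k' → ¬ Heavy F Q k' (idx k' x)

variable {F G : Rd d → ℝ≥0∞} {Q : DyadicCube d}

lemma two_rpow_mono {k k' : ℤ} (h : k ≤ k') :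
    (2 : ℝ≥0∞) ^ ((k : ℝ) * d) ≤ (2 : ℝ≥0∞) ^ ((k' : ℝ) * d) :=
  ENNReal.rpow_le_rpow_of_exponent_le (by norm_num) (by gcongr)

/-- At the scale of `Q` or above, the factor `4 * 3 ^ d ≥ 1` in the threshold rules out heaviness.
Hence a largest heavy scale exists as soon as there is a heavy one. -/
lemma Heavy.lt {k : ℤ} {n : Fin d → ℤ} (h : Heavy F Q k n) : k < Q.1 := by
  by_contra! hk
  refine absurd h (not_lt.2 ?_)
  calc (2 : ℝ≥0∞) ^ ((Q.1 : ℝ) * d) * ∫⁻ y in cell k n ∩ tri Q, F y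
      ≤ (2 : ℝ≥0∞) ^ ((k : ℝ) * d) * ∫⁻ y in tri Q, F y :=
        mul_le_mul' (two_rpow_mono hk) (lintegral_mono_set Set.inter_subset_right)
    _ = 1 * (∫⁻ y in tri Q, F y) * (2 : ℝ≥0∞) ^ ((k : ℝ) * d) := by ring
    _ ≤ _ := by
        gcongr
        have : (1 : ℝ≥0∞) ≤ 3 ^ d := one_le_pow_of_one_le' (by norm_num) d
        calc (1 : ℝ≥0∞) = 1 * 1 := by ring
          _ ≤ _ := mul_le_mul' (by norm_num) this

lemma Heavy.exists_maxHeavy {k : ℤ} {x : Rd d} (h : Heavy F Q k (idx k x)) :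
    ∃ k', k ≤ k' ∧ MaxHeavy F Q k' x := by
  obtain ⟨m, hm, hmax⟩ := Int.exists_greatest_of_bdd (P := fun m => Heavy F Q m (idx m x))
    ⟨Q.1, fun z hz => hz.lt.le⟩ ⟨k, h⟩
  exact ⟨m, hmax k h, hm, fun k' hk' h' => absurd (hmax k' h') (not_le.2 hk')⟩

lemma MaxHeavy.congr {k : ℤ} {x y : Rd d} (h : MaxHeavy F Q k x) (hxy : idx k x = idx k y) :
    MaxHeavy F Q k y :=
  ⟨hxy ▸ h.1, fun k' hk' => by rw [← idx_eq_of_le hxy hk'.le]; exact h.2 k' hk'⟩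

/-- This makes the bad functions of different scales disjointly supported. -/
lemma MaxHeavy.unique {k k' : ℤ} {x : Rd d} (h : MaxHeavy F Q k x) (h' : MaxHeavy F Q k' x) :
    k = k' := by
  rcases lt_trichotomy k k' with hk | hk | hk
  · exact absurd h'.1 (h.2 _ hk)
  · exact hk
  · exact absurd h.1 (h'.2 _ hk)

lemma measurableSet_maxHeavy (F : Rd d → ℝ≥0∞) (Q : DyadicCube d) (k : ℤ) :
    MeasurableSet {x | MaxHeavy F Q k x} := by
  have : {x | MaxHeavy F Q k x} = {x | MaxHeavy F Q k (cellPt k (idx k x))} := by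
    ext x
    exact ⟨fun h => h.congr (by simp), fun h => h.congr (by simp)⟩
  rw [this]
  exact measurableSet_idx k fun n => MaxHeavy F Q k (cellPt k n)

/-- A weak type (1,1) estimate: the maximal heavy cells are disjoint and together carry at most the
mass of `F` on `tri Q`. Including neighbours costs `3 ^ d`, which the threshold compensates, and its
remaining factor 4 leaves a quarter of the volume of `Q`. -/
lemma volume_heavy_le (hF : ∫⁻ x, F x ≠ ∞) :
    4 * volume {x : Rd d | ∃ k m, Near (idx k x) m ∧ Heavy F Q k m} ≤
      (2 : ℝ≥0∞) ^ ((Q.1 : ℝ) * d) := by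
  set I := ∫⁻ y in tri Q, F y with hI
  have hIt : I ≠ ∞ := ((setLIntegral_le_lintegral _ _).trans_lt hF.lt_top).ne
  set v := (2 : ℝ≥0∞) ^ ((Q.1 : ℝ) * d) with hv
  rcases eq_or_ne I 0 with h0 | h0
  · have : {x : Rd d | ∃ k m, Near (idx k x) m ∧ Heavy F Q k m} = ∅ := by
      rw [Set.eq_empty_iff_forall_notMem]
      rintro x ⟨k, m, -, h⟩
      have h1 : ∫⁻ y in cell k m ∩ tri Q, F y = 0 :=
        le_antisymm ((lintegral_mono_set Set.inter_subset_right).trans_eq h0) zero_le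
      rw [Heavy, h1, mul_zero] at h
      exact not_lt_zero h
    rw [this]; simp
  -- For a maximal heavy cell `P` this is the part of `P` inside `tri Q`. For any other cell it is
  -- empty.
  let V : DyadicCube d → Set (Rd d) := fun P => {x | x ∈ cell P.1 P.2 ∩ tri Q ∧ MaxHeavy F Q P.1 x}
  have hVm : ∀ P, MeasurableSet (V P) := fun P =>
    ((measurableSet_cell _ _).inter (measurableSet_tri _)).inter (measurableSet_maxHeavy _ _ _)
  have hVd : Pairwise (Function.onFun Disjoint V) := by
    intro P P' hPP
    refine Set.disjoint_left.2 fun x hx hx' => hPP ?_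
    have e := hx.2.unique hx'.2
    refine Prod.ext e ?_
    have h1 : idx P.1 x = P.2 := hx.1.1
    have h2 : idx P'.1 x = P'.2 := hx'.1.1
    rw [← h1, ← h2, e]
  -- The heavy neighbour of `x` sits in a maximal heavy cell, and ancestors of neighbours are
  -- neighbours.
  have hcov : {x : Rd d | ∃ k m, Near (idx k x) m ∧ Heavy F Q k m} ⊆
      ⋃ P : DyadicCube d, {x | x ∈ tri P ∧ MaxHeavy F Q P.1 (cellPt P.1 P.2)} := by
    rintro x ⟨k, m, hn, hm⟩
    have hm' : Heavy F Q k (idx k (cellPt k m)) := by rwa [idx_cellPt]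
    obtain ⟨k', hk', hM⟩ := hm'.exists_maxHeavy
    refine Set.mem_iUnion.2 ⟨(k', idx k' (cellPt k m)), ?_, hM.congr (by simp)⟩
    exact near_of_le (by rwa [idx_cellPt]) hk'
  have hP : ∀ P : DyadicCube d, 4 * 3 ^ d * I *
      volume {x | x ∈ tri P ∧ MaxHeavy F Q P.1 (cellPt P.1 P.2)} ≤
        3 ^ d * v * ∫⁻ y in V P, F y := by
    intro P
    by_cases hM : MaxHeavy F Q P.1 (cellPt P.1 P.2)
    · have e1 : {x | x ∈ tri P ∧ MaxHeavy F Q P.1 (cellPt P.1 P.2)} = tri P := by simp [hM]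
      have e2 : V P = cell P.1 P.2 ∩ tri Q := by
        ext x
        refine ⟨fun h => h.1, fun h => ⟨h, hM.congr ?_⟩⟩
        rw [idx_cellPt]; exact h.1.symm
      have h := hM.1
      rw [idx_cellPt, Heavy] at h
      rw [e1, e2, volume_tri]
      calc _ = 3 ^ d * (4 * 3 ^ d * I * (2 : ℝ≥0∞) ^ ((P.1 : ℝ) * d)) := by ring
        _ ≤ 3 ^ d * (v * ∫⁻ y in cell P.1 P.2 ∩ tri Q, F y) := by gcongr
        _ = _ := by ring
    · simp [hM]
  have hsum : 4 * 3 ^ d * I * volume {x : Rd d | ∃ k m, Near (idx k x) m ∧ Heavy F Q k m} ≤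
      3 ^ d * v * I := by
    calc _ ≤ 4 * 3 ^ d * I *
          ∑' P : DyadicCube d, volume {x | x ∈ tri P ∧ MaxHeavy F Q P.1 (cellPt P.1 P.2)} := by
          gcongr
          exact (measure_mono hcov).trans (measure_iUnion_le _)
      _ = ∑' P : DyadicCube d, 4 * 3 ^ d * I *
          volume {x | x ∈ tri P ∧ MaxHeavy F Q P.1 (cellPt P.1 P.2)} := ENNReal.tsum_mul_left.symm
      _ ≤ ∑' P : DyadicCube d, 3 ^ d * v * ∫⁻ y in V P, F y := ENNReal.tsum_le_tsum hP
      _ = 3 ^ d * v * ∫⁻ y in ⋃ P, V P, F y := by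
          rw [ENNReal.tsum_mul_left, lintegral_iUnion hVm hVd]
      _ ≤ _ := by
          gcongr
          exact lintegral_mono_set (Set.iUnion_subset fun P x hx => hx.1.2)
  have h3 : (3 : ℝ≥0∞) ^ d * I ≠ 0 := mul_ne_zero (by positivity) h0
  have h3t : (3 : ℝ≥0∞) ^ d * I ≠ ∞ := ENNReal.mul_ne_top (by simp) hIt
  refine (ENNReal.mul_le_mul_iff_right h3 h3t).1 ?_
  calc _ = 4 * 3 ^ d * I * volume {x : Rd d | ∃ k m, Near (idx k x) m ∧ Heavy F Q k m} := by ring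
    _ ≤ _ := hsum
    _ = _ := by ring

/-- The cells with a heavy neighbour. -/
def Stop (F G : Rd d → ℝ≥0∞) (Q : DyadicCube d) (k : ℤ) (n : Fin d → ℤ) : Prop :=
  ∃ m, Near n m ∧ (Heavy F Q k m ∨ Heavy G Q k m)

lemma Stop.lt {k : ℤ} {n : Fin d → ℤ} (h : Stop F G Q k n) : k < Q.1 := by
  obtain ⟨m, -, h | h⟩ := h <;> exact h.lt

/-- The cubes selected by the stopping time argument which starts at scale `K`. -/
inductive Sel (F G : Rd d → ℝ≥0∞) (K : ℤ) : DyadicCube d → Prop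
  | top (n : Fin d → ℤ) : Sel F G K (K, n)
  | child (Q : DyadicCube d) (k : ℤ) (x : Rd d) (hQ : Sel F G K Q) (hx : x ∈ cell Q.1 Q.2)
      (hk : Stop F G Q k (idx k x)) (hmax : ∀ k', k < k' → ¬ Stop F G Q k' (idx k' x)) :
      Sel F G K (k, idx k x)

/-- The points of a cube which belong to no stopping cell. -/
def core (F G : Rd d → ℝ≥0∞) (Q : DyadicCube d) : Set (Rd d) :=
  {x | x ∈ cell Q.1 Q.2 ∧ ∀ k, ¬ Stop F G Q k (idx k x)}

lemma measurableSet_core (F G : Rd d → ℝ≥0∞) (Q : DyadicCube d) : MeasurableSet (core F G Q) := by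
  have : core F G Q = cell Q.1 Q.2 ∩ ⋂ k, {x | ¬ Stop F G Q k (idx k x)} := by
    ext x; simp [core]
  rw [this]
  exact (measurableSet_cell _ _).inter
    (MeasurableSet.iInter fun k => measurableSet_idx k fun n => ¬ Stop F G Q k n)

/-- Each of the two functions removes at most a quarter of the cube. -/
lemma volume_core_ge (hF : ∫⁻ x, F x ≠ ∞) (hG : ∫⁻ x, G x ≠ ∞) (Q : DyadicCube d) :
    (2 : ℝ≥0∞) ^ ((Q.1 : ℝ) * d) ≤ 2 * volume (core F G Q) := by
  set v := (2 : ℝ≥0∞) ^ ((Q.1 : ℝ) * d) with hv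
  have hvt : v ≠ ∞ := two_rpow_ne_top _
  set a := volume {x : Rd d | ∃ k m, Near (idx k x) m ∧ Heavy F Q k m}
  set b := volume {x : Rd d | ∃ k m, Near (idx k x) m ∧ Heavy G Q k m}
  have ha : 4 * a ≤ v := volume_heavy_le hF
  have hb : 4 * b ≤ v := volume_heavy_le hG
  have hsub : cell Q.1 Q.2 ⊆ core F G Q ∪
      ({x : Rd d | ∃ k m, Near (idx k x) m ∧ Heavy F Q k m} ∪
        {x : Rd d | ∃ k m, Near (idx k x) m ∧ Heavy G Q k m}) := by
    intro x hx
    by_cases h : ∀ k, ¬ Stop F G Q k (idx k x)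
    · exact Or.inl ⟨hx, h⟩
    · push Not at h
      obtain ⟨k, m, hm, h | h⟩ := h
      · exact Or.inr (Or.inl ⟨k, m, hm, h⟩)
      · exact Or.inr (Or.inr ⟨k, m, hm, h⟩)
  have h1 : v ≤ volume (core F G Q) + (a + b) := by
    rw [hv, ← volume_cell Q.1 Q.2]
    refine (measure_mono hsub).trans ((measure_union_le _ _).trans ?_)
    gcongr
    exact measure_union_le _ _
  have h2 : v + v ≤ 2 * volume (core F G Q) + v := by
    have : 4 * (a + b) ≤ v + v := by rw [mul_add]; exact add_le_add ha hb
    have h3 : 2 * (a + b) ≤ v := by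
      refine (ENNReal.mul_le_mul_iff_right (a := 2) (by norm_num) (by norm_num)).1 ?_
      calc _ = 4 * (a + b) := by ring
        _ ≤ _ := this
        _ = _ := by ring
    calc v + v ≤ 2 * (volume (core F G Q) + (a + b)) := by rw [two_mul]; gcongr
      _ = 2 * volume (core F G Q) + 2 * (a + b) := by ring
      _ ≤ _ := by gcongr
  exact (ENNReal.add_le_add_iff_right hvt).1 h2

lemma Sel.scale_le {K : ℤ} (h : Sel F G K Q) : Q.1 ≤ K := by
  induction h with
  | top n => exact le_rfl
  | child Q k x hQ hx hk hmax ih => exact hk.lt.le.trans ih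

/-- A smaller selected cube can reach a point of a larger one only by way of a stopping cell of the
larger cube. This is what makes the cores disjoint. The induction replaces one of the two cubes by a
cube higher up. -/
lemma Sel.exists_stop {K : ℤ} {Q Q' : DyadicCube d} (hQ : Sel F G K Q) (hQ' : Sel F G K Q')
    {x : Rd d} (hx : x ∈ cell Q.1 Q.2) (hx' : x ∈ cell Q'.1 Q'.2) (hlt : Q'.1 < Q.1) :
    ∃ k, Q'.1 ≤ k ∧ Stop F G Q k (idx k x) := by
  obtain ⟨N, hN⟩ : ∃ N : ℕ, (K - Q'.1).toNat = N := ⟨_, rfl⟩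
  induction N using Nat.strong_induction_on generalizing Q Q' with
  | _ N ih =>
  cases hQ' with
  | top n => exact absurd hQ.scale_le (not_le.2 hlt)
  | child P k y hP hy hk hmax =>
    simp only at hlt hx' hN ⊢
    have hkP := hk.lt
    have hPK := hP.scale_le
    have hQK := hQ.scale_le
    have hxy : idx k x = idx k y := hx'
    have hxP : x ∈ cell P.1 P.2 := by
      rw [cell, Set.mem_ofPred_eq, idx_eq_of_le hxy hkP.le]; exact hy
    -- The parent `P` of `Q'` is compared with `Q`. If `P` is smaller, the induction applies to `P`
    -- inside `Q`. If they coincide, `Q'` is itself the stopping cell. If `P` is larger, then `Q`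
    -- would lie in a stopping cell of `P` larger than `Q'`, against the maximality of `Q'`.
    rcases lt_trichotomy P.1 Q.1 with h | h | h
    · obtain ⟨k', hk', hs⟩ := ih _ (by omega) hQ hP hx hxP h rfl
      exact ⟨k', by omega, hs⟩
    · have : P = Q := by
        refine Prod.ext h ?_
        rw [← show idx P.1 x = P.2 from hxP, ← show idx Q.1 x = Q.2 from hx, h]
      subst this
      exact ⟨k, le_rfl, hxy ▸ hk⟩
    · obtain ⟨k', hk', hs⟩ := ih _ (by omega) hP hQ hxP hx h rfl
      rw [idx_eq_of_le hxy (by omega)] at hs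
      exact absurd hs (hmax k' (by omega))

lemma Sel.disjoint_core {K : ℤ} {Q Q' : DyadicCube d} (hQ : Sel F G K Q) (hQ' : Sel F G K Q')
    (hne : Q ≠ Q') : Disjoint (core F G Q) (core F G Q') := by
  refine Set.disjoint_left.2 fun x hx hx' => ?_
  rcases lt_trichotomy Q.1 Q'.1 with h | h | h
  · obtain ⟨k, -, hs⟩ := hQ'.exists_stop hQ hx'.1 hx.1 h
    exact hx'.2 k hs
  · refine hne (Prod.ext h ?_)
    rw [← show idx Q.1 x = Q.2 from hx.1, ← show idx Q'.1 x = Q'.2 from hx'.1, h]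
  · obtain ⟨k, -, hs⟩ := hQ.exists_stop hQ' hx.1 hx'.1 h
    exact hx.2 k hs

/-- Every cell below the top scale is governed by a selected cube. -/
lemma exists_sel {K k : ℤ} (hk : k ≤ K) (x : Rd d) :
    ∃ Q, Sel F G K Q ∧ k ≤ Q.1 ∧ x ∈ cell Q.1 Q.2 ∧ ∀ k', k ≤ k' → ¬ Stop F G Q k' (idx k' x) := by
  -- The smallest selected cube of scale at least `k` containing `x`. If `x` lay in a stopping cell
  -- of it at scale `k` or above, the largest such cell would be selected and smaller.
  obtain ⟨m, ⟨Q, hQ, rfl, hkQ, hx⟩, hmin⟩ := Int.exists_least_of_bdd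
    (P := fun m => ∃ Q : DyadicCube d, Sel F G K Q ∧ Q.1 = m ∧ k ≤ m ∧ x ∈ cell Q.1 Q.2)
    ⟨k, fun z ⟨_, _, _, h, _⟩ => h⟩ ⟨K, (K, idx K x), Sel.top _, rfl, hk, rfl⟩
  refine ⟨Q, hQ, hkQ, hx, fun k' hk' hs => ?_⟩
  obtain ⟨m, hm, hmax⟩ := Int.exists_greatest_of_bdd (P := fun m => Stop F G Q m (idx m x))
    ⟨Q.1, fun z hz => hz.lt.le⟩ ⟨k', hs⟩
  have hm2 := hmin m ⟨(m, idx m x), Sel.child Q m x hQ hx hm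
    (fun k'' h h' => absurd (hmax k'' h') (not_le.2 h)), rfl, hk'.trans (hmax k' hs), rfl⟩
  exact absurd hm.lt (not_lt.2 hm2)

/-- The disjoint sets are the cores. They fill half of a cell, hence the fraction `3^(-d)/2` of the
tripled cube. Injectivity of `triCube` lets the core be recovered from the tripled cube. -/
lemma isSparse_sel (hF : ∫⁻ x, F x ≠ ∞) (hG : ∫⁻ x, G x ≠ ∞) (K : ℤ) :
    IsSparse (((3 : ℝ) ^ d)⁻¹ / 2) (triCube '' {Q | Sel F G K Q}) := by
  classical
  have inv : ∀ Q : DyadicCube d, Function.invFun triCube (triCube Q) = Q :=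
    Function.leftInverse_invFun triCube_injective
  refine ⟨fun P => core F G (Function.invFun triCube P), ?_, ?_⟩
  · rintro _ ⟨Q, hQ, rfl⟩
    simp only [inv]
    refine ⟨measurableSet_core _ _ _, ?_, ?_⟩
    · rw [toSet_triCube]
      exact fun x hx => cell_subset_tri Q hx.1
    · rw [toSet_triCube, volume_tri]
      have h3 : ENNReal.ofReal (((3 : ℝ) ^ d)⁻¹ / 2) * 3 ^ d = 2⁻¹ := by
        have : (3 : ℝ≥0∞) ^ d = ENNReal.ofReal (3 ^ d) := by
          rw [ENNReal.ofReal_pow (by norm_num)]; norm_num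
        rw [this, ← ENNReal.ofReal_mul (by positivity),
          show ((3 : ℝ) ^ d)⁻¹ / 2 * 3 ^ d = 2⁻¹ by field_simp,
          ENNReal.ofReal_inv_of_pos (by norm_num)]
        norm_num
      rw [← mul_assoc, h3]
      calc _ ≤ 2⁻¹ * (2 * volume (core F G Q)) := by gcongr; exact volume_core_ge hF hG Q
        _ = _ := by rw [← mul_assoc, ENNReal.inv_mul_cancel (by norm_num) (by norm_num), one_mul]
  · rintro _ ⟨Q, hQ, rfl⟩ _ ⟨Q', hQ', rfl⟩ hne
    simp only [Function.onFun, inv]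
    exact hQ.disjoint_core hQ' fun h => hne (by rw [h])

end dyadic

/-! ### The Calderón–Zygmund decomposition relative to a cube. -/

section decomposition

variable {d : ℕ}

/-- The level above which cells are heavy. -/
def heavyLevel (F : Rd d → ℝ≥0∞) (Q : DyadicCube d) : ℝ≥0∞ :=
  4 * 3 ^ d * (∫⁻ y in tri Q, F y) / (2 : ℝ≥0∞) ^ ((Q.1 : ℝ) * d)

lemma lintegral_le_of_not_heavy {F : Rd d → ℝ≥0∞} {Q : DyadicCube d} {k : ℤ} {n : Fin d → ℤ}
    (h : ¬ Heavy F Q k n) :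
    ∫⁻ y in cell k n, (tri Q).indicator F y ≤ heavyLevel F Q * (2 : ℝ≥0∞) ^ ((k : ℝ) * d) := by
  rw [Heavy, not_lt] at h
  rw [lintegral_indicator (measurableSet_tri Q), Measure.restrict_restrict (measurableSet_tri Q),
    Set.inter_comm, heavyLevel, ← ENNReal.mul_div_right_comm,
    ENNReal.le_div_iff_mul_le (Or.inl (two_rpow_ne_zero _)) (Or.inl (two_rpow_ne_top _)), mul_comm]
  exact h

/-- The parent cell is not heavy, and comparing volumes with the parent costs `2 ^ d`. -/
lemma MaxHeavy.lintegral_le {F : Rd d → ℝ≥0∞} {Q : DyadicCube d} {k : ℤ} {x : Rd d}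
    (h : MaxHeavy F Q k x) :
    ∫⁻ y in cell k (idx k x), (tri Q).indicator F y ≤
      2 ^ d * heavyLevel F Q * (2 : ℝ≥0∞) ^ ((k : ℝ) * d) := by
  have h1 := lintegral_le_of_not_heavy (h.2 (k + 1) (by omega))
  have hsub : cell k (idx k x) ⊆ cell (k + 1) (idx (k + 1) x) := fun y hy =>
    idx_eq_of_le hy (by omega)
  refine (lintegral_mono_set hsub).trans (h1.trans_eq ?_)
  have : ((k + 1 : ℤ) : ℝ) * d = d + k * d := by push_cast; ring
  rw [this, two_rpow_add, ENNReal.rpow_natCast]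
  ring

/-- An integral bound on cells passes to unions of cells. -/
lemma lintegral_le_of_cells {F : Rd d → ℝ≥0∞} {k : ℤ} {P : (Fin d → ℤ) → Prop} {A : ℝ≥0∞}
    (h : ∀ n, P n → ∫⁻ y in cell k n, F y ≤ A * (2 : ℝ≥0∞) ^ ((k : ℝ) * d)) :
    ∫⁻ y in {x | P (idx k x)}, F y ≤ A * volume {x : Rd d | P (idx k x)} := by
  have e : {x : Rd d | P (idx k x)} = ⋃ n : {n // P n}, cell k n := by
    ext x
    simp [cell]
  have hm : ∀ n : {n // P n}, MeasurableSet (cell (d := d) k n) := fun n => measurableSet_cell _ _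
  have hd : Pairwise (Function.onFun Disjoint fun n : {n // P n} => cell (d := d) k n) := by
    intro m n hmn
    refine Set.disjoint_left.2 fun x hx hx' => hmn (Subtype.ext ?_)
    rw [← show idx k x = m from hx, ← show idx k x = n from hx']
  rw [e, lintegral_iUnion hm hd, measure_iUnion hd hm, ← ENNReal.tsum_mul_left]
  refine ENNReal.tsum_le_tsum fun n => ?_
  rw [volume_cell]
  exact h n n.2

/-- The mean over the cell of scale `k` containing `x`. -/
def cellMean (f : Rd d → ℂ) (k : ℤ) (x : Rd d) : ℂ :=
  ((((2 : ℝ≥0∞) ^ ((k : ℝ) * d)).toReal)⁻¹ : ℝ) * ∫ y in cell k (idx k x), f y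

lemma cellMean_congr (f : Rd d → ℂ) {k : ℤ} {x y : Rd d} (h : idx k x = idx k y) :
    cellMean f k x = cellMean f k y := by
  rw [cellMean, cellMean, h]

lemma measurable_cellMean (f : Rd d → ℂ) (k : ℤ) : Measurable (cellMean f k) := by
  have : Measurable fun n : Fin d → ℤ =>
    (((((2 : ℝ≥0∞) ^ ((k : ℝ) * d)).toReal)⁻¹ : ℝ) : ℂ) * ∫ y in cell k n, f y :=
    measurable_of_countable _
  exact this.comp (measurable_idx k)

/-- Jensen's inequality for the mean over a cell, in the form of Hölder against the constant 1. -/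
lemma enorm_cellMean_rpow_le {f : Rd d → ℂ} (hf : Measurable f) {p : ℝ} (hp : 1 ≤ p) (k : ℤ)
    (x : Rd d) : ‖cellMean f k x‖ₑ ^ p * (2 : ℝ≥0∞) ^ ((k : ℝ) * d) ≤
      ∫⁻ y in cell k (idx k x), ‖f y‖ₑ ^ p := by
  set v := (2 : ℝ≥0∞) ^ ((k : ℝ) * d) with hv
  have hv0 : v ≠ 0 := two_rpow_ne_zero _
  have hvt : v ≠ ∞ := two_rpow_ne_top _
  have hp0 : 0 < p := by linarith
  have h1 : ‖cellMean f k x‖ₑ = v⁻¹ * ‖∫ y in cell k (idx k x), f y‖ₑ := by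
    rw [cellMean, enorm_mul]
    congr 1
    rw [← ofReal_norm, Complex.norm_real, Real.norm_of_nonneg (by positivity),
      ← ENNReal.toReal_inv, ENNReal.ofReal_toReal (ENNReal.inv_ne_top.2 hv0)]
  have h2 : ‖∫ y in cell k (idx k x), f y‖ₑ ≤
      (∫⁻ y in cell k (idx k x), ‖f y‖ₑ ^ p) ^ (1 / p) * v ^ (1 - 1 / p) := by
    refine (enorm_integral_le_lintegral_enorm _).trans ?_
    have := eLpNorm_le_eLpNorm_mul_rpow_measure_univ (μ := volume.restrict (cell k (idx k x)))
      (f := f) (p := 1) (q := ENNReal.ofReal p) (by simpa using hp) hf.aestronglyMeasurable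
    rw [eLpNorm_one_eq_lintegral_enorm, eLpNorm_eq_lintegral_rpow_enorm_toReal (by simpa using hp0)
      (by simp), ENNReal.toReal_ofReal hp0.le] at this
    simpa [volume_cell] using this
  rw [h1, ENNReal.mul_rpow_of_nonneg _ _ hp0.le]
  calc v⁻¹ ^ p * ‖∫ y in cell k (idx k x), f y‖ₑ ^ p * v
      ≤ v⁻¹ ^ p * ((∫⁻ y in cell k (idx k x), ‖f y‖ₑ ^ p) ^ (1 / p) * v ^ (1 - 1 / p)) ^ p * v := by
        gcongr
    _ = (∫⁻ y in cell k (idx k x), ‖f y‖ₑ ^ p) * (v ^ (-p) * v ^ ((1 - 1 / p) * p) * v ^ (1 : ℝ)) := by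
        rw [ENNReal.mul_rpow_of_nonneg _ _ hp0.le, ← ENNReal.rpow_mul, ← ENNReal.rpow_mul,
          one_div_mul_cancel hp0.ne', ENNReal.rpow_one, ENNReal.rpow_one, ENNReal.inv_rpow,
          ENNReal.rpow_neg]
        ring
    _ = _ := by
        rw [← ENNReal.rpow_add _ _ hv0 hvt, ← ENNReal.rpow_add _ _ hv0 hvt]
        have : -p + (1 - 1 / p) * p + 1 = 0 := by field_simp; ring
        rw [this, ENNReal.rpow_zero, mul_one]

/-- The part of scale `k` of the bad function of the Calderón–Zygmund decomposition. -/
def czBad (f : Rd d → ℂ) (p : ℝ) (Q : DyadicCube d) (k : ℤ) : Rd d → ℂ :=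
  {x | MaxHeavy (fun y => ‖f y‖ₑ ^ p) Q k x}.indicator fun x =>
    (tri Q).indicator f x - cellMean ((tri Q).indicator f) k x

/-- The good function of the Calderón–Zygmund decomposition. -/
def czGood (f : Rd d → ℂ) (p : ℝ) (Q : DyadicCube d) (x : Rd d) : ℂ :=
  (tri Q).indicator f x - ∑' k, czBad f p Q k x

variable {f : Rd d → ℂ} {p : ℝ} {Q : DyadicCube d}

lemma czBad_of_not {k : ℤ} {x : Rd d} (h : ¬ MaxHeavy (fun y => ‖f y‖ₑ ^ p) Q k x) :
    czBad f p Q k x = 0 :=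
  Set.indicator_of_notMem (s := {x | MaxHeavy (fun y => ‖f y‖ₑ ^ p) Q k x}) h _

lemma czBad_of_maxHeavy {k : ℤ} {x : Rd d} (h : MaxHeavy (fun y => ‖f y‖ₑ ^ p) Q k x) :
    czBad f p Q k x = (tri Q).indicator f x - cellMean ((tri Q).indicator f) k x :=
  Set.indicator_of_mem (s := {x | MaxHeavy (fun y => ‖f y‖ₑ ^ p) Q k x}) h _

/-- At every point at most one scale is the maximal heavy one, so the series has at most one nonzero
term. -/
lemma hasSum_czBad (f : Rd d → ℂ) (p : ℝ) (Q : DyadicCube d) (x : Rd d) :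
    HasSum (fun k => czBad f p Q k x) ((tri Q).indicator f x - czGood f p Q x) := by
  rw [czGood, sub_sub_cancel]
  apply Summable.hasSum
  by_cases h : ∃ k, MaxHeavy (fun y => ‖f y‖ₑ ^ p) Q k x
  · obtain ⟨k, hk⟩ := h
    exact (hasSum_single k fun k' hk' => czBad_of_not fun h => hk' (h.unique hk)).summable
  · push Not at h
    simp only [czBad_of_not (h _)]
    exact summable_zero

lemma czGood_of_maxHeavy {k : ℤ} {x : Rd d} (h : MaxHeavy (fun y => ‖f y‖ₑ ^ p) Q k x) :
    czGood f p Q x = cellMean ((tri Q).indicator f) k x := by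
  rw [czGood, tsum_eq_single k fun k' hk' => czBad_of_not fun h' => hk' (h'.unique h),
    czBad_of_maxHeavy h, sub_sub_cancel]

lemma czGood_of_not {x : Rd d} (h : ∀ k, ¬ MaxHeavy (fun y => ‖f y‖ₑ ^ p) Q k x) :
    czGood f p Q x = (tri Q).indicator f x := by
  rw [czGood]
  simp only [czBad_of_not (h _), tsum_zero, sub_zero]

lemma indicator_rpow_enorm (hp : 0 < p) (S : Set (Rd d)) (f : Rd d → ℂ) :
    (fun y => ‖S.indicator f y‖ₑ ^ p) = S.indicator fun y => ‖f y‖ₑ ^ p := by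
  ext y
  by_cases h : y ∈ S <;> simp [h, hp]

lemma enorm_cellMean_le (hf : Measurable f) (hp : 1 ≤ p) {k : ℤ} {x : Rd d}
    (h : MaxHeavy (fun y => ‖f y‖ₑ ^ p) Q k x) :
    ‖cellMean ((tri Q).indicator f) k x‖ₑ ^ p ≤ 2 ^ d * heavyLevel (fun y => ‖f y‖ₑ ^ p) Q := by
  have h1 := enorm_cellMean_rpow_le (hf.indicator (measurableSet_tri Q)) hp k x
  rw [indicator_rpow_enorm (by linarith)] at h1
  exact (ENNReal.mul_le_mul_iff_left (two_rpow_ne_zero _) (two_rpow_ne_top _)).1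
    (h1.trans h.lintegral_le)

lemma cell_subset_tri_of_mem {k : ℤ} {x : Rd d} (hx : x ∈ tri Q) (hk : k ≤ Q.1) :
    cell k (idx k x) ⊆ tri Q := fun y hy => by
  rw [tri, Set.mem_ofPred_eq, idx_eq_of_le (show idx k y = idx k x from hy) hk]; exact hx

/-- Continuity replaces Lebesgue differentiation: if `|f|^p` exceeded the level at `x`, it would do
so on all sufficiently small cells around `x`, and these would be heavy. -/
lemma enorm_le_of_not_heavy (hf : Continuous f) {x : Rd d}
    (h : ∀ k, ¬ Heavy (fun y => ‖f y‖ₑ ^ p) Q k (idx k x)) (hx : x ∈ tri Q) :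
    ‖f x‖ₑ ^ p ≤ heavyLevel (fun y => ‖f y‖ₑ ^ p) Q := by
  by_contra! hlt
  obtain ⟨a, ha, hax⟩ := exists_between hlt
  have hc : Continuous fun y => ‖f y‖ₑ ^ p := by fun_prop
  obtain ⟨δ, hδ, hball⟩ := Metric.isOpen_iff.1 (isOpen_lt continuous_const hc) x hax
  obtain ⟨N, hN⟩ := exists_pow_lt_of_lt_one (show 0 < δ / (d + 1) by positivity)
    (show (1 / 2 : ℝ) < 1 by norm_num)
  set k : ℤ := min Q.1 (-N) with hk
  have hkN : (2 : ℝ) ^ k ≤ (1 / 2) ^ N := by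
    calc (2 : ℝ) ^ k ≤ 2 ^ (-N : ℤ) := zpow_le_zpow_right₀ (by norm_num) (min_le_right _ _)
      _ = _ := by simp
  have hsmall : (d : ℝ) * 2 ^ k < δ := by
    have h2 : (0 : ℝ) < 2 ^ k := by positivity
    have : (2 : ℝ) ^ k * (d + 1) < δ := by
      rw [← lt_div_iff₀ (by positivity)]; exact hkN.trans_lt hN
    nlinarith
  have hle := lintegral_le_of_not_heavy (h k)
  have hge : a * (2 : ℝ≥0∞) ^ ((k : ℝ) * d) ≤
      ∫⁻ y in cell k (idx k x), (tri Q).indicator (fun y => ‖f y‖ₑ ^ p) y := by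
    rw [← volume_cell k (idx k x), ← setLIntegral_const]
    refine setLIntegral_mono' (measurableSet_cell _ _) fun y hy => ?_
    rw [Set.indicator_of_mem (cell_subset_tri_of_mem hx (min_le_left _ _) hy)]
    refine le_of_lt (hball ?_)
    rw [Metric.mem_ball, dist_eq_norm]
    exact (norm_sub_le_of_idx_eq hy).trans_lt hsmall
  exact absurd ha (not_lt.2 ((ENNReal.mul_le_mul_iff_left (two_rpow_ne_zero _)
    (two_rpow_ne_top _)).1 (hge.trans hle)))

lemma enorm_czGood_le (hf : Continuous f) (hp : 1 ≤ p) (x : Rd d) :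
    ‖czGood f p Q x‖ₑ ^ p ≤ 2 ^ d * heavyLevel (fun y => ‖f y‖ₑ ^ p) Q := by
  by_cases h : ∃ k, MaxHeavy (fun y => ‖f y‖ₑ ^ p) Q k x
  · obtain ⟨k, hk⟩ := h
    rw [czGood_of_maxHeavy hk]
    exact enorm_cellMean_le hf.measurable hp hk
  · push Not at h
    rw [czGood_of_not h]
    by_cases hx : x ∈ tri Q
    · rw [Set.indicator_of_mem hx]
      refine (enorm_le_of_not_heavy hf (fun k hk => ?_) hx).trans ?_
      · obtain ⟨k', -, h'⟩ := hk.exists_maxHeavy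
        exact h k' h'
      · exact le_mul_of_one_le_left zero_le (one_le_pow_of_one_le' (by norm_num) d)
    · rw [Set.indicator_of_notMem hx, enorm_zero, ENNReal.zero_rpow_of_pos (by linarith)]
      exact zero_le

lemma measurable_czBad (hf : Measurable f) (k : ℤ) : Measurable (czBad f p Q k) :=
  ((hf.indicator (measurableSet_tri Q)).sub (measurable_cellMean _ _)).indicator
    (measurableSet_maxHeavy _ _ _)

lemma measurable_czGood (hf : Measurable f) : Measurable (czGood f p Q) := by
  have : Measurable fun x => (tri Q).indicator f x - czGood f p Q x := by
    refine measurable_of_tendsto_metrizable' (atTop : Filter (Finset ℤ))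
      (f := fun s x => ∑ k ∈ s, czBad f p Q k x) (fun s => ?_) ?_
    · exact Finset.measurable_sum _ fun k _ => measurable_czBad hf k
    · rw [tendsto_pi_nhds]
      exact fun x => hasSum_czBad f p Q x
  have h := (hf.indicator (measurableSet_tri Q)).sub this
  have e : ((tri Q).indicator f - fun x => (tri Q).indicator f x - czGood f p Q x) =
      czGood f p Q := by
    ext x; simp
  rwa [e] at h

lemma norm_cellMean_le {M : ℝ} (hM : ∀ x, ‖f x‖ ≤ M) (k : ℤ) (x : Rd d) :
    ‖cellMean f k x‖ ≤ M := by
  set v := (2 : ℝ≥0∞) ^ ((k : ℝ) * d) with hv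
  have hv0 : 0 < v.toReal := ENNReal.toReal_pos (two_rpow_ne_zero _) (two_rpow_ne_top _)
  have h := norm_setIntegral_le_of_norm_le_const (μ := volume) (s := cell k (idx k x)) (f := f)
    (C := M) (by rw [volume_cell]; exact (two_rpow_ne_top _).lt_top) fun y _ => hM y
  rw [measureReal_def, volume_cell, ← hv] at h
  rw [cellMean, norm_mul, ← hv, Complex.norm_real, Real.norm_of_nonneg (by positivity),
    inv_mul_le_iff₀ hv0, mul_comm]
  exact h

lemma norm_czBad_le {M : ℝ} (hM : ∀ x, ‖f x‖ ≤ M) (k : ℤ) (x : Rd d) :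
    ‖czBad f p Q k x‖ ≤ M + M := by
  have hM' : ∀ x, ‖(tri Q).indicator f x‖ ≤ M := fun x =>
    (norm_indicator_le_norm_self _ _).trans (hM x)
  refine (norm_indicator_le_norm_self _ _).trans ((norm_sub_le _ _).trans ?_)
  exact add_le_add (hM' x) (norm_cellMean_le hM' k x)

lemma norm_czGood_le {M : ℝ} (hM : ∀ x, ‖f x‖ ≤ M) (x : Rd d) : ‖czGood f p Q x‖ ≤ M := by
  have hM' : ∀ x, ‖(tri Q).indicator f x‖ ≤ M := fun x =>
    (norm_indicator_le_norm_self _ _).trans (hM x)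
  by_cases h : ∃ k, MaxHeavy (fun y => ‖f y‖ₑ ^ p) Q k x
  · obtain ⟨k, hk⟩ := h
    rw [czGood_of_maxHeavy hk]
    exact norm_cellMean_le hM' k x
  · push Not at h
    rw [czGood_of_not h]
    exact hM' x

/-- The means of the bad functions over the cells of their scale vanish, also after restriction to
a union of such cells. -/
lemma integral_czBad (hf : IsBddCompact f) (k : ℤ) (P : (Fin d → ℤ) → Prop) (n : Fin d → ℤ) :
    ∫ y in cell k n, {x | P (idx k x)}.indicator (czBad f p Q k) y = 0 := by
  by_cases h : P n ∧ MaxHeavy (fun y => ‖f y‖ₑ ^ p) Q k (cellPt k n)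
  · set v := (2 : ℝ≥0∞) ^ ((k : ℝ) * d) with hv
    have hv0 : 0 < v.toReal := ENNReal.toReal_pos (two_rpow_ne_zero _) (two_rpow_ne_top _)
    have hfin : volume (cell (d := d) k n) ≠ ∞ := by rw [volume_cell]; exact two_rpow_ne_top _
    have e : ∀ y ∈ cell k n, {x | P (idx k x)}.indicator (czBad f p Q k) y =
        (tri Q).indicator f y - cellMean ((tri Q).indicator f) k (cellPt k n) := by
      intro y hy
      have hyn : idx k y = n := hy
      have hPy : P (idx k y) := hyn.symm ▸ h.1
      rw [Set.indicator_of_mem (show y ∈ {x | P (idx k x)} from hPy),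
        czBad_of_maxHeavy (h.2.congr (by rw [idx_cellPt, hyn])),
        cellMean_congr _ (show idx k y = idx k (cellPt k n) by rw [idx_cellPt, hyn])]
    rw [setIntegral_congr_fun (measurableSet_cell k n) e, integral_sub, setIntegral_const, cellMean,
      idx_cellPt, measureReal_def, volume_cell, ← hv, Complex.real_smul, ← mul_assoc,
      ← Complex.ofReal_mul, mul_inv_cancel₀ hv0.ne', Complex.ofReal_one, one_mul, sub_self]
    · obtain ⟨hm, M, hM, -⟩ := hf.indicator (measurableSet_tri Q)
      exact Measure.integrableOn_of_bounded (M := M) hfin hm.aestronglyMeasurable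
        (Eventually.of_forall hM)
    · exact integrableOn_const hfin
  · refine setIntegral_eq_zero_of_forall_eq_zero fun y hy => ?_
    have hyn : idx k y = n := hy
    by_cases hP : P n
    · have hPy : P (idx k y) := hyn.symm ▸ hP
      rw [Set.indicator_of_mem (show y ∈ {x | P (idx k x)} from hPy)]
      refine czBad_of_not fun hM => h ⟨hP, hM.congr (by rw [idx_cellPt, hyn])⟩
    · exact Set.indicator_of_notMem (fun h' => hP (by rw [← hyn]; exact h')) _

/-- The bad function lives on the maximal heavy cells of scale `k`. There both `f` and its mean have
`p`-th powers with averages at most `2 ^ d` times the level. The point is that the volume on the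
right is only that of these cells. -/
lemma lintegral_czBad_le (hf : Measurable f) (hp : 1 ≤ p) (k : ℤ) (P : (Fin d → ℤ) → Prop) :
    ∫⁻ x in {x | P (idx k x)}, ‖czBad f p Q k x‖ₑ ^ p ≤
      2 ^ p * (2 * 2 ^ d) * heavyLevel (fun y => ‖f y‖ₑ ^ p) Q *
        volume {x | MaxHeavy (fun y => ‖f y‖ₑ ^ p) Q k x ∧ P (idx k x)} := by
  have hp0 : 0 < p := by linarith
  set L := heavyLevel (fun y => ‖f y‖ₑ ^ p) Q with hL
  set W := {x | MaxHeavy (fun y => ‖f y‖ₑ ^ p) Q k x ∧ P (idx k x)} with hW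
  have eW : W = {x | MaxHeavy (fun y => ‖f y‖ₑ ^ p) Q k (cellPt k (idx k x)) ∧ P (idx k x)} := by
    ext x
    exact and_congr_left fun _ => ⟨fun h => h.congr (by simp), fun h => h.congr (by simp)⟩
  have hWm : MeasurableSet W := by
    rw [eW]
    exact measurableSet_idx k
      fun n => MaxHeavy (fun y => ‖f y‖ₑ ^ p) Q k (cellPt k n) ∧ P n
  have h1 : ∫⁻ x in {x | P (idx k x)}, ‖czBad f p Q k x‖ₑ ^ p ≤
      ∫⁻ x in W, 2 ^ p * ((tri Q).indicator (fun y => ‖f y‖ₑ ^ p) x + 2 ^ d * L) := by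
    rw [← lintegral_indicator (measurableSet_idx k P), ← lintegral_indicator hWm]
    refine lintegral_mono fun x => ?_
    by_cases hx : x ∈ W
    · rw [Set.indicator_of_mem hx, Set.indicator_of_mem (show x ∈ {x | P (idx k x)} from hx.2),
        czBad_of_maxHeavy hx.1]
      have e1 : ∀ a b : ℝ≥0∞, (a + b) ^ p ≤ 2 ^ p * (a ^ p + b ^ p) := by
        intro a b
        rcases le_total a b with hab | hab
        · calc (a + b) ^ p ≤ (2 * b) ^ p := by rw [two_mul]; gcongr
            _ = 2 ^ p * b ^ p := ENNReal.mul_rpow_of_nonneg _ _ hp0.le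
            _ ≤ _ := by gcongr; exact le_add_self
        · calc (a + b) ^ p ≤ (2 * a) ^ p := by rw [two_mul]; gcongr
            _ = 2 ^ p * a ^ p := ENNReal.mul_rpow_of_nonneg _ _ hp0.le
            _ ≤ _ := by gcongr; exact le_self_add
      refine (ENNReal.rpow_le_rpow enorm_sub_le hp0.le).trans ((e1 _ _).trans ?_)
      rw [← indicator_rpow_enorm hp0]
      gcongr
      exact enorm_cellMean_le hf hp hx.1
    · rw [Set.indicator_of_notMem hx]
      refine le_of_eq ?_
      by_cases hP : P (idx k x)
      · rw [Set.indicator_of_mem (show x ∈ {x | P (idx k x)} from hP),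
          czBad_of_not fun h => hx ⟨h, hP⟩, enorm_zero, ENNReal.zero_rpow_of_pos hp0]
      · exact Set.indicator_of_notMem (s := {x | P (idx k x)}) hP _
  have h2 : ∫⁻ x in W, (tri Q).indicator (fun y => ‖f y‖ₑ ^ p) x ≤ 2 ^ d * L * volume W := by
    rw [eW]
    refine lintegral_le_of_cells
      (P := fun n => MaxHeavy (fun y => ‖f y‖ₑ ^ p) Q k (cellPt k n) ∧ P n) fun n hn => ?_
    have := hn.1.lintegral_le
    rwa [idx_cellPt] at this
  refine h1.trans ?_
  rw [lintegral_const_mul _ (by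
    exact ((hf.enorm.pow_const p).indicator (measurableSet_tri Q)).add measurable_const),
    lintegral_add_right _ measurable_const, setLIntegral_const]
  calc _ ≤ 2 ^ p * (2 ^ d * L * volume W + 2 ^ d * L * volume W) := by gcongr
    _ = _ := by ring

end decomposition

/-! ### Estimates on a single dyadic cell. -/

section summation

variable {d : ℕ} {E : Set ℝ}

/-- The trivial `L^∞` bound by the mass of `μ`. It suffices for two good functions and also gives
finiteness of the maximal function. -/
lemma averageMax_le_const (μ : Measure (Rd d × Rd d)) [IsFiniteMeasure μ] (E : Set ℝ)
    {f g : Rd d → ℂ} {a b : ℝ≥0∞} (hf : ∀ x, ‖f x‖ₑ ≤ a) (hg : ∀ x, ‖g x‖ₑ ≤ b) (x : Rd d) :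
    averageMax μ E f g x ≤ a * b * μ Set.univ := by
  refine iSup₂_le fun t _ => ?_
  refine (enorm_integral_le_lintegral_enorm _).trans ?_
  rw [← lintegral_const]
  refine lintegral_mono fun w => ?_
  rw [enorm_mul]
  exact mul_le_mul' (hf _) (hg _)

/-- The uniform bound on the sums of absolute values justifies integrating the series term by term
against `μ`. -/
lemma pairing_tsum_left_le (μ : Measure (Rd d × Rd d)) [IsFiniteMeasure μ] (hE : E.Countable)
    {b : ℕ → Rd d → ℂ} (hb : ∀ j, Measurable (b j)) {M : ℝ≥0} (hM : ∀ x, ∑' j, ‖b j x‖ₑ ≤ M)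
    {g h : Rd d → ℂ} (hg : IsBddCompact g) (hh : Measurable h) :
    pairing μ E (fun x => ∑' j, b j x) g h ≤ ∑' j, pairing μ E (b j) g h := by
  have hpt : ∀ x, averageMax μ E (fun x => ∑' j, b j x) g x ≤ ∑' j, averageMax μ E (b j) g x := by
    intro x
    refine iSup₂_le fun t ht => ?_
    obtain ⟨hgm, N, hN, -⟩ := hg
    have hbm : ∀ j, Measurable fun w : Rd d × Rd d => b j (x - t • w.1) := fun j =>
      (hb j).comp (by fun_prop)
    have hgw : Measurable fun w : Rd d × Rd d => g (x - t • w.2) := hgm.comp (by fun_prop)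
    have hmm : ∀ j, Measurable fun w : Rd d × Rd d => b j (x - t • w.1) * g (x - t • w.2) :=
      fun j => (hbm j).mul hgw
    have e : bilinearAverage μ t (fun x => ∑' j, b j x) g x =
        ∑' j, bilinearAverage μ t (b j) g x := by
      unfold bilinearAverage
      rw [← integral_tsum]
      · simp only [tsum_mul_right]
      · intro j
        exact (hmm j).aestronglyMeasurable
      · rw [← lintegral_tsum fun j => (hmm j).enorm.aemeasurable]
        refine ((lintegral_mono (g := fun _ => (M : ℝ≥0∞) * ENNReal.ofReal N) fun w => ?_).trans_lt
          ?_).ne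
        · simp only [enorm_mul, ENNReal.tsum_mul_right]
          refine mul_le_mul' (hM _) ?_
          rw [← ofReal_norm]
          exact ENNReal.ofReal_le_ofReal (hN _)
        · rw [lintegral_const]
          exact ENNReal.mul_lt_top (ENNReal.mul_lt_top ENNReal.coe_lt_top ENNReal.ofReal_lt_top)
            (measure_lt_top _ _)
    rw [e]
    refine enorm_tsum_le_tsum_enorm.trans (ENNReal.tsum_le_tsum fun j => ?_)
    exact le_iSup₂ (f := fun t (_ : t ∈ E) => ‖bilinearAverage μ t (b j) g x‖ₑ) t ht
  have hmm : ∀ j, Measurable fun x => averageMax μ E (b j) g x * ‖h x‖ₑ := fun j =>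
    (measurable_averageMax μ hE (hb j) hg.1).mul hh.enorm
  unfold pairing
  rw [← lintegral_tsum fun j => (hmm j).aemeasurable]
  refine lintegral_mono fun x => ?_
  simp only
  rw [ENNReal.tsum_mul_right]
  exact mul_le_mul_left (hpt x) _

lemma pairing_swap (μ : Measure (Rd d × Rd d)) (E : Set ℝ) (f g h : Rd d → ℂ) :
    pairing (μ.map Prod.swap) E f g h = pairing μ E g f h := by
  simp only [pairing, averageMax_swap]

lemma pairing_tsum_right_le (μ : Measure (Rd d × Rd d)) [IsFiniteMeasure μ] (hE : E.Countable)
    {b : ℕ → Rd d → ℂ} (hb : ∀ j, Measurable (b j)) {M : ℝ≥0} (hM : ∀ x, ∑' j, ‖b j x‖ₑ ≤ M)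
    {f h : Rd d → ℂ} (hf : IsBddCompact f) (hh : Measurable h) :
    pairing μ E f (fun x => ∑' j, b j x) h ≤ ∑' j, pairing μ E f (b j) h := by
  simp only [← pairing_swap μ]
  exact pairing_tsum_left_le _ hE hb hM hf hh

lemma IsLocalizedFamily.swap {μ : Measure (Rd d × Rd d)} {A : ℤ → Set ℝ} {p q r ε : ℝ} {C : ℝ≥0}
    (H : IsLocalizedFamily μ A p q r ε C) :
    IsLocalizedFamily (μ.map Prod.swap) A q p r ε C where
  countable := H.countable
  support k t ht := by
    rw [ae_map_iff measurable_swap.aemeasurable]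
    · filter_upwards [H.support k t ht] with w hw
      exact ⟨hw.2, hw.1⟩
    · have h1 : Measurable fun w : Rd d × Rd d => ‖t • w.1‖ := by fun_prop
      have h2 : Measurable fun w : Rd d × Rd d => ‖t • w.2‖ := by fun_prop
      exact (measurableSet_le h1 measurable_const).inter (measurableSet_le h2 measurable_const)
  bound k f g h hf hg hh := by
    rw [pairing_swap]
    refine (H.bound k g f h hg hf hh).trans_eq ?_
    rw [sub_right_comm]; ring
  gain_left k j f g h hjk hf hg hh h0 := by
    rw [pairing_swap]
    refine (H.gain_right k j g f h hjk hg hf hh h0).trans_eq ?_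
    rw [sub_right_comm (1 / r)]; ring
  gain_right k j f g h hjk hf hg hh h0 := by
    rw [pairing_swap]
    refine (H.gain_left k j g f h hjk hg hf hh h0).trans_eq ?_
    rw [sub_right_comm (1 / r)]; ring

lemma near_idx_of_norm_le {k : ℤ} {x y : Rd d} (h : ‖x - y‖ ≤ 2 ^ k) :
    Near (idx k x) (idx k y) := by
  intro i
  have h2 : (0 : ℝ) < 2 ^ k := by positivity
  have hi : |x i - y i| ≤ 2 ^ k := by
    have := (PiLp.norm_apply_le (x - y) i).trans h
    simpa [Real.norm_eq_abs] using this
  have hx := mem_cell_iff.1 (show x ∈ cell k (idx k x) from rfl) i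
  have hy := mem_cell_iff.1 (show y ∈ cell k (idx k y) from rfl) i
  rw [abs_le] at hi ⊢
  have l1 : (idx k y i : ℝ) * 2 ^ k < (idx k x i + 2) * 2 ^ k := by linarith [hx.2, hy.1, hi.1]
  have l2 : (idx k x i : ℝ) * 2 ^ k < (idx k y i + 2) * 2 ^ k := by linarith [hx.1, hy.2, hi.2]
  have m1 := lt_of_mul_lt_mul_right l1 h2.le
  have m2 := lt_of_mul_lt_mul_right l2 h2.le
  have n1 : idx k y i < idx k x i + 2 := by exact_mod_cast m1
  have n2 : idx k x i < idx k y i + 2 := by exact_mod_cast m2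
  omega

/-- Averages of index `R.1` move points by at most the side of `R`, so from the cell they see only
the neighbouring cells. -/
lemma pairing_localize {μ : Measure (Rd d × Rd d)} {A : ℤ → Set ℝ} {p q r ε : ℝ} {C : ℝ≥0}
    (H : IsLocalizedFamily μ A p q r ε C) (R : DyadicCube d) (f g h : Rd d → ℂ) :
    pairing μ (A R.1) f g ((cell R.1 R.2).indicator h) =
      pairing μ (A R.1) ((tri R).indicator f) ((tri R).indicator g)
        ((cell R.1 R.2).indicator h) := by
  refine lintegral_congr fun x => ?_
  by_cases hx : x ∈ cell R.1 R.2
  · congr 1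
    refine iSup_congr fun t => iSup_congr fun ht => ?_
    congr 1
    refine integral_congr_ae ?_
    filter_upwards [H.support R.1 t ht] with w hw
    have key : ∀ y : Rd d, ‖t • y‖ ≤ 2 ^ R.1 → x - t • y ∈ tri R := by
      intro y hy
      have : Near (idx R.1 (x - t • y)) (idx R.1 x) := near_idx_of_norm_le (by simpa using hy)
      rwa [show idx R.1 x = R.2 from hx] at this
    rw [Set.indicator_of_mem (key _ hw.1), Set.indicator_of_mem (key _ hw.2)]
  · simp [Set.indicator_of_notMem hx]

lemma lpn_indicator {p : ℝ} (hp : 0 < p) {S : Set (Rd d)} (hS : MeasurableSet S) (f : Rd d → ℂ) :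
    lpn p (S.indicator f) = (∫⁻ x in S, ‖f x‖ₑ ^ p) ^ (1 / p) := by
  rw [lpn, indicator_rpow_enorm hp, lintegral_indicator hS]

lemma exists_norm_le_of_mem_tri (R : DyadicCube d) : ∃ B, ∀ x ∈ tri R, ‖x‖ ≤ B := by
  have h2 : (0 : ℝ) < 2 ^ R.1 := by positivity
  refine ⟨d * (2 * 2 ^ R.1) + ‖cellPt R.1 R.2‖, fun x hx => ?_⟩
  have h : ‖x - cellPt R.1 R.2‖ ≤ d * (2 * 2 ^ R.1) := by
    refine norm_le_of_coord_le (by positivity) fun i => ?_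
    have h1 := mem_cell_iff.1 (show x ∈ cell R.1 (idx R.1 x) from rfl) i
    have h3 := abs_le.1 (hx i)
    have h4 : ((-1 : ℤ) : ℝ) ≤ ((idx R.1 x i - R.2 i : ℤ) : ℝ) := by exact_mod_cast h3.1
    have h5 : ((idx R.1 x i - R.2 i : ℤ) : ℝ) ≤ ((1 : ℤ) : ℝ) := by exact_mod_cast h3.2
    push_cast at h4 h5
    rw [PiLp.sub_apply, cellPt, abs_le]
    simp only
    constructor <;> nlinarith [h1.1, h1.2]
  calc ‖x‖ = ‖(x - cellPt R.1 R.2) + cellPt R.1 R.2‖ := by rw [sub_add_cancel]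
    _ ≤ _ := (norm_add_le _ _).trans (by gcongr)

lemma isBddCompact_indicator_tri {f : Rd d → ℂ} (hf : Measurable f) {M : ℝ} (hM : ∀ x, ‖f x‖ ≤ M)
    (R : DyadicCube d) : IsBddCompact ((tri R).indicator f) := by
  obtain ⟨B, hB⟩ := exists_norm_le_of_mem_tri R
  refine ⟨hf.indicator (measurableSet_tri R), max M B,
    fun x => (norm_indicator_le_norm_self _ _).trans ((hM x).trans (le_max_left _ _)),
    fun x hx => Set.indicator_of_notMem (fun h => ?_) _⟩
  exact absurd ((hB x h).trans (le_max_right M B)) (not_le.2 hx)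

end summation

section cell_estimate

variable {d : ℕ} {μ : Measure (Rd d × Rd d)} {A : ℤ → Set ℝ}
  {p q r ε : ℝ} {C : ℝ≥0} {f g h : Rd d → ℂ} {Q R : DyadicCube d}

/-- `tri R` is a union of cells of every smaller scale, so cutting a bad function off to `tri R`
keeps its cell means zero. -/
lemma tri_eq_of_le {j : ℤ} (hj : j ≤ R.1) :
    tri R = {x : Rd d | Near (idx R.1 (cellPt j (idx j x) : Rd d)) R.2} := by
  ext x
  rw [tri, Set.mem_ofPred_eq, Set.mem_ofPred_eq,
    idx_eq_of_le (show idx j x = idx j (cellPt j (idx j x) : Rd d) by rw [idx_cellPt]) hj]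

/-- The constant in the estimate for the bad functions. -/
def badConst (d : ℕ) (p q r : ℝ) : ℝ≥0∞ :=
  (2 ^ p * (2 * 2 ^ d)) ^ (1 / p) * (3 ^ d) ^ (1 / p - 1 / r) * (3 ^ d) ^ (1 / q)

lemma badConst_ne_top (d : ℕ) (p q r : ℝ) : badConst d p q r ≠ ∞ := by
  have h2 : (2 : ℝ≥0∞) ^ p * (2 * 2 ^ d) ≠ ∞ :=
    ENNReal.mul_ne_top (two_rpow_ne_top _) (ENNReal.mul_ne_top (by simp) (by simp))
  have h20 : (2 : ℝ≥0∞) ^ p * (2 * 2 ^ d) ≠ 0 :=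
    mul_ne_zero (two_rpow_ne_zero _) (mul_ne_zero (by simp) (by simp))
  have h3 : (3 : ℝ≥0∞) ^ d ≠ ∞ := by simp
  have h30 : (3 : ℝ≥0∞) ^ d ≠ 0 := by simp
  exact ENNReal.mul_ne_top (ENNReal.mul_ne_top (ENNReal.rpow_ne_top_of_ne_zero h20 h2)
    (ENNReal.rpow_ne_top_of_ne_zero h30 h3)) (ENNReal.rpow_ne_top_of_ne_zero h30 h3)

/-- The cancellation gain is combined with the `L^p` size of the bad function. Since `p ≤ r`, its
volume factor splits as `V^(1/p) = V^(1/r) V^(1/p - 1/r)`. The second factor is bounded by the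
volume of `tri R`, while the first is kept because `V` itself can be summed over `R`. -/
lemma pairing_czBad_le (H : IsLocalizedFamily μ A p q r ε C) (hp : 1 ≤ p) (hq : 1 ≤ q)
    (hpr : p ≤ r) (hf : IsBddCompact f) {j : ℤ} (hj : j ≤ R.1) {G : Rd d → ℂ}
    (hG : IsBddCompact G) (hh : IsBddCompact h) {a : ℝ≥0∞}
    (ha : lpn q G ≤ (a * (3 ^ d * (2 : ℝ≥0∞) ^ ((R.1 : ℝ) * d))) ^ (1 / q)) :
    pairing μ (A R.1) ((tri R).indicator (czBad f p Q j)) G h ≤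
      C * badConst d p q r * (2 : ℝ≥0∞) ^ (((j : ℝ) - R.1) * ε) *
        heavyLevel (fun y => ‖f y‖ₑ ^ p) Q ^ (1 / p) * a ^ (1 / q) *
        volume {x | MaxHeavy (fun y => ‖f y‖ₑ ^ p) Q j x ∧ x ∈ tri R} ^ (1 / r) *
        lpn (r / (r - 1)) h := by
  have hp0 : 0 < p := by linarith
  have hq0 : 0 < q := by linarith
  have hr0 : 0 < r := by linarith
  have hpr' : 1 / r ≤ 1 / p := one_div_le_one_div_of_le hp0 hpr
  obtain ⟨hfm, M, hM, -⟩ := id hf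
  have hb : IsBddCompact ((tri R).indicator (czBad f p Q j)) :=
    isBddCompact_indicator_tri (measurable_czBad hfm j) (norm_czBad_le hM j) R
  set P : (Fin d → ℤ) → Prop := fun n => Near (idx R.1 (cellPt j n : Rd d)) R.2 with hP
  have hT : tri R = {x : Rd d | P (idx j x)} := tri_eq_of_le hj
  set L := heavyLevel (fun y => ‖f y‖ₑ ^ p) Q with hL
  set V := volume {x | MaxHeavy (fun y => ‖f y‖ₑ ^ p) Q j x ∧ x ∈ tri R} with hV
  set v := (2 : ℝ≥0∞) ^ ((R.1 : ℝ) * d) with hv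
  have hVv : V ≤ 3 ^ d * v := by
    rw [hv, ← volume_tri]
    exact measure_mono fun x hx => hx.2
  have h0 : ∀ n, ∫ y in cell j n, (tri R).indicator (czBad f p Q j) y = 0 := fun n => by
    rw [hT]; exact integral_czBad hf j P n
  have hbn : lpn p ((tri R).indicator (czBad f p Q j)) ≤
      (2 ^ p * (2 * 2 ^ d)) ^ (1 / p) * L ^ (1 / p) *
        (V ^ (1 / r) * (3 ^ d * v) ^ (1 / p - 1 / r)) := by
    rw [lpn_indicator hp0 (measurableSet_tri R)]
    have h1 := lintegral_czBad_le (Q := Q) hfm hp j P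
    have e : {x | MaxHeavy (fun y => ‖f y‖ₑ ^ p) Q j x ∧ P (idx j x)} =
        {x | MaxHeavy (fun y => ‖f y‖ₑ ^ p) Q j x ∧ x ∈ tri R} := by
      rw [hT]; rfl
    rw [e, ← hT, ← hV, ← hL] at h1
    calc _ ≤ (2 ^ p * (2 * 2 ^ d) * L * V) ^ (1 / p) := by gcongr
      _ = (2 ^ p * (2 * 2 ^ d)) ^ (1 / p) * L ^ (1 / p) * V ^ (1 / r + (1 / p - 1 / r)) := by
          rw [ENNReal.mul_rpow_of_nonneg _ _ (by positivity),
            ENNReal.mul_rpow_of_nonneg _ _ (by positivity), add_sub_cancel]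
      _ ≤ _ := by
          rw [ENNReal.rpow_add_of_nonneg _ _ (by positivity) (by linarith)]
          gcongr
  refine (H.gain_left R.1 j _ G h hj hb hG hh h0).trans ?_
  -- By scale invariance all powers of the side of `R` cancel.
  have hvv : (2 : ℝ≥0∞) ^ ((R.1 : ℝ) * (d * (1 / r - 1 / p - 1 / q))) *
      (v ^ (1 / p - 1 / r) * v ^ (1 / q)) = 1 := by
    rw [hv, ← ENNReal.rpow_mul, ← ENNReal.rpow_mul, ← two_rpow_add, ← two_rpow_add]
    have : (R.1 : ℝ) * (d * (1 / r - 1 / p - 1 / q)) +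
        ((R.1 : ℝ) * d * (1 / p - 1 / r) + (R.1 : ℝ) * d * (1 / q)) = 0 := by ring
    rw [this, ENNReal.rpow_zero]
  calc _ ≤ C * (2 : ℝ≥0∞) ^ (((j : ℝ) - R.1) * ε) *
        (2 : ℝ≥0∞) ^ ((R.1 : ℝ) * (d * (1 / r - 1 / p - 1 / q))) *
        ((2 ^ p * (2 * 2 ^ d)) ^ (1 / p) * L ^ (1 / p) *
          (V ^ (1 / r) * (3 ^ d * v) ^ (1 / p - 1 / r))) *
        (a * (3 ^ d * v)) ^ (1 / q) * lpn (r / (r - 1)) h := by gcongr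
    _ = C * badConst d p q r * (2 : ℝ≥0∞) ^ (((j : ℝ) - R.1) * ε) * L ^ (1 / p) * a ^ (1 / q) *
        V ^ (1 / r) * lpn (r / (r - 1)) h *
        ((2 : ℝ≥0∞) ^ ((R.1 : ℝ) * (d * (1 / r - 1 / p - 1 / q))) *
          (v ^ (1 / p - 1 / r) * v ^ (1 / q))) := by
        rw [ENNReal.mul_rpow_of_nonneg (3 ^ d) v (by linarith),
          ENNReal.mul_rpow_of_nonneg a _ (by positivity),
          ENNReal.mul_rpow_of_nonneg (3 ^ d) v (by positivity), badConst]
        ring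
    _ = _ := by rw [hvv, mul_one]

/-- Only one scale contributes at a given point, so the bound for a single bad function survives
summation. It feeds the dominated summation in `pairing_tsum_left_le`. -/
lemma tsum_enorm_czBad_le {M : ℝ} (hM : ∀ x, ‖f x‖ ≤ M) {φ : ℕ → ℤ} (hφ : Function.Injective φ)
    (S : Set (Rd d)) (x : Rd d) :
    ∑' m, ‖S.indicator (czBad f p Q (φ m)) x‖ₑ ≤ ENNReal.ofReal (M + M) := by
  have hb : ∀ j, ‖S.indicator (czBad f p Q j) x‖ₑ ≤ ENNReal.ofReal (M + M) := fun j => by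
    rw [← ofReal_norm]
    exact ENNReal.ofReal_le_ofReal
      ((norm_indicator_le_norm_self _ _).trans (norm_czBad_le hM j x))
  have hz : ∀ j, ¬ MaxHeavy (fun y => ‖f y‖ₑ ^ p) Q j x →
      ‖S.indicator (czBad f p Q j) x‖ₑ = 0 := fun j hj => by
    by_cases hx : x ∈ S <;> simp [hx, czBad_of_not hj]
  by_cases h : ∃ m, MaxHeavy (fun y => ‖f y‖ₑ ^ p) Q (φ m) x
  · obtain ⟨m, hm⟩ := h
    rw [tsum_eq_single m fun m' hm' => hz _ fun h' => hm' (hφ (h'.unique hm))]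
    exact hb _
  · push Not at h
    simp only [hz _ (h _), tsum_zero]
    exact zero_le

/-- With no heavy cell of scale at least `R.1` meeting `tri R`, only bad functions of scale `R.1 - 1
- m` are present there. All of them have mean zero on cells smaller than `R`. -/
lemma indicator_eq_czGood_add (hRQ : tri R ⊆ tri Q)
    (hns : ∀ k, R.1 ≤ k → ∀ x ∈ tri R, ¬ Heavy (fun y => ‖f y‖ₑ ^ p) Q k (idx k x)) :
    (tri R).indicator f = fun x => (tri R).indicator (czGood f p Q) x +
      ∑' m : ℕ, (tri R).indicator (czBad f p Q (R.1 - 1 - m)) x := by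
  ext x
  by_cases hx : x ∈ tri R
  · simp only [Set.indicator_of_mem hx]
    have hs := hasSum_czBad f p Q x
    have hinj : Function.Injective fun m : ℕ => R.1 - 1 - (m : ℤ) := fun m n hmn => by
      simp only at hmn; omega
    rw [← hinj.hasSum_iff] at hs
    · rw [show (∑' m : ℕ, czBad f p Q (R.1 - 1 - m) x) = _ from hs.tsum_eq,
        Set.indicator_of_mem (hRQ hx)]
      ring
    · intro j hj
      refine czBad_of_not fun hM => hj ⟨(R.1 - 1 - j).toNat, ?_⟩
      have : j < R.1 := by
        by_contra! h
        exact hns j h x hx hM.1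
      simp only; omega
  · simp [Set.indicator_of_notMem hx]

lemma lpn_czGood_le (hf : Continuous f) (hp : 1 ≤ p) :
    lpn p ((tri R).indicator (czGood f p Q)) ≤
      (2 ^ d * heavyLevel (fun y => ‖f y‖ₑ ^ p) Q *
        (3 ^ d * (2 : ℝ≥0∞) ^ ((R.1 : ℝ) * d))) ^ (1 / p) := by
  rw [lpn_indicator (by linarith) (measurableSet_tri R)]
  refine ENNReal.rpow_le_rpow ?_ (by positivity)
  rw [← volume_tri, ← setLIntegral_const]
  exact setLIntegral_mono measurable_const fun x _ => enorm_czGood_le hf hp x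

/-- The cells that make up `tri R` are not heavy, so `f` itself has controlled size on `tri R`,
though perhaps not on smaller cells. -/
lemma lpn_indicator_tri_le (hp : 0 < p) (hRQ : tri R ⊆ tri Q)
    (hns : ∀ x ∈ tri R, ¬ Heavy (fun y => ‖f y‖ₑ ^ p) Q R.1 (idx R.1 x)) :
    lpn p ((tri R).indicator f) ≤ (heavyLevel (fun y => ‖f y‖ₑ ^ p) Q *
        (3 ^ d * (2 : ℝ≥0∞) ^ ((R.1 : ℝ) * d))) ^ (1 / p) := by
  rw [lpn_indicator hp (measurableSet_tri R)]
  refine ENNReal.rpow_le_rpow ?_ (by positivity)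
  rw [← volume_tri]
  calc ∫⁻ x in tri R, ‖f x‖ₑ ^ p = ∫⁻ x in tri R, (tri Q).indicator (fun y => ‖f y‖ₑ ^ p) x :=
        setLIntegral_congr_fun (measurableSet_tri R) fun x hx => by
          rw [Set.indicator_of_mem (hRQ hx)]
    _ ≤ _ := lintegral_le_of_cells (P := fun n => Near n R.2) fun n hn => by
        refine lintegral_le_of_not_heavy ?_
        have := hns (cellPt R.1 n) (by rw [tri, Set.mem_ofPred_eq, idx_cellPt]; exact hn)
        rwa [idx_cellPt] at this

variable [IsFiniteMeasure μ] in
/-- The estimate for one dyadic cube without heavy neighbours. -/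
theorem pairing_cell_le (H : IsLocalizedFamily μ A p q r ε C) (hp : 1 ≤ p) (hq : 1 ≤ q)
    (hpr : p ≤ r) (hqr : q ≤ r) (hf : IsBddCompact f) (hfc : Continuous f)
    (hg : IsBddCompact g) (hgc : Continuous g) (hh : IsBddCompact h) (hRQ : tri R ⊆ tri Q)
    (hnf : ∀ k, R.1 ≤ k → ∀ x ∈ tri R, ¬ Heavy (fun y => ‖f y‖ₑ ^ p) Q k (idx k x))
    (hng : ∀ k, R.1 ≤ k → ∀ x ∈ tri R, ¬ Heavy (fun y => ‖g y‖ₑ ^ q) Q k (idx k x)) :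
    pairing μ (A R.1) f g ((cell R.1 R.2).indicator h) ≤
      heavyLevel (fun y => ‖f y‖ₑ ^ p) Q ^ (1 / p) * heavyLevel (fun y => ‖g y‖ₑ ^ q) Q ^ (1 / q) *
      ((2 ^ d) ^ (1 / p) * (2 ^ d) ^ (1 / q) * μ Set.univ * (∫⁻ x in cell R.1 R.2, ‖h x‖ₑ) +
        ∑' m : ℕ, (2 : ℝ≥0∞) ^ ((-1 - (m : ℝ)) * ε) *
          (C * badConst d p q r *
            volume {x | MaxHeavy (fun y => ‖f y‖ₑ ^ p) Q (R.1 - 1 - m) x ∧ x ∈ tri R} ^ (1 / r) +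
          C * badConst d q p r * (2 ^ d) ^ (1 / p) *
            volume {x | MaxHeavy (fun y => ‖g y‖ₑ ^ q) Q (R.1 - 1 - m) x ∧ x ∈ tri R} ^ (1 / r)) *
          lpn (r / (r - 1)) ((cell R.1 R.2).indicator h)) := by
  have hp0 : 0 < p := by linarith
  have hq0 : 0 < q := by linarith
  obtain ⟨hfm, M, hM, -⟩ := id hf
  obtain ⟨hgm, N, hN, -⟩ := id hg
  have hE := H.countable R.1
  set hR := (cell R.1 R.2).indicator h with hRdef
  have hhR : IsBddCompact hR := hh.indicator (measurableSet_cell _ _)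
  set cf := heavyLevel (fun y => ‖f y‖ₑ ^ p) Q with hcf
  set cg := heavyLevel (fun y => ‖g y‖ₑ ^ q) Q with hcg
  have hinj : Function.Injective fun m : ℕ => R.1 - 1 - (m : ℤ) := fun m n hmn => by
    simp only at hmn; omega
  set γf := (tri R).indicator (czGood f p Q) with hγf
  set γg := (tri R).indicator (czGood g q Q) with hγg
  set bf : ℕ → Rd d → ℂ := fun m => (tri R).indicator (czBad f p Q (R.1 - 1 - m)) with hbf
  set bg : ℕ → Rd d → ℂ := fun m => (tri R).indicator (czBad g q Q (R.1 - 1 - m)) with hbg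
  have hγf' : IsBddCompact γf :=
    isBddCompact_indicator_tri (measurable_czGood hfm) (norm_czGood_le hM) R
  have hγg' : IsBddCompact γg :=
    isBddCompact_indicator_tri (measurable_czGood hgm) (norm_czGood_le hN) R
  have hgT : IsBddCompact ((tri R).indicator g) := hg.indicator (measurableSet_tri R)
  have hbfm : ∀ m, Measurable (bf m) := fun m =>
    (measurable_czBad hfm _).indicator (measurableSet_tri R)
  have hbgm : ∀ m, Measurable (bg m) := fun m =>
    (measurable_czBad hgm _).indicator (measurableSet_tri R)
  have ef : (tri R).indicator f = fun x => γf x + ∑' m, bf m x := indicator_eq_czGood_add hRQ hnf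
  have eg : (tri R).indicator g = fun x => γg x + ∑' m, bg m x := indicator_eq_czGood_add hRQ hng
  have hbfs : IsBddCompact fun x => ∑' m, bf m x := by
    have : (fun x => ∑' m, bf m x) = fun x => (tri R).indicator f x - γf x := by
      rw [ef]; ext x; simp
    rw [this]
    exact (hf.indicator (measurableSet_tri R)).sub hγf'
  have hbgs : IsBddCompact fun x => ∑' m, bg m x := by
    have : (fun x => ∑' m, bg m x) = fun x => (tri R).indicator g x - γg x := by
      rw [eg]; ext x; simp
    rw [this]
    exact hgT.sub hγg'
  -- The function `g` is decomposed only against the good part of `f`. Against the bad part of `f`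
  -- its size on `tri R` is enough, so no term has two bad functions.
  have S1 : pairing μ (A R.1) ((tri R).indicator f) ((tri R).indicator g) hR ≤
      pairing μ (A R.1) γf γg hR + ∑' m, pairing μ (A R.1) γf (bg m) hR +
        ∑' m, pairing μ (A R.1) (bf m) ((tri R).indicator g) hR := by
    conv_lhs => rw [ef]
    refine (pairing_add_left_le hE hγf' hbfs hgT hhR).trans (add_le_add ?_ ?_)
    · conv_lhs => rw [eg]
      refine (pairing_add_mid_le hE hγf' hγg' hbgs hhR).trans ?_
      gcongr
      exact pairing_tsum_right_le μ hE hbgm (M := (N + N).toNNReal)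
        (fun x => tsum_enorm_czBad_le hN hinj _ x) hγf' hhR.1
    · exact pairing_tsum_left_le μ hE hbfm (M := (M + M).toNNReal)
        (fun x => tsum_enorm_czBad_le hM hinj _ x) hgT hhR.1
  have T0 : pairing μ (A R.1) γf γg hR ≤ cf ^ (1 / p) * cg ^ (1 / q) *
      ((2 ^ d) ^ (1 / p) * (2 ^ d) ^ (1 / q) * μ Set.univ * (∫⁻ x in cell R.1 R.2, ‖h x‖ₑ)) := by
    have key : ∀ {e : ℝ} {u : Rd d → ℂ}, Continuous u → 1 ≤ e → ∀ x,
        ‖(tri R).indicator (czGood u e Q) x‖ₑ ≤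
          (2 ^ d) ^ (1 / e) * heavyLevel (fun y => ‖u y‖ₑ ^ e) Q ^ (1 / e) := by
      intro e u hu he x
      rw [← ENNReal.mul_rpow_of_nonneg _ _ (by positivity), one_div,
        ENNReal.le_rpow_inv_iff (by linarith)]
      refine (ENNReal.rpow_le_rpow (enorm_indicator_le_enorm_self _ _) (by linarith)).trans ?_
      exact enorm_czGood_le hu he x
    calc pairing μ (A R.1) γf γg hR ≤ ∫⁻ x, ((2 ^ d) ^ (1 / p) * cf ^ (1 / p)) *
          ((2 ^ d) ^ (1 / q) * cg ^ (1 / q)) * μ Set.univ * ‖hR x‖ₑ :=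
          lintegral_mono fun x => mul_le_mul_left
            (averageMax_le_const μ _ (key hfc hp) (key hgc hq) x) _
      _ = ((2 ^ d) ^ (1 / p) * cf ^ (1 / p)) * ((2 ^ d) ^ (1 / q) * cg ^ (1 / q)) * μ Set.univ *
          ∫⁻ x in cell R.1 R.2, ‖h x‖ₑ := by
          rw [lintegral_const_mul _ hhR.1.enorm, ← lintegral_indicator (measurableSet_cell _ _)]
          congr 2
          ext x
          rw [hRdef, enorm_indicator_eq_indicator_enorm]
      _ = _ := by ring
  have T1 : ∀ m, pairing μ (A R.1) γf (bg m) hR ≤ cf ^ (1 / p) * cg ^ (1 / q) *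
      ((2 : ℝ≥0∞) ^ ((-1 - (m : ℝ)) * ε) * (C * badConst d q p r * (2 ^ d) ^ (1 / p) *
        volume {x | MaxHeavy (fun y => ‖g y‖ₑ ^ q) Q (R.1 - 1 - m) x ∧ x ∈ tri R} ^ (1 / r)) *
          lpn (r / (r - 1)) hR) := by
    intro m
    rw [← pairing_swap]
    refine (pairing_czBad_le H.swap hq hp hqr hg (by omega) hγf' hhR
      (lpn_czGood_le hfc hp)).trans_eq ?_
    rw [ENNReal.mul_rpow_of_nonneg _ _ (by positivity)]
    have : ((R.1 - 1 - m : ℤ) : ℝ) - R.1 = -1 - (m : ℝ) := by push_cast; ring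
    rw [this]; ring
  have T2 : ∀ m, pairing μ (A R.1) (bf m) ((tri R).indicator g) hR ≤ cf ^ (1 / p) * cg ^ (1 / q) *
      ((2 : ℝ≥0∞) ^ ((-1 - (m : ℝ)) * ε) * (C * badConst d p q r *
        volume {x | MaxHeavy (fun y => ‖f y‖ₑ ^ p) Q (R.1 - 1 - m) x ∧ x ∈ tri R} ^ (1 / r)) *
          lpn (r / (r - 1)) hR) := by
    intro m
    refine (pairing_czBad_le H hp hq hpr hf (by omega) hgT hhR
      (lpn_indicator_tri_le hq0 hRQ (hng R.1 le_rfl))).trans_eq ?_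
    have : ((R.1 - 1 - m : ℤ) : ℝ) - R.1 = -1 - (m : ℝ) := by push_cast; ring
    rw [this]; ring
  rw [pairing_localize H R f g h]
  refine S1.trans ?_
  refine (add_le_add (add_le_add T0 (ENNReal.tsum_le_tsum T1))
    (ENNReal.tsum_le_tsum T2)).trans_eq ?_
  rw [ENNReal.tsum_mul_left, ENNReal.tsum_mul_left, ← mul_add, ← mul_add, add_assoc,
    ← ENNReal.tsum_add]
  congr 3
  ext m
  ring

end cell_estimate

/-! ### Summation over the cells governed by one cube. -/

section local_sum

variable {d : ℕ} {F G : Rd d → ℝ≥0∞} {Q : DyadicCube d}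

/-- The dyadic subcubes of `Q` which lie in no stopping cell. -/
def Governed (F G : Rd d → ℝ≥0∞) (Q P : DyadicCube d) : Prop :=
  P.1 ≤ Q.1 ∧ idx Q.1 (cellPt P.1 P.2 : Rd d) = Q.2 ∧
    ∀ k, P.1 ≤ k → ¬ Stop F G Q k (idx k (cellPt P.1 P.2))

lemma Governed.cell_subset {P : DyadicCube d} (h : Governed F G Q P) :
    cell P.1 P.2 ⊆ cell (d := d) Q.1 Q.2 := fun x hx => by
  rw [cell, Set.mem_ofPred_eq, ← h.2.1]
  refine idx_eq_of_le (k := P.1) ?_ h.1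
  rw [idx_cellPt]; exact hx

lemma Governed.near {P : DyadicCube d} {x : Rd d} (hx : x ∈ tri P) {k : ℤ} (hk : P.1 ≤ k) :
    Near (idx k x) (idx k (cellPt P.1 P.2 : Rd d)) :=
  near_of_le (by rw [idx_cellPt]; exact hx) hk

lemma Governed.tri_subset {P : DyadicCube d} (h : Governed F G Q P) : tri P ⊆ tri Q :=
  fun x hx => by
    have := Governed.near hx h.1
    rwa [h.2.1] at this

lemma Governed.not_heavy {P : DyadicCube d} (h : Governed F G Q P) {k : ℤ} (hk : P.1 ≤ k) {x : Rd d}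
    (hx : x ∈ tri P) : ¬ Heavy F Q k (idx k x) ∧ ¬ Heavy G Q k (idx k x) :=
  ⟨fun hH => h.2.2 k hk ⟨_, (Governed.near hx hk).symm, Or.inl hH⟩,
    fun hH => h.2.2 k hk ⟨_, (Governed.near hx hk).symm, Or.inr hH⟩⟩

/-- The sets `X k` being disjoint for different scales, and cells of one scale being disjoint, the
pieces of `h` do not overlap. Without the `X k` each point would count once for every scale. -/
lemma tsum_lintegral_indicator_le {X : ℤ → Set (Rd d)} (hX : ∀ k, MeasurableSet (X k))
    (hXd : Pairwise (Function.onFun Disjoint X)) (h : Rd d → ℂ) {e : ℝ} (he : 0 < e) :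
    ∑' P : {P // Governed F G Q P}, ∫⁻ x in cell P.1.1 P.1.2, ‖(X P.1.1).indicator h x‖ₑ ^ e ≤
      ∫⁻ x in cell Q.1 Q.2, ‖h x‖ₑ ^ e := by
  let U : {P // Governed F G Q P} → Set (Rd d) := fun P => X P.1.1 ∩ cell P.1.1 P.1.2
  have hU : ∀ P, MeasurableSet (U P) := fun P => (hX _).inter (measurableSet_cell _ _)
  have hUd : Pairwise (Function.onFun Disjoint U) := by
    intro P P' hPP
    refine Set.disjoint_left.2 fun x hx hx' => hPP (Subtype.ext (Prod.ext ?_ ?_))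
    · by_contra hk
      exact Set.disjoint_left.1 (hXd hk) hx.1 hx'.1
    · have hk : P.1.1 = P'.1.1 := by
        by_contra hk
        exact Set.disjoint_left.1 (hXd hk) hx.1 hx'.1
      rw [← show idx P.1.1 x = P.1.2 from hx.2, ← show idx P'.1.1 x = P'.1.2 from hx'.2, hk]
  have e1 : ∀ P : {P // Governed F G Q P}, ∫⁻ x in cell P.1.1 P.1.2,
      ‖(X P.1.1).indicator h x‖ₑ ^ e = ∫⁻ x in U P, ‖h x‖ₑ ^ e := fun P => by
    rw [indicator_rpow_enorm he, lintegral_indicator (hX _), Measure.restrict_restrict (hX _)]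
  simp only [e1]
  rw [← lintegral_iUnion hU hUd]
  exact lintegral_mono_set (Set.iUnion_subset fun P => Set.inter_subset_right.trans P.2.cell_subset)

/-- For a fixed offset `m` the maximal heavy scale at `x` determines the scale of `P`, and then `P`
is one of the `3 ^ d` neighbours of the cell of `x`. The overlap `3 ^ d` times the volume of `tri Q`
gives `9 ^ d`. -/
lemma tsum_volume_maxHeavy_le (F' : Rd d → ℝ≥0∞) (m : ℤ) :
    ∑' P : {P // Governed F G Q P}, volume {x | MaxHeavy F' Q (P.1.1 - m) x ∧ x ∈ tri P.1} ≤
      9 ^ d * (2 : ℝ≥0∞) ^ ((Q.1 : ℝ) * d) := by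
  let U : (Fin d → Fin 3) → {P // Governed F G Q P} → Set (Rd d) := fun o P =>
    {x | MaxHeavy F' Q (P.1.1 - m) x} ∩ (tri P.1 ∩ cell P.1.1 fun i => P.1.2 i + ((o i : ℤ) - 1))
  have hU : ∀ o P, MeasurableSet (U o P) := fun o P => (measurableSet_maxHeavy _ _ _).inter
    ((measurableSet_tri _).inter (measurableSet_cell _ _))
  have hUd : ∀ o, Pairwise (Function.onFun Disjoint (U o)) := by
    intro o P P' hPP
    refine Set.disjoint_left.2 fun x hx hx' => hPP (Subtype.ext ?_)
    have hk : P.1.1 = P'.1.1 := by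
      have := hx.1.unique hx'.1
      omega
    refine Prod.ext hk (funext fun i => ?_)
    have h1 := congrFun (show idx P.1.1 x = _ from hx.2.2) i
    have h2 := congrFun (show idx P'.1.1 x = _ from hx'.2.2) i
    rw [hk, h2] at h1
    omega
  have hcov : ∀ P : {P // Governed F G Q P},
      {x | MaxHeavy F' Q (P.1.1 - m) x ∧ x ∈ tri P.1} ⊆ ⋃ o, U o P := by
    rintro P x ⟨hx, hxt⟩
    have hi : ∀ i, 0 ≤ idx P.1.1 x i - P.1.2 i + 1 ∧ idx P.1.1 x i - P.1.2 i + 1 < 3 := fun i => by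
      have := abs_le.1 (hxt i)
      omega
    refine Set.mem_iUnion.2 ⟨fun i => ⟨(idx P.1.1 x i - P.1.2 i + 1).toNat, ?_⟩, hx, hxt, ?_⟩
    · have := hi i; omega
    · rw [cell, Set.mem_ofPred_eq]
      ext i
      have := hi i
      simp only
      omega
  calc _ ≤ ∑' P : {P // Governed F G Q P}, ∑ o, volume (U o P) :=
        ENNReal.tsum_le_tsum fun P => (measure_mono (hcov P)).trans (measure_iUnion_fintype_le _ _)
    _ = ∑ o, ∑' P : {P // Governed F G Q P}, volume (U o P) :=
        Summable.tsum_finsetSum fun _ _ => ENNReal.summable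
    _ = ∑ o, volume (⋃ P, U o P) := by
        refine Finset.sum_congr rfl fun o _ => ?_
        rw [measure_iUnion (hUd o) (hU o)]
    _ ≤ ∑ _o : Fin d → Fin 3, volume (tri Q) := by
        refine Finset.sum_le_sum fun o _ => measure_mono (Set.iUnion_subset fun P x hx => ?_)
        exact P.2.tri_subset hx.2.1
    _ = _ := by
        rw [Finset.sum_const, Finset.card_univ, Fintype.card_fun, Fintype.card_fin,
          Fintype.card_fin, volume_tri, nsmul_eq_mul, ← mul_assoc]
        push_cast
        rw [← mul_pow]
        norm_num

lemma tsum_mul_le_Lp_mul_Lq {ι : Type*} [Countable ι] {r s : ℝ} (hrs : r.HolderConjugate s)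
    (a b : ι → ℝ≥0∞) :
    ∑' i, a i * b i ≤ (∑' i, a i ^ r) ^ (1 / r) * (∑' i, b i ^ s) ^ (1 / s) := by
  let _ : MeasurableSpace ι := ⊤
  have h := ENNReal.lintegral_mul_le_Lp_mul_Lq Measure.count hrs
    (measurable_of_countable a).aemeasurable (measurable_of_countable b).aemeasurable
  simpa only [lintegral_count, Pi.mul_apply] using h

lemma tsum_two_rpow_ne_top {ε : ℝ} (hε : 0 < ε) :
    ∑' m : ℕ, (2 : ℝ≥0∞) ^ ((-1 - (m : ℝ)) * ε) ≠ ∞ := by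
  have e : ∀ m : ℕ, (2 : ℝ≥0∞) ^ ((-1 - (m : ℝ)) * ε) = 2 ^ (-ε) * (2 ^ (-ε)) ^ m := fun m => by
    rw [← ENNReal.rpow_natCast, ← ENNReal.rpow_mul, ← two_rpow_add]
    congr 1; ring
  simp only [e]
  rw [ENNReal.tsum_mul_left, ENNReal.tsum_geometric]
  refine ENNReal.mul_ne_top (two_rpow_ne_top _) (ENNReal.inv_ne_top.2 ?_)
  have : (2 : ℝ≥0∞) ^ (-ε) < 1 := ENNReal.rpow_lt_one_of_one_lt_of_neg (by norm_num) (by linarith)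
  exact (tsub_pos_of_lt this).ne'

/-- The constant in the local estimate. -/
def localConst {d : ℕ} (μ : Measure (Rd d × Rd d)) (p q r ε : ℝ) (C : ℝ≥0) : ℝ≥0∞ :=
  (2 ^ d) ^ (1 / p) * (2 ^ d) ^ (1 / q) * μ Set.univ +
    (∑' m : ℕ, (2 : ℝ≥0∞) ^ ((-1 - (m : ℝ)) * ε)) *
      ((C * badConst d p q r + C * badConst d q p r * (2 ^ d) ^ (1 / p)) * (9 ^ d) ^ (1 / r))

lemma localConst_ne_top (μ : Measure (Rd d × Rd d)) [IsFiniteMeasure μ] {p q r ε : ℝ} (C : ℝ≥0)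
    (hε : 0 < ε) : localConst μ p q r ε C ≠ ∞ := by
  have h2 : ∀ e : ℝ, ((2 : ℝ≥0∞) ^ d) ^ e ≠ ∞ := fun e =>
    ENNReal.rpow_ne_top_of_ne_zero (by simp) (by simp)
  have h9 : ∀ e : ℝ, ((9 : ℝ≥0∞) ^ d) ^ e ≠ ∞ := fun e =>
    ENNReal.rpow_ne_top_of_ne_zero (by simp) (by simp)
  refine ENNReal.add_ne_top.2 ⟨?_, ENNReal.mul_ne_top (tsum_two_rpow_ne_top hε)
    (ENNReal.mul_ne_top (ENNReal.add_ne_top.2 ⟨?_, ?_⟩) (h9 _))⟩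
  · exact ENNReal.mul_ne_top (ENNReal.mul_ne_top (h2 _) (h2 _)) (measure_ne_top _ _)
  · exact ENNReal.mul_ne_top ENNReal.coe_ne_top (badConst_ne_top _ _ _ _)
  · exact ENNReal.mul_ne_top (ENNReal.mul_ne_top ENNReal.coe_ne_top (badConst_ne_top _ _ _ _)) (h2 _)

/-- The sum over all dyadic cubes governed by `Q`. -/
theorem tsum_pairing_governed_le {μ : Measure (Rd d × Rd d)} [IsFiniteMeasure μ] {A : ℤ → Set ℝ}
    {p q r ε : ℝ} {C : ℝ≥0} (H : IsLocalizedFamily μ A p q r ε C) (hp : 1 ≤ p) (hq : 1 ≤ q)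
    (hr : 1 < r) (hpr : p ≤ r) (hqr : q ≤ r) {f g h : Rd d → ℂ} (hf : IsBddCompact f)
    (hfc : Continuous f) (hg : IsBddCompact g) (hgc : Continuous g) (hh : IsBddCompact h)
    {X : ℤ → Set (Rd d)} (hX : ∀ k, MeasurableSet (X k))
    (hXd : Pairwise (Function.onFun Disjoint X)) :
    ∑' P : {P // Governed (fun y => ‖f y‖ₑ ^ p) (fun y => ‖g y‖ₑ ^ q) Q P},
        pairing μ (A P.1.1) f g ((cell P.1.1 P.1.2).indicator ((X P.1.1).indicator h)) ≤
      localConst μ p q r ε C * (heavyLevel (fun y => ‖f y‖ₑ ^ p) Q ^ (1 / p) *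
        heavyLevel (fun y => ‖g y‖ₑ ^ q) Q ^ (1 / q)) *
        (((2 : ℝ≥0∞) ^ ((Q.1 : ℝ) * d)) ^ (1 / r) *
          (∫⁻ x in cell Q.1 Q.2, ‖h x‖ₑ ^ (r / (r - 1))) ^ (1 / (r / (r - 1)))) := by
  have hrs : r.HolderConjugate (r / (r - 1)) := Real.HolderConjugate.conjExponent hr
  set s := r / (r - 1) with hs
  have hr0 : 0 < r := by linarith
  have hs0 : 0 < s := hrs.symm.pos
  set F := fun y => ‖f y‖ₑ ^ p with hF
  set G := fun y => ‖g y‖ₑ ^ q with hG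
  set c := heavyLevel F Q ^ (1 / p) * heavyLevel G Q ^ (1 / q) with hc
  set v := (2 : ℝ≥0∞) ^ ((Q.1 : ℝ) * d) with hv
  set Z := (∫⁻ x in cell Q.1 Q.2, ‖h x‖ₑ ^ s) ^ (1 / s) with hZ
  set N : {P // Governed F G Q P} → ℝ≥0∞ := fun P =>
    lpn s ((cell P.1.1 P.1.2).indicator ((X P.1.1).indicator h)) with hN
  have hNs : (∑' P, N P ^ s) ^ (1 / s) ≤ Z := by
    refine ENNReal.rpow_le_rpow ?_ (by positivity)
    refine le_trans (le_of_eq (tsum_congr fun P => ?_)) (tsum_lintegral_indicator_le hX hXd h hs0)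
    rw [hN]
    simp only
    rw [lpn_indicator hs0 (measurableSet_cell _ _), ← ENNReal.rpow_mul, one_div_mul_cancel hs0.ne',
      ENNReal.rpow_one]
  have h1 : ∑' P : {P // Governed F G Q P}, ∫⁻ x in cell P.1.1 P.1.2, ‖(X P.1.1).indicator h x‖ₑ ≤
      v ^ (1 / r) * Z := by
    have h1 := tsum_lintegral_indicator_le (F := F) (G := G) (Q := Q) hX hXd h one_pos
    simp only [ENNReal.rpow_one] at h1
    refine h1.trans ?_
    have := ENNReal.lintegral_mul_le_Lp_mul_Lq (volume.restrict (cell Q.1 Q.2)) hrs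
      (f := fun _ => 1) (g := fun x => ‖h x‖ₑ) aemeasurable_const hh.1.enorm.aemeasurable
    simpa [volume_cell, hv, hZ] using this
  -- Hölder over the cells with exponents `r` and `r'`: the volumes of the heavy sets add up to a
  -- multiple of that of `Q`, and the norms of the disjoint pieces of `h` to its norm on `Q`. The
  -- bound is uniform in `m`, leaving a geometric series.
  have hV : ∀ (F' : Rd d → ℝ≥0∞) (m : ℕ), ∑' P : {P // Governed F G Q P},
      volume {x | MaxHeavy F' Q (P.1.1 - 1 - m) x ∧ x ∈ tri P.1} ^ (1 / r) * N P ≤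
        (9 ^ d) ^ (1 / r) * (v ^ (1 / r) * Z) := by
    intro F' m
    refine (tsum_mul_le_Lp_mul_Lq hrs _ _).trans ?_
    rw [← mul_assoc, ← ENNReal.mul_rpow_of_nonneg _ _ (by positivity)]
    refine mul_le_mul' (ENNReal.rpow_le_rpow ?_ (by positivity)) hNs
    refine le_trans (le_of_eq (tsum_congr fun P => ?_)) (tsum_volume_maxHeavy_le F' (1 + m))
    rw [← ENNReal.rpow_mul, one_div_mul_cancel hr0.ne', ENNReal.rpow_one, sub_sub]
  set K1 := C * badConst d p q r
  set K2 := C * badConst d q p r * (2 ^ d) ^ (1 / p)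
  have step : ∀ P : {P // Governed F G Q P}, pairing μ (A P.1.1) f g
      ((cell P.1.1 P.1.2).indicator ((X P.1.1).indicator h)) ≤
        c * ((2 ^ d) ^ (1 / p) * (2 ^ d) ^ (1 / q) * μ Set.univ *
            (∫⁻ x in cell P.1.1 P.1.2, ‖(X P.1.1).indicator h x‖ₑ) +
          ∑' m : ℕ, (2 : ℝ≥0∞) ^ ((-1 - (m : ℝ)) * ε) *
            (K1 * volume {x | MaxHeavy F Q (P.1.1 - 1 - m) x ∧ x ∈ tri P.1} ^ (1 / r) +
              K2 * volume {x | MaxHeavy G Q (P.1.1 - 1 - m) x ∧ x ∈ tri P.1} ^ (1 / r)) *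
            N P) := fun P =>
    pairing_cell_le H hp hq hpr hqr hf hfc hg hgc (hh.indicator (hX _)) P.2.tri_subset
      (fun k hk x hx => (P.2.not_heavy hk hx).1) (fun k hk x hx => (P.2.not_heavy hk hx).2)
  refine (ENNReal.tsum_le_tsum step).trans ?_
  rw [ENNReal.tsum_mul_left, ENNReal.tsum_add, ENNReal.tsum_mul_left, ENNReal.tsum_comm]
  have h2 : ∑' (m : ℕ) (P : {P // Governed F G Q P}), (2 : ℝ≥0∞) ^ ((-1 - (m : ℝ)) * ε) *
      (K1 * volume {x | MaxHeavy F Q (P.1.1 - 1 - m) x ∧ x ∈ tri P.1} ^ (1 / r) +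
        K2 * volume {x | MaxHeavy G Q (P.1.1 - 1 - m) x ∧ x ∈ tri P.1} ^ (1 / r)) * N P ≤
      ∑' m : ℕ, (2 : ℝ≥0∞) ^ ((-1 - (m : ℝ)) * ε) *
        ((K1 + K2) * ((9 ^ d) ^ (1 / r) * (v ^ (1 / r) * Z))) := by
    refine ENNReal.tsum_le_tsum fun m => ?_
    simp only [mul_assoc]
    rw [ENNReal.tsum_mul_left]
    gcongr
    simp only [add_mul, mul_assoc]
    rw [ENNReal.tsum_add, ENNReal.tsum_mul_left, ENNReal.tsum_mul_left]
    gcongr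
    · exact hV F m
    · exact hV G m
  rw [ENNReal.tsum_mul_right] at h2
  calc _ ≤ c * ((2 ^ d) ^ (1 / p) * (2 ^ d) ^ (1 / q) * μ Set.univ * (v ^ (1 / r) * Z) +
        (∑' m : ℕ, (2 : ℝ≥0∞) ^ ((-1 - (m : ℝ)) * ε)) *
          ((K1 + K2) * ((9 ^ d) ^ (1 / r) * (v ^ (1 / r) * Z)))) := by gcongr
    _ = _ := by rw [localConst]; ring

/-- The level normalizes by the volume of the cell and the average by that of the tripled cube. The
ratio `3 ^ d` turns `4 * 3 ^ d` into `4 * 9 ^ d`. -/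
lemma heavyLevel_rpow_eq (f : Rd d → ℂ) {p : ℝ} (hp : 0 < p) (Q : DyadicCube d) :
    heavyLevel (fun y => ‖f y‖ₑ ^ p) Q ^ (1 / p) =
      (4 * 9 ^ d) ^ (1 / p) * localAverage f (triCube Q) p := by
  rw [localAverage, toSet_triCube, volume_tri, ← ENNReal.mul_rpow_of_nonneg _ _ (by positivity),
    heavyLevel, ENNReal.div_eq_inv_mul]
  congr 1
  rw [ENNReal.mul_inv (Or.inl (by simp)) (Or.inl (by simp))]
  have h9 : (9 : ℝ≥0∞) ^ d * (3 ^ d)⁻¹ = 3 ^ d := by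
    rw [show (9 : ℝ≥0∞) = 3 * 3 by norm_num, mul_pow, mul_assoc,
      ENNReal.mul_inv_cancel (by simp) (by simp), mul_one]
  calc _ = 4 * 3 ^ d * (((2 : ℝ≥0∞) ^ ((Q.1 : ℝ) * d))⁻¹ * ∫⁻ y in tri Q, ‖f y‖ₑ ^ p) := by ring
    _ = 4 * (9 ^ d * (3 ^ d)⁻¹) *
        (((2 : ℝ≥0∞) ^ ((Q.1 : ℝ) * d))⁻¹ * ∫⁻ y in tri Q, ‖f y‖ₑ ^ p) := by rw [h9]
    _ = _ := by ring

lemma rpow_mul_lintegral_eq (h : Rd d → ℂ) {r : ℝ} (hr : 1 < r) (Q : DyadicCube d) :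
    volume (tri Q) ^ (1 / r) *
        (∫⁻ x in tri Q, ‖h x‖ₑ ^ (r / (r - 1))) ^ (1 / (r / (r - 1))) =
      volume (tri Q) * localAverage h (triCube Q) (r / (r - 1)) := by
  have hrs : r.HolderConjugate (r / (r - 1)) := Real.HolderConjugate.conjExponent hr
  set s := r / (r - 1)
  have hs0 : 0 < s := hrs.symm.pos
  have ht : volume (tri Q) ≠ ∞ := by
    rw [volume_tri]; exact ENNReal.mul_ne_top (by simp) (two_rpow_ne_top _)
  have h0 : volume (tri Q) ≠ 0 := by
    rw [volume_tri]; exact mul_ne_zero (by simp) (two_rpow_ne_zero _)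
  rw [localAverage, toSet_triCube, ENNReal.mul_rpow_of_nonneg _ _ (by positivity), ← mul_assoc]
  congr 1
  have : 1 / r = 1 + -(1 / s) := by
    have := hrs.inv_add_inv_eq_one
    rw [one_div, one_div]; linarith
  rw [this, ENNReal.rpow_add _ _ h0 ht, ENNReal.rpow_one, ENNReal.rpow_neg, ENNReal.inv_rpow]

end local_sum

/-! ### The sparse bound for the supremum over all scales. -/

section sparse_bound

variable {d : ℕ} {μ : Measure (Rd d × Rd d)} {A : ℤ → Set ℝ}
  {p q r ε : ℝ} {C : ℝ≥0} {f g h : Rd d → ℂ}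

lemma pairing_le_tsum_cell {E : Set ℝ} (k : ℤ) (f g h : Rd d → ℂ) :
    pairing μ E f g h ≤ ∑' n, pairing μ E f g ((cell k n).indicator h) := by
  have hU : ⋃ n, cell (d := d) k n = Set.univ :=
    Set.eq_univ_of_forall fun x => Set.mem_iUnion.2 ⟨idx k x, rfl⟩
  have e : ∀ n, pairing μ E f g ((cell k n).indicator h) =
      ∫⁻ x in cell k n, averageMax μ E f g x * ‖h x‖ₑ := fun n => by
    rw [← lintegral_indicator (measurableSet_cell k n)]
    refine lintegral_congr fun x => ?_
    by_cases hx : x ∈ cell k n <;> simp [hx]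
  simp only [e]
  rw [pairing, ← setLIntegral_univ, ← hU]
  exact lintegral_iUnion_le _ _

lemma sparseForm_sel (F G : Rd d → ℝ≥0∞) (K : ℤ) (p q s : ℝ) (f g h : Rd d → ℂ) :
    sparseForm (triCube '' {Q | Sel F G K Q}) p q s f g h =
      ∑' Q : {Q : DyadicCube d | Sel F G K Q}, volume (tri Q.1) *
        (localAverage f (triCube Q) p * localAverage g (triCube Q) q *
          localAverage h (triCube Q) s) := by
  rw [sparseForm, tsum_image (fun Q : Cube d => volume Q.toSet *
    (localAverage f Q p * localAverage g Q q * localAverage h Q s)) triCube_injective.injOn]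
  simp only [toSet_triCube]

variable [IsFiniteMeasure μ] in
/-- The scales below the top scale are controlled by the sparse form. -/
theorem tsum_pairing_small_scales_le (H : IsLocalizedFamily μ A p q r ε C) (hp : 1 ≤ p)
    (hq : 1 ≤ q) (hr : 1 < r) (hpr : p ≤ r) (hqr : q ≤ r) (hf : IsBddCompact f)
    (hfc : Continuous f) (hg : IsBddCompact g) (hgc : Continuous g) (hh : IsBddCompact h)
    {X : ℤ → Set (Rd d)} (hX : ∀ k, MeasurableSet (X k))
    (hXd : Pairwise (Function.onFun Disjoint X)) (K : ℤ) :
    ∑' k : {k // k ≤ K}, pairing μ (A k) f g ((X k).indicator h) ≤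
      localConst μ p q r ε C * ((4 * 9 ^ d) ^ (1 / p) * (4 * 9 ^ d) ^ (1 / q)) *
        sparseForm (triCube '' {Q | Sel (fun y => ‖f y‖ₑ ^ p) (fun y => ‖g y‖ₑ ^ q) K Q}) p q
          (r / (r - 1)) f g h := by
  classical
  set F := fun y => ‖f y‖ₑ ^ p with hF
  set G := fun y => ‖g y‖ₑ ^ q with hG
  set T : DyadicCube d → ℝ≥0∞ := fun P =>
    pairing μ (A P.1) f g ((cell P.1 P.2).indicator ((X P.1).indicator h)) with hT
  -- Every cell below the top scale is governed by some selected cube. Governance by several cubes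
  -- would only enlarge the right-hand side.
  have h1 : ∀ P : DyadicCube d, P.1 ≤ K → T P ≤ ∑' Q : {Q : DyadicCube d | Sel F G K Q},
      {P | Governed F G Q P}.indicator T P := by
    intro P hP
    obtain ⟨Q, hQ, hPQ, hx, hs⟩ := exists_sel (F := F) (G := G) hP (cellPt P.1 P.2)
    have hgov : Governed F G Q P := ⟨hPQ, hx, hs⟩
    refine le_trans (le_of_eq ?_) (ENNReal.le_tsum (⟨Q, hQ⟩ : {Q : DyadicCube d | Sel F G K Q}))
    rw [Set.indicator_of_mem (show P ∈ {P | Governed F G Q P} from hgov)]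
  have h2 : ∀ Q : DyadicCube d, ∑' P, {P | Governed F G Q P}.indicator T P ≤
      localConst μ p q r ε C * ((4 * 9 ^ d) ^ (1 / p) * (4 * 9 ^ d) ^ (1 / q)) *
        (volume (tri Q) * (localAverage f (triCube Q) p * localAverage g (triCube Q) q *
          localAverage h (triCube Q) (r / (r - 1)))) := by
    intro Q
    rw [← tsum_subtype]
    refine (tsum_pairing_governed_le H hp hq hr hpr hqr hf hfc hg hgc hh hX hXd).trans ?_
    rw [heavyLevel_rpow_eq f (by linarith), heavyLevel_rpow_eq g (by linarith)]
    have hs0 : 0 < r / (r - 1) := div_pos (by linarith) (by linarith)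
    have hr0 : 0 < r := by linarith
    have h3 : ((2 : ℝ≥0∞) ^ ((Q.1 : ℝ) * d)) ^ (1 / r) *
        (∫⁻ x in cell Q.1 Q.2, ‖h x‖ₑ ^ (r / (r - 1))) ^ (1 / (r / (r - 1))) ≤
        volume (tri Q) * localAverage h (triCube Q) (r / (r - 1)) := by
      rw [← rpow_mul_lintegral_eq h hr]
      have h4 : (2 : ℝ≥0∞) ^ ((Q.1 : ℝ) * d) ≤ volume (tri Q) := by
        rw [← volume_cell Q.1 Q.2]; exact measure_mono (cell_subset_tri Q)
      have h5 : ∫⁻ x in cell Q.1 Q.2, ‖h x‖ₑ ^ (r / (r - 1)) ≤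
          ∫⁻ x in tri Q, ‖h x‖ₑ ^ (r / (r - 1)) := lintegral_mono_set (cell_subset_tri Q)
      gcongr
    refine (mul_le_mul_right h3 _).trans_eq ?_
    ring
  calc ∑' k : {k // k ≤ K}, pairing μ (A k) f g ((X k).indicator h)
      ≤ ∑' (k : {k // k ≤ K}) (n : Fin d → ℤ), T (k, n) :=
        ENNReal.tsum_le_tsum fun k => pairing_le_tsum_cell _ _ _ _
    _ ≤ ∑' (k : {k // k ≤ K}) (n : Fin d → ℤ), ∑' Q : {Q : DyadicCube d | Sel F G K Q},
          {P | Governed F G Q P}.indicator T (k.1, n) :=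
        ENNReal.tsum_le_tsum fun k => ENNReal.tsum_le_tsum fun n => h1 _ k.2
    _ ≤ ∑' (k : ℤ) (n : Fin d → ℤ), ∑' Q : {Q : DyadicCube d | Sel F G K Q},
          {P | Governed F G Q P}.indicator T (k, n) :=
        ENNReal.tsum_comp_le_tsum_of_injective Subtype.val_injective _
    _ = ∑' P : DyadicCube d, ∑' Q : {Q : DyadicCube d | Sel F G K Q},
          {P | Governed F G Q P}.indicator T P := ENNReal.tsum_prod.symm
    _ = ∑' Q : {Q : DyadicCube d | Sel F G K Q}, ∑' P : DyadicCube d,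
          {P | Governed F G Q P}.indicator T P := ENNReal.tsum_comm
    _ ≤ _ := by
        rw [sparseForm_sel, ← ENNReal.tsum_mul_left]
        exact ENNReal.tsum_le_tsum fun Q => h2 Q

lemma lpn_eq_of_support {e : ℝ} (he : 0 < e) {Q : DyadicCube d} (hs : ∀ x, x ∉ tri Q → f x = 0) :
    lpn e f = volume (tri Q) ^ (1 / e) * localAverage f (triCube Q) e := by
  have ht : volume (tri Q) ≠ ∞ := by
    rw [volume_tri]; exact ENNReal.mul_ne_top (by simp) (two_rpow_ne_top _)
  have h0 : volume (tri Q) ≠ 0 := by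
    rw [volume_tri]; exact mul_ne_zero (by simp) (two_rpow_ne_zero _)
  have ef : (tri Q).indicator f = f := by
    ext x
    by_cases hx : x ∈ tri Q
    · exact Set.indicator_of_mem hx f
    · rw [Set.indicator_of_notMem hx, hs x hx]
  rw [localAverage, toSet_triCube, ← ENNReal.mul_rpow_of_nonneg _ _ (by positivity), ← mul_assoc,
    ENNReal.mul_inv_cancel h0 ht, one_mul, ← lpn_indicator he (measurableSet_tri Q), ef]

/-- The scales above the top scale are controlled by a single cube. -/
theorem tsum_pairing_large_scales_le (H : IsLocalizedFamily μ A p q r ε C) (hp : 1 ≤ p)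
    (hq : 1 ≤ q) (hr : 1 < r) (hf : IsBddCompact f) (hg : IsBddCompact g) (hh : IsBddCompact h)
    {X : ℤ → Set (Rd d)} (hX : ∀ k, MeasurableSet (X k)) {Q : DyadicCube d}
    (hfs : ∀ x, x ∉ tri Q → f x = 0) (hgs : ∀ x, x ∉ tri Q → g x = 0)
    (hhs : ∀ x, x ∉ tri Q → h x = 0) :
    ∑' m : ℕ, pairing μ (A (Q.1 + 1 + m)) f g ((X (Q.1 + 1 + m)).indicator h) ≤
      C * (∑' m : ℕ, (2 : ℝ≥0∞) ^ ((-1 - (m : ℝ)) * (d * (1 / p + 1 / q - 1 / r)))) *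
        (3 ^ d) ^ (1 / p + 1 / q - 1 / r) *
        (volume (tri Q) * (localAverage f (triCube Q) p * localAverage g (triCube Q) q *
          localAverage h (triCube Q) (r / (r - 1)))) := by
  have hrs : r.HolderConjugate (r / (r - 1)) := Real.HolderConjugate.conjExponent hr
  set s := r / (r - 1) with hs
  have hs0 : 0 < s := hrs.symm.pos
  set V := volume (tri Q) with hV
  have ht : V ≠ ∞ := by
    rw [hV, volume_tri]; exact ENNReal.mul_ne_top (by simp) (two_rpow_ne_top _)
  have h0 : V ≠ 0 := by
    rw [hV, volume_tri]; exact mul_ne_zero (by simp) (two_rpow_ne_zero _)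
  set D : ℝ := d * (1 / p + 1 / q - 1 / r) with hD
  have hpow : V ^ (1 / p) * V ^ (1 / q) * V ^ (1 / s) =
      (3 ^ d) ^ (1 / p + 1 / q - 1 / r) * (2 : ℝ≥0∞) ^ ((Q.1 : ℝ) * D) * V := by
    rw [← ENNReal.rpow_add _ _ h0 ht, ← ENNReal.rpow_add _ _ h0 ht]
    have e1 : 1 / p + 1 / q + 1 / s = (1 / p + 1 / q - 1 / r) + 1 := by
      have := hrs.inv_add_inv_eq_one
      simp only [one_div]; linarith
    rw [e1, ENNReal.rpow_add _ _ h0 ht, ENNReal.rpow_one]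
    congr 1
    rw [hV, volume_tri, ENNReal.mul_rpow_of_ne_top (by simp) (two_rpow_ne_top _),
      ← ENNReal.rpow_mul]
    congr 2
    rw [hD]; ring
  -- Above the scale of the supports the scale invariant bound is enough: `2^(kd(1/r - 1/p - 1/q))`
  -- supplies the factor `2^((-1-m)D)` relative to the top cube.
  have hm : ∀ m : ℕ, pairing μ (A (Q.1 + 1 + m)) f g ((X (Q.1 + 1 + m)).indicator h) ≤
      (2 : ℝ≥0∞) ^ ((-1 - (m : ℝ)) * D) * (C * (3 ^ d) ^ (1 / p + 1 / q - 1 / r) *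
        (V * (localAverage f (triCube Q) p * localAverage g (triCube Q) q *
          localAverage h (triCube Q) s))) := by
    intro m
    refine (H.bound _ f g _ hf hg (hh.indicator (hX _))).trans ?_
    have h1 : lpn s ((X (Q.1 + 1 + m)).indicator h) ≤ lpn s h :=
      lpn_mono hs0.le fun x => enorm_indicator_le_enorm_self _ _
    have h2 : (2 : ℝ≥0∞) ^ (((Q.1 + 1 + m : ℤ) : ℝ) * (d * (1 / r - 1 / p - 1 / q))) =
        2 ^ ((-1 - (m : ℝ)) * D) * 2 ^ (-((Q.1 : ℝ) * D)) := by
      rw [← two_rpow_add]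
      congr 1
      push_cast
      rw [hD]; ring
    have h3 : (2 : ℝ≥0∞) ^ (-((Q.1 : ℝ) * D)) * 2 ^ ((Q.1 : ℝ) * D) = 1 := by
      rw [← two_rpow_add, neg_add_cancel, ENNReal.rpow_zero]
    calc _ ≤ C * (2 : ℝ≥0∞) ^ (((Q.1 + 1 + m : ℤ) : ℝ) * (d * (1 / r - 1 / p - 1 / q))) *
          lpn p f * lpn q g * lpn s h := by gcongr
      _ = C * (2 ^ ((-1 - (m : ℝ)) * D) * 2 ^ (-((Q.1 : ℝ) * D))) *
          (V ^ (1 / p) * V ^ (1 / q) * V ^ (1 / s)) *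
          (localAverage f (triCube Q) p * localAverage g (triCube Q) q *
            localAverage h (triCube Q) s) := by
          rw [h2, lpn_eq_of_support (by linarith) hfs, lpn_eq_of_support (by linarith) hgs,
            lpn_eq_of_support hs0 hhs]
          ring
      _ = (2 ^ ((-1 - (m : ℝ)) * D)) * (C * (3 ^ d) ^ (1 / p + 1 / q - 1 / r) *
          (V * (localAverage f (triCube Q) p * localAverage g (triCube Q) q *
            localAverage h (triCube Q) s))) *
          ((2 : ℝ≥0∞) ^ (-((Q.1 : ℝ) * D)) * 2 ^ ((Q.1 : ℝ) * D)) := by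
          rw [hpow]; ring
      _ = _ := by rw [h3, mul_one]
  refine (ENNReal.tsum_le_tsum hm).trans_eq ?_
  rw [ENNReal.tsum_mul_right]
  ring

variable [IsFiniteMeasure μ] in
/-- Linearization of a supremum over scales. -/
lemma exists_linearization (hA : ∀ k, (A k).Countable) (hf : Measurable f) (hg : Measurable g)
    (hfin : ∀ x, ⨆ k, averageMax μ (A k) f g x ≠ ∞) :
    ∃ X : ℤ → Set (Rd d), (∀ k, MeasurableSet (X k)) ∧ Pairwise (Function.onFun Disjoint X) ∧
      ∀ h : Rd d → ℂ, Measurable h → ∫⁻ x, (⨆ k, averageMax μ (A k) f g x) * ‖h x‖ₑ ≤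
        2 * ∑' k, pairing μ (A k) f g ((X k).indicator h) := by
  have hm : ∀ k, Measurable (averageMax μ (A k) f g) := fun k =>
    measurable_averageMax μ (hA k) hf hg
  set M : Rd d → ℝ≥0∞ := fun x => ⨆ k, averageMax μ (A k) f g x with hM
  have hMm : Measurable M := Measurable.iSup hm
  let e : ℕ ≃ ℤ := (Denumerable.eqv ℤ).symm
  -- The points where the scale number `n` attains at least half of the supremum, hence the factor 2
  -- in the conclusion. Finiteness of the supremum ensures that some scale does. Disjointifying
  -- selects one scale per point.
  let Y : ℕ → Set (Rd d) := fun n => {x | M x ≤ 2 * averageMax μ (A (e n)) f g x}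
  have hY : ∀ n, MeasurableSet (Y n) := fun n => measurableSet_le hMm ((hm _).const_mul 2)
  have hcov : ∀ x, ∃ n, x ∈ Y n := by
    intro x
    rcases eq_or_ne (M x) 0 with h0 | h0
    · exact ⟨0, by simp [Y, h0]⟩
    · have hlt : M x / 2 < ⨆ k, averageMax μ (A k) f g x := ENNReal.half_lt_self h0 (hfin x)
      obtain ⟨k, hk⟩ := lt_iSup_iff.1 hlt
      refine ⟨e.symm k, ?_⟩
      simp only [Y, Set.mem_ofPred_eq, Equiv.apply_symm_apply]
      rw [mul_comm]
      exact (ENNReal.div_le_iff_le_mul (by simp) (by simp)).1 hk.le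
  refine ⟨fun k => disjointed Y (e.symm k), fun k => .disjointed hY _, fun k k' hk =>
    disjoint_disjointed Y fun h => hk (e.symm.injective h), fun h hh => ?_⟩
  have hmm : ∀ k, Measurable fun x => averageMax μ (A k) f g x *
      ‖(disjointed Y (e.symm k)).indicator h x‖ₑ := fun k =>
    (hm k).mul (hh.indicator (MeasurableSet.disjointed hY _)).enorm
  unfold pairing
  rw [← lintegral_tsum fun k => (hmm k).aemeasurable, ← lintegral_const_mul' _ _ (by simp)]
  refine lintegral_mono fun x => ?_
  have hx : x ∈ ⋃ n, disjointed Y n := by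
    rw [iUnion_disjointed]; exact Set.mem_iUnion.2 (hcov x)
  obtain ⟨n, hn⟩ := Set.mem_iUnion.1 hx
  have hn' : M x ≤ 2 * averageMax μ (A (e n)) f g x := disjointed_subset Y n hn
  calc M x * ‖h x‖ₑ ≤ 2 * averageMax μ (A (e n)) f g x * ‖h x‖ₑ := by gcongr
    _ = 2 * (averageMax μ (A (e n)) f g x *
        ‖(disjointed Y (e.symm (e n))).indicator h x‖ₑ) := by
        rw [Equiv.symm_apply_apply, Set.indicator_of_mem hn, mul_assoc]
    _ ≤ _ := by
        gcongr
        exact ENNReal.le_tsum (f := fun k => averageMax μ (A k) f g x *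
          ‖(disjointed Y (e.symm k)).indicator h x‖ₑ) (e n)

lemma tsum_int_le (T : ℤ → ℝ≥0∞) (K : ℤ) :
    ∑' k, T k ≤ ∑' k : {k // k ≤ K}, T k + ∑' m : ℕ, T (K + 1 + m) := by
  have e := (ENNReal.summable (f := fun k : {k // k ≤ K} => T k)).tsum_add_tsum_compl
    (s := {k | k ≤ K}) (f := T) ENNReal.summable
  rw [← e]
  refine add_le_add le_rfl ?_
  let φ : ↥({k : ℤ | k ≤ K}ᶜ) → ℕ := fun k => (k.1 - (K + 1)).toNat
  have hφ : ∀ k : ↥({k : ℤ | k ≤ K}ᶜ), K + 1 + (φ k : ℤ) = k.1 := fun k => by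
    have : ¬ k.1 ≤ K := k.2
    simp only [φ]; omega
  have hφi : Function.Injective φ := fun k k' hk => Subtype.ext (by rw [← hφ, ← hφ k', hk])
  have h := ENNReal.tsum_comp_le_tsum_of_injective hφi fun m : ℕ => T (K + 1 + m)
  simp only [hφ] at h
  exact h

variable [IsFiniteMeasure μ] in
/-- Sparse bounds for the maximal function of a localized family. -/
theorem exists_sparse_bound (hd : 1 ≤ d) (H : IsLocalizedFamily μ A p q r ε C) (hε : 0 < ε)
    (hp : 1 ≤ p) (hq : 1 ≤ q) (hr : 1 < r) (hpr : p ≤ r) (hqr : q ≤ r) :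
    ∃ C' : ℝ≥0, ∀ f g h : Rd d → ℂ, IsBddCompact f → Continuous f → IsBddCompact g →
      Continuous g → IsBddCompact h → ∃ S : Set (Cube d), IsSparse (((3 : ℝ) ^ d)⁻¹ / 2) S ∧
        ∫⁻ x, (⨆ k, averageMax μ (A k) f g x) * ‖h x‖ₑ ≤
          C' * sparseForm S p q (r / (r - 1)) f g h := by
  have hp0 : 0 < p := by linarith
  have hq0 : 0 < q := by linarith
  have hr0 : 0 < r := by linarith
  -- Here `p ≤ r` and `q < ∞` make the inequality `1/p + 1/q > 1/r` strict. Together with `d ≥ 1`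
  -- this makes the series over large scales converge.
  have hθ : 0 < 1 / p + 1 / q - 1 / r := by
    have h1 : 1 / r ≤ 1 / p := one_div_le_one_div_of_le hp0 hpr
    have h2 : 0 < 1 / q := by positivity
    linarith
  have hD : 0 < (d : ℝ) * (1 / p + 1 / q - 1 / r) :=
    mul_pos (by exact_mod_cast hd) hθ
  set K1 := localConst μ p q r ε C * ((4 * 9 ^ d) ^ (1 / p) * (4 * 9 ^ d) ^ (1 / q)) with hK1
  set K2 := C * (∑' m : ℕ, (2 : ℝ≥0∞) ^ ((-1 - (m : ℝ)) * (d * (1 / p + 1 / q - 1 / r)))) *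
        (3 ^ d) ^ (1 / p + 1 / q - 1 / r) with hK2
  have h49 : ∀ e : ℝ, (4 * 9 ^ d : ℝ≥0∞) ^ e ≠ ∞ := fun e =>
    ENNReal.rpow_ne_top_of_ne_zero (mul_ne_zero (by simp) (by simp))
      (ENNReal.mul_ne_top (by simp) (by simp))
  have hK1t : K1 ≠ ∞ :=
    ENNReal.mul_ne_top (localConst_ne_top μ C hε) (ENNReal.mul_ne_top (h49 _) (h49 _))
  have hK2t : K2 ≠ ∞ :=
    ENNReal.mul_ne_top (ENNReal.mul_ne_top ENNReal.coe_ne_top (tsum_two_rpow_ne_top hD))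
      (ENNReal.rpow_ne_top_of_ne_zero (by simp) (by simp))
  refine ⟨(2 * (K1 + K2)).toNNReal, fun f g h hf hfc hg hgc hh => ?_⟩
  obtain ⟨hfm, M₁, hM₁, hM₁'⟩ := id hf
  obtain ⟨hgm, M₂, hM₂, hM₂'⟩ := id hg
  obtain ⟨hhm, M₃, hM₃, hM₃'⟩ := id hh
  -- A scale at which the triple of the cube at the origin contains the supports of all three
  -- functions.
  obtain ⟨K, hK⟩ := pow_unbounded_of_one_lt (max M₁ (max M₂ M₃)) (one_lt_two)
  set Q : DyadicCube d := ((K : ℤ), 0) with hQ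
  have hball : ∀ x, x ∉ tri Q → (2 : ℝ) ^ K < ‖x‖ := by
    intro x hx
    by_contra! hle
    refine hx ?_
    have h1 : Near (idx (K : ℤ) x) (idx (K : ℤ) (0 : Rd d)) :=
      near_idx_of_norm_le (by simpa using hle)
    have h2 : idx (K : ℤ) (0 : Rd d) = 0 := by ext i; simp [idx]
    rwa [h2] at h1
  have hfs : ∀ x, x ∉ tri Q → f x = 0 := fun x hx =>
    hM₁' x ((le_max_left _ _).trans_lt (hK.trans (hball x hx)))
  have hgs : ∀ x, x ∉ tri Q → g x = 0 := fun x hx =>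
    hM₂' x (((le_max_left _ _).trans (le_max_right _ _)).trans_lt (hK.trans (hball x hx)))
  have hhs : ∀ x, x ∉ tri Q → h x = 0 := fun x hx =>
    hM₃' x (((le_max_right _ _).trans (le_max_right _ _)).trans_lt (hK.trans (hball x hx)))
  have hfin : ∀ x, ⨆ k, averageMax μ (A k) f g x ≠ ∞ := by
    intro x
    refine ne_top_of_le_ne_top (b := ENNReal.ofReal M₁ * ENNReal.ofReal M₂ * μ Set.univ) ?_
      (iSup_le fun k => averageMax_le_const μ _ (fun x => ?_) (fun x => ?_) x)
    · exact ENNReal.mul_ne_top (ENNReal.mul_ne_top (by simp) (by simp)) (measure_ne_top _ _)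
    · rw [← ofReal_norm]; exact ENNReal.ofReal_le_ofReal (hM₁ x)
    · rw [← ofReal_norm]; exact ENNReal.ofReal_le_ofReal (hM₂ x)
  obtain ⟨X, hX, hXd, hlin⟩ := exists_linearization H.countable hfm hgm hfin
  have hint : ∀ {u : Rd d → ℂ} {e : ℝ}, IsBddCompact u → 0 < e → ∫⁻ x, ‖u x‖ₑ ^ e ≠ ∞ := by
    intro u e hu he
    rw [← lpn_rpow he]
    exact ENNReal.rpow_ne_top_of_nonneg he.le (lpn_lt_top hu he).ne
  set S := triCube '' {Q : DyadicCube d | Sel (fun y => ‖f y‖ₑ ^ p) (fun y => ‖g y‖ₑ ^ q) K Q}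
    with hS
  refine ⟨S, isSparse_sel (hint hf hp0) (hint hg hq0) K, ?_⟩
  have hsmall := tsum_pairing_small_scales_le H hp hq hr hpr hqr hf hfc hg hgc hh hX hXd K
  have hlarge := tsum_pairing_large_scales_le H hp hq hr hf hg hh hX hfs hgs hhs
  -- All cubes of the top scale are selected, so the contribution of the large scales is dominated
  -- by a single term of the same sparse form.
  have hone : volume (tri Q) * (localAverage f (triCube Q) p * localAverage g (triCube Q) q *
      localAverage h (triCube Q) (r / (r - 1))) ≤ sparseForm S p q (r / (r - 1)) f g h := by
    rw [hS, sparseForm_sel]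
    exact ENNReal.le_tsum (f := fun Q : {Q : DyadicCube d | Sel (fun y => ‖f y‖ₑ ^ p)
      (fun y => ‖g y‖ₑ ^ q) K Q} => volume (tri Q.1) *
        (localAverage f (triCube Q) p * localAverage g (triCube Q) q *
          localAverage h (triCube Q) (r / (r - 1)))) ⟨Q, Sel.top 0⟩
  have hsplit : ∑' k, pairing μ (A k) f g ((X k).indicator h) ≤
      ∑' k : {k // k ≤ (K : ℤ)}, pairing μ (A k) f g ((X k).indicator h) +
        ∑' m : ℕ, pairing μ (A (Q.1 + 1 + m)) f g ((X (Q.1 + 1 + m)).indicator h) :=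
    tsum_int_le (fun k => pairing μ (A k) f g ((X k).indicator h)) K
  refine (hlin h hhm).trans ?_
  rw [ENNReal.coe_toNNReal (ENNReal.mul_ne_top (by simp) (ENNReal.add_ne_top.2 ⟨hK1t, hK2t⟩)),
    mul_assoc]
  gcongr
  refine hsplit.trans ?_
  rw [add_mul]
  exact add_le_add hsmall (hlarge.trans (mul_le_mul_right hone _))

end sparse_bound

/-! ### The multi-scale maximal operator. -/

/-- For test functions the averages are continuous in `t`, so a dense subset of `E` gives the same
supremum. The shift by `c` is harmless in a supremum over all integers. -/
lemma multiScaleMaximal_eq {d : ℕ} (μ : Measure (Rd d × Rd d)) [IsFiniteMeasure μ]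
    {E E' : Set ℝ} (hE' : E' ⊆ E) (hEE' : E ⊆ closure E') {f g : Rd d → ℂ}
    (hf : IsTestFunction f) (hg : IsTestFunction g) (c : ℤ) (x : Rd d) :
    multiScaleMaximal (fourierMeasure μ) E f g x =
      ⨆ k : ℤ, averageMax μ (scaleSet E' (k - c)) f g x := by
  have h := fun t => bilinearMultiplier_fourierMeasure μ t (hf.2.toSchwartzMap hf.1)
    (hg.2.toSchwartzMap hg.1) x
  have e1 : (hf.2.toSchwartzMap hf.1 : Rd d → ℂ) = f := rfl
  have e2 : (hg.2.toSchwartzMap hg.1 : Rd d → ℂ) = g := rfl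
  rw [e1, e2] at h
  obtain ⟨-, M, hM, -⟩ := hf.isBddCompact
  obtain ⟨-, N, hN, -⟩ := hg.isBddCompact
  have hc : Continuous fun t => bilinearAverage μ t f g x :=
    (continuous_bilinearAverage μ hf.1.continuous hg.1.continuous hM hN).comp
      (Continuous.prodMk_left x)
  have key : ∀ l : ℤ, ⨆ t ∈ E, ‖bilinearAverage μ (t * (2 : ℝ) ^ l) f g x‖ₑ =
      averageMax μ (scaleSet E' l) f g x := by
    intro l
    simp only [averageMax, scaleSet, iSup_image]
    refine le_antisymm (iSup₂_le fun t ht => ?_) (biSup_mono hE')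
    have hcl : IsClosed {t : ℝ | ‖bilinearAverage μ (t * (2 : ℝ) ^ l) f g x‖ₑ ≤
        ⨆ t ∈ E', ‖bilinearAverage μ (t * (2 : ℝ) ^ l) f g x‖ₑ} :=
      isClosed_le (hc.comp (by fun_prop)).enorm continuous_const
    refine closure_minimal (fun t ht => ?_) hcl (hEE' ht)
    exact le_iSup₂ (f := fun t (_ : t ∈ E') => ‖bilinearAverage μ (t * (2 : ℝ) ^ l) f g x‖ₑ) t ht
  simp only [multiScaleMaximal, h, key]
  exact ((Equiv.subRight c).iSup_comp (g := fun l => averageMax μ (scaleSet E' l) f g x)).symm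

/-- Sparse domination of the multi-scale maximal operator at interior points of the improving
region of the single-scale maximal operator. -/
theorem hasSparseDomination_multiScaleMaximal {d : ℕ} (hd : 1 ≤ d) {E : Set ℝ}
    (hE : E ⊆ Set.Icc 1 2) {β : ℝ} (hβ : upperMinkowskiDim E = (β : EReal))
    {μ : Measure (Rd d × Rd d)} [IsFiniteMeasure μ] (hμ : IsCompactlySupported μ)
    {a : ℝ} (ha : IsAdmissible μ a) (haβ : (d : ℝ) + β < 2 * a) {p q r : ℝ}
    (hpqr : (1 / p, 1 / q, 1 / r) ∈ interior (improvingRegion μ E))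
    (hr : 1 < r) (hpr : p ≤ r) (hqr : q ≤ r) :
    HasSparseDomination (multiScaleMaximal (fourierMeasure μ) E) p q (r / (r - 1)) := by
  -- The countable dense subset must lie inside `E`, so that the bounds assumed for `E` pass to it.
  obtain ⟨E', hE', hE'c, hEE'⟩ : ∃ E' ⊆ E, E'.Countable ∧ E ⊆ closure E' :=
    (TopologicalSpace.IsSeparable.of_separableSpace E).exists_countable_dense_subset
  obtain ⟨hp, hq, c, ε, C, hε, H⟩ :=
    exists_isLocalizedFamily hE hE' hE'c hβ hμ ha haβ hpqr hr
  obtain ⟨C', hC'⟩ := exists_sparse_bound hd H hε hp hq hr hpr hqr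
  have h3 : (1 : ℝ) ≤ 3 ^ d := one_le_pow₀ (by norm_num)
  have h3' : ((3 : ℝ) ^ d)⁻¹ ≤ 1 := inv_le_one_of_one_le₀ h3
  refine ⟨((3 : ℝ) ^ d)⁻¹ / 2, by positivity, by linarith, C', fun f g h hf hg hh => ?_⟩
  have hfb := hf.isBddCompact
  have hgb := hg.isBddCompact
  have hhb := hh.isBddCompact
  have hM : multiScaleMaximal (fourierMeasure μ) E f g =
      fun x => ⨆ k : ℤ, averageMax μ (scaleSet E' (k - c)) f g x :=
    funext (multiScaleMaximal_eq μ hE' hEE' hf hg c)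
  obtain ⟨-, M₁, hM₁, -⟩ := id hfb
  obtain ⟨-, M₂, hM₂, -⟩ := id hgb
  set B : ℝ≥0∞ := ENNReal.ofReal M₁ * ENNReal.ofReal M₂ * μ Set.univ
  have hB : B ≠ ∞ :=
    ENNReal.mul_ne_top (ENNReal.mul_ne_top (by simp) (by simp)) (measure_ne_top _ _)
  have hle : ∀ x, multiScaleMaximal (fourierMeasure μ) E f g x ≤ B := fun x => by
    rw [hM]
    refine iSup_le fun k => averageMax_le_const μ _ (fun x => ?_) (fun x => ?_) x
    · rw [← ofReal_norm]; exact ENNReal.ofReal_le_ofReal (hM₁ x)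
    · rw [← ofReal_norm]; exact ENNReal.ofReal_le_ofReal (hM₂ x)
  have hne : ∀ x, multiScaleMaximal (fourierMeasure μ) E f g x ≠ ∞ := fun x =>
    ne_top_of_le_ne_top hB (hle x)
  have hmeas : Measurable (multiScaleMaximal (fourierMeasure μ) E f g) := by
    rw [hM]
    exact Measurable.iSup fun k => measurable_averageMax μ (H.countable k) hfb.1 hgb.1
  refine ⟨Eventually.of_forall hne, ?_, ?_⟩
  · have hhi : Integrable fun x => conj (h x) := by
      have : Integrable h := hh.1.continuous.integrable_of_hasCompactSupport hh.2
      exact (Complex.conjLIE.toLinearIsometry.toContinuousLinearMap).integrable_comp this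
    refine hhi.bdd_mul (c := B.toReal) ?_ (Eventually.of_forall fun x => ?_)
    · exact (Complex.measurable_ofReal.comp hmeas.ennreal_toReal).aestronglyMeasurable
    · rw [Complex.norm_real, Real.norm_of_nonneg ENNReal.toReal_nonneg]
      exact ENNReal.toReal_mono hB (hle x)
  · obtain ⟨S, hS, hb⟩ := hC' f g h hfb hf.1.continuous hgb hg.1.continuous hhb
    refine ⟨S, hS, le_trans ?_ hb⟩
    refine (enorm_integral_le_lintegral_enorm _).trans (le_of_eq (lintegral_congr fun x => ?_))
    have hx := congrFun hM x
    rw [← hx, enorm_mul, RCLike.enorm_conj]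
    congr 1
    rw [← ofReal_norm, Complex.norm_real, Real.norm_of_nonneg ENNReal.toReal_nonneg,
      ENNReal.ofReal_toReal (hne x)]

end BilinearSparse

end

theorem corollary1p6 (d : ℕ) (hd : 1 ≤ d) (E : Set ℝ) (hEne : E.Nonempty)
    (hE : E ⊆ Set.Icc 1 2) (β : ℝ) (hβ : BilinearSparse.upperMinkowskiDim E = (β : EReal))
    (μ : MeasureTheory.Measure (BilinearSparse.Rd d × BilinearSparse.Rd d))
    [MeasureTheory.IsFiniteMeasure μ] (hμ : BilinearSparse.IsCompactlySupported μ)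
    (a : ℝ) (ha : BilinearSparse.IsAdmissible μ a) (haβ : (d : ℝ) + β < 2 * a)
    (p q r : ℝ)
    (hpqr : (1 / p, 1 / q, 1 / r) ∈ interior (BilinearSparse.improvingRegion μ E))
    (hr : 1 < r) (hpr : p ≤ r) (hqr : q ≤ r) :
    BilinearSparse.HasSparseDomination
      (BilinearSparse.multiScaleMaximal (BilinearSparse.fourierMeasure μ) E)
      p q (r / (r - 1)) := by
  exact BilinearSparse.hasSparseDomination_multiScaleMaximal hd hE hβ hμ ha haβ hpqr hr hpr hqr
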